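/- Let $\sigma\in\mathbb R$ and let $\nu$ be a Lévy measure on $\mathbb R$, i.e. $\nu(\{0\})=0$ and $\int 1\wedge|x|^2\,\nu(dx)<\infty$. Assume that $\sigma\neq0$ or $\nu\neq0$, and that $\int_{|x|\ge1}e^{qx}\,\nu(dx)<\infty$ for all $q\in[0,1]$. Put $$a=-\frac{\sigma^2}{2}-\int_{\mathbb R}\bigl(e^x-1-x\mathbf 1_{|x|\le1}\bigr)\,\nu(dx),\qquad \psi(q)=iaq-\tfrac12\sigma^2q^2+\int_{\mathbb R}\bigl(e^{iqx}-1-iqx\mathbf 1_{|x|\le1}\bigr)\,\nu(dx).$$ Let $\Lambda$ be a homogeneous independently scattered random measure on the upper half-plane $\mathbb H$ with Lévy exponent $\psi$ and intensity $\lambda(dx\,dy)=y^{-2}dx\,dy$: for every Borel set $B$ with $\lambda(B)<\infty$ one has $\mathbb E(e^{iq\Lambda(B)})=e^{\psi(q)\lambda(B)}$ for all $q\in\mathbb R$, and for pairwise disjoint Borel sets $B_1,B_2,\dots$ of finite $\lambda$-measure the variables $\Lambda(B_i)$ are independent, with $\Lambda(\bigcup_iB_i)=\sum_i\Lambda(B_i)$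 almost surely when $\lambda(\bigcup_iB_i)<\infty$. Let $I=[0,1]$, $V(t)=\{x+iy\in\mathbb H:-y/2<x-t\le y/2\}$, $V(I)=\bigcap_{t\in I}V(t)$, and, for $\epsilon>0$ and $t\in I$, $V_\epsilon^I(t)=(V(t)\setminus V(I))\cap\{\operatorname{Im}z\ge\epsilon\}$. Let $\mu_\epsilon$ be the random measure $\mu_\epsilon(dt)=e^{\Lambda(V_\epsilon^I(t))}\,dt$ on $I$, where a càdlàg modification in $t$ of the density is used; take a modification of the measure-valued martingale $(\mu_{1/t})_{t>0}$ that is weakly right-continuous, let $\mu$ be its almost sure weak limit as $t\to\infty$, and let $Z=\mu([0,1])$. (1) The following assertions are equivalent: ($\alpha$) $0<\mathbb E(Z^q)<\infty$ for all real $q>1$; ($\beta$) $\sigma=0$, $\nu$ is carried by $(-\infty,0]$, $\int_{-\infty}^0 1\wedge|x|\,\nu(dx)<\infty$, and $$\gamma=\int_{-\infty}^0(1-e^x)\,\nu(dx)\le1.$$ (2) If ($\beta$) holds, then $$\lim_{q\to\infty}\frac{\log\mathbb E(Z^q)}{q\log q}=\gamma .$$ -/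

import Mathlib

open MeasureTheory ProbabilityTheory Filter Set Topology
open scoped UpperHalfPlane ENNReal NNReal

noncomputable section

namespace LogIDCascade

/-! ### Lévy exponents -/

/-- Lévy measures on the line. -/
structure IsLevyMeasure (ν : Measure ℝ) : Prop where
  zero_notAtom : ν {0} = 0
  lintegral_lt_top : ∫⁻ x, ENNReal.ofReal (min 1 (|x| ^ 2)) ∂ν < ⊤

/-- The truncation `x ↦ x 𝟏_{|x| ≤ 1}`. -/
def trunc (x : ℝ) : ℝ := if |x| ≤ 1 then x else 0

/-- The characteristic Lévy exponent
`ψ(q) = i a q - σ² q² / 2 + ∫ (e^{iqx} - 1 - i q x 𝟏_{|x| ≤ 1}) ν(dx)`. -/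
def levyExponent (a σ : ℝ) (ν : Measure ℝ) (q : ℝ) : ℂ :=
  Complex.I * a * q - (1 / 2 : ℂ) * (σ : ℂ) ^ 2 * (q : ℂ) ^ 2
    + ∫ x : ℝ, (Complex.exp (Complex.I * q * x) - 1 - Complex.I * q * (trunc x : ℂ)) ∂ν

/-- The set `I_ν` of real `q` with `∫_{|x| ≥ 1} e^{qx} ν(dx) < ∞`. -/
def expDomain (ν : Measure ℝ) : Set ℝ :=
  {q | ∫⁻ x in {x : ℝ | 1 ≤ |x|}, ENNReal.ofReal (Real.exp (q * x)) ∂ν < ⊤}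

/-- The normalizing drift `a = -σ²/2 - ∫ (e^x - 1 - x 𝟏_{|x| ≤ 1}) ν(dx)`, for which
`E(e^{Λ(B)}) = 1`. -/
def normDrift (σ : ℝ) (ν : Measure ℝ) : ℝ :=
  -(σ ^ 2 / 2) - ∫ x : ℝ, (Real.exp x - 1 - trunc x) ∂ν

/-! ### Independently scattered random measures -/

variable {Ω : Type*} [MeasurableSpace Ω]

/-- `Λ` is, under `P`, a homogeneous independently scattered random measure on `S` with Lévy
exponent `ψ` and intensity `m`.  Only its values on Borel sets of finite intensity matter.  In
`sum`, the series converges almost surely as the limit of its partial sums. -/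
structure IsIndepScattered {S : Type*} [MeasurableSpace S] (P : Measure Ω)
    (ψ : ℝ → ℂ) (m : Measure S) (Λ : Set S → Ω → ℝ) : Prop where
  measurable : ∀ B, MeasurableSet B → m B < ⊤ → Measurable (Λ B)
  charFun_eq : ∀ B, MeasurableSet B → m B < ⊤ → ∀ q : ℝ,
    ∫ ω, Complex.exp (Complex.I * q * (Λ B ω : ℂ)) ∂P = Complex.exp (ψ q * ((m B).toReal : ℂ))
  indep : ∀ B : ℕ → Set S, (∀ i, MeasurableSet (B i)) → (∀ i, m (B i) < ⊤) →
    Pairwise (Function.onFun Disjoint B) → iIndepFun (fun i => Λ (B i)) P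
  sum : ∀ B : ℕ → Set S, (∀ i, MeasurableSet (B i)) → m (⋃ i, B i) < ⊤ →
    Pairwise (Function.onFun Disjoint B) →
    ∀ᵐ ω ∂P, Tendsto (fun n => ∑ i ∈ Finset.range n, Λ (B i) ω) atTop (𝓝 (Λ (⋃ i, B i) ω))

/-! ### Cones in the upper half-plane

The intensity is the hyperbolic area `λ(dx dy) = y⁻² dx dy`, which is `volume` on `ℍ`. -/

/-- The cone `V(t) = {x + iy : -y/2 < x - t ≤ y/2}`. -/
def cone (t : ℝ) : Set ℍ := {z | -(z.im / 2) < z.re - t ∧ z.re - t ≤ z.im / 2}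

/-- `V(J) = ⋂_{t ∈ J} V(t)`. -/
def coneInter (J : Set ℝ) : Set ℍ := ⋂ t ∈ J, cone t

/-- `V_ε^J(t) = (V(t) \ V(J)) ∩ {Im z ≥ ε}`. -/
def truncCone (J : Set ℝ) (ε t : ℝ) : Set ℍ := (cone t \ coneInter J) ∩ {z | ε ≤ z.im}

/-! ### The cascade and its limit -/

/-- `f` is right-continuous with left limits on `[a, b]`. -/
def IsCadlagOn (f : ℝ → ℝ) (a b : ℝ) : Prop :=
  (∀ t ∈ Ico a b, ContinuousWithinAt f (Ici t) t) ∧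
    ∀ t ∈ Ioc a b, ∃ l : ℝ, Tendsto f (𝓝[<] t) (𝓝 l)

/-- `μ` is the limit measure `μ^I`, `I = [a, b]`, of the cascade built on `Λ`.  Here

* `X ε` is a càdlàg modification on `I` of the process `t ↦ Q(V_ε^I(t)) = e^{Λ(V_ε^I(t))}`;
* `M` is a modification of the family of random measures
  `μ_ε^I(dx) = |I|⁻¹ Q(V_ε^I(x)) dx` on `I` such that `t ↦ M (1/t)`, `t > 0`, is almost surely
  weakly right-continuous;
* almost surely, `M (1/t)` converges weakly to `μ` as `t → ∞`. -/
structure IsCascadeLimit (P : Measure Ω) (Λ : Set ℍ → Ω → ℝ) (a b : ℝ)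
    (X : ℝ → ℝ → Ω → ℝ) (M : ℝ → Ω → FiniteMeasure ℝ) (μ : Ω → FiniteMeasure ℝ) : Prop where
  modification : ∀ ε > 0, ∀ t ∈ Icc a b,
    ∀ᵐ ω ∂P, X ε t ω = Real.exp (Λ (truncCone (Icc a b) ε t) ω)
  cadlag : ∀ ε > 0, ∀ᵐ ω ∂P, IsCadlagOn (fun t => X ε t ω) a b
  density : ∀ ε > 0, ∀ᵐ ω ∂P, (M ε ω : Measure ℝ) =
    (volume.restrict (Icc a b)).withDensity (fun x => ENNReal.ofReal (1 / (b - a) * X ε x ω))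
  rightContinuous : ∀ᵐ ω ∂P, ∀ s > 0, ContinuousWithinAt (fun t : ℝ => M (1 / t) ω) (Ici s) s
  tendsto : ∀ᵐ ω ∂P, Tendsto (fun t : ℝ => M (1 / t) ω) atTop (𝓝 (μ ω))

/-- The moment `E(Z^q) ∈ [0, ∞]` of the total mass `Z = ‖μ‖`. -/
def massMoment (P : Measure Ω) (μ : Ω → FiniteMeasure ℝ) (q : ℝ) : ℝ≥0∞ :=
  ∫⁻ ω, ((μ ω).mass : ℝ≥0∞) ^ q ∂P

/-- `γ = ∫_{(-∞,0]} (1 - e^x) ν(dx)`. -/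
def gam (ν : Measure ℝ) : ℝ := ∫ x in Iic (0 : ℝ), (1 - Real.exp x) ∂ν

/-- `σ = 0`, `ν` is carried by `(-∞, 0]`, `∫_{(-∞,0]} 1 ∧ |x| ν(dx) < ∞`, and `γ ≤ 1`. -/
def SubcriticalNegative (σ : ℝ) (ν : Measure ℝ) : Prop :=
  σ = 0 ∧ ν (Ioi 0) = 0 ∧ ∫⁻ x in Iic (0 : ℝ), ENNReal.ofReal (min 1 |x|) ∂ν < ⊤ ∧ gam ν ≤ 1

end LogIDCascade

end

/-!
The total mass `Z` of the limit of a log-infinitely divisible cascade on `[0, 1]` has finite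
moments of all orders exactly when the jumps are negative, of finite variation and of total
intensity `γ ≤ 1`, and then `log E(Z^q) ∼ γ q log q`.

*All moments finite implies the structural conditions.*  Over `[0, 1/2]` the cones have a common
part `C` of intensity `log 2`, and after removing it and dilating by two the cascade over
`[0, 1/2]` is the cascade over `[0, 1]`.  So `Z` dominates `e^{Λ(C)} Z' / 2` with `Z'` a copy of `Z`
independent of `Λ(C)`, whence `E e^{qΛ(C)} ≤ 2^q` for all `q > 1`, and `Λ(C) ≤ log 2` almost surely.
Cutting a set of intensity `log 2` into equal independent pieces gives `Λ(B) ≤ λ(B)` for sets of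
intensity `log 2 / n` (`IsCascadeLimit.smallTimeBounded`).  Moreover `E e^{Λ(B)} ≥ 1`, as otherwise
`Z = 0` by Fatou's lemma.  If `Y_τ` has the law of `Λ(B)`, `λ(B) = τ`, these two facts bound
`E f(Y_τ) / τ` from above, while it tends to `σ²/2 f''(0) + ∫ f dν` as `τ → 0`, for smooth compactly
supported `f` vanishing to second order at `0`; the latter is read off the characteristic function
by Fourier inversion (`tendsto_integral_div`).  Suitable `f` yield `ν (0, ∞) = 0`, `σ = 0` and
`∫ (1 - e^x) dν ≤ 1` (`SmallTimeBounded.subcriticalNegative`).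

*The structural conditions imply moment bounds.*  Here `E e^{pΛ(B)} = e^{φ(p) λ(B)}` with
`φ(p) = γ p - ∫ (1 - e^{px}) dν`, by approximation with compound Poisson laws
(`SubcriticalNegative.lintegral_exp_eq`).  The second differences `α_k` of `φ` are nonnegative and
sum to `γ`.  As the points of a finite set whose cones contain a given point of the half-plane are
consecutive, the mixed moment of the truncated densities at `t₁ < … < tₙ` is
`exp ∑_{i<j} α_{j-i-1} λ(V_ε(tᵢ) ∩ V_ε(tⱼ))` (`IsMomentSeq.lintegral_prod_dens`), with intensities
equal to `log (1 / (tⱼ - tᵢ))` for `tⱼ - tᵢ ≥ ε` and at most that in general.  The `n`-th moment of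
the truncated mass is `n!` times the integral of this over ordered points.

* For the upper bound a new point contributes at most `u^{-α₀} (u + v)^{-(γ - α₀)}`, where `u` and
  `v` are the last two spacings.  Multiplied by `e^{Nu} (Nu)^{-(1-γ)} ≥ 1`, this becomes a scale
  invariant kernel with an integral operator of bounded norm on the weight `v^{-(γ - α₀)/2}`, and
  each point costs a factor `C N^{-(1-γ)}`; take `N = n` (`IsCascadeLimit.orderedMoment_le`).
* For the lower bound the points are confined to `n` boxes of length `1/(2n)`, and only pairs with
  index distance at most `R` are kept (`IsCascadeLimit.le_orderedMoment`).

Both bounds are uniform in the truncation and pass to the limit, the upper bounds giving uniform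
integrability.
-/

noncomputable section

namespace LogIDCascade

section

/-! ### Finite families of values of an independently scattered measure -/

/-- The atom of the finite family `B` indexed by `s`: the points which belong to `B i` exactly for
`i ∈ s`.  The atom of `s = ∅` is set to be empty, since the complement of `⋃ i, B i` may have
infinite intensity. -/
def atom {S ι : Type*} (B : ι → Set S) (s : Finset ι) : Set S :=
  {z | s.Nonempty ∧ ∀ i, z ∈ B i ↔ i ∈ s}

section atoms

variable {S ι : Type*}

lemma atom_disjoint (B : ι → Set S) :
    Pairwise (Function.onFun Disjoint (atom B)) := by
  intro s t hst
  refine Set.disjoint_left.2 fun z hz hz' => hst ?_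
  ext i
  rw [← hz.2 i, ← hz'.2 i]

lemma atom_subset (B : ι → Set S) {s : Finset ι} {i : ι} (hi : i ∈ s) : atom B s ⊆ B i :=
  fun _ hz => (hz.2 i).2 hi

lemma measurableSet_atom [Fintype ι] [MeasurableSpace S] {B : ι → Set S}
    (hB : ∀ i, MeasurableSet (B i)) (s : Finset ι) : MeasurableSet (atom B s) := by
  have : atom B s = {_z | s.Nonempty} ∩ ⋂ i, {z | z ∈ B i ↔ i ∈ s} := by
    ext z
    simp [atom]
  rw [this]
  exact (MeasurableSet.const _).inter
    (MeasurableSet.iInter fun i => (hB i).iff (MeasurableSet.const _))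

lemma measure_atom_lt_top [MeasurableSpace S] {m : Measure S} {B : ι → Set S}
    (hB : ∀ i, m (B i) < ⊤) (s : Finset ι) : m (atom B s) < ⊤ := by
  by_cases hs : s.Nonempty
  · obtain ⟨i, hi⟩ := hs
    exact (measure_mono (atom_subset B hi)).trans_lt (hB i)
  · simp [atom, hs]

lemma iUnion_atom [Fintype ι] [DecidableEq ι] (B : ι → Set S) (i : ι) :
    ⋃ s ∈ Finset.univ.filter (fun s : Finset ι => i ∈ s), atom B s = B i := by
  classical
  ext z
  simp only [Finset.mem_filter, Finset.mem_univ, true_and, mem_iUnion]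
  constructor
  · rintro ⟨s, hs, hz⟩
    exact atom_subset B hs hz
  · intro hz
    refine ⟨Finset.univ.filter (fun j => z ∈ B j), by simpa using hz, ⟨i, by simpa using hz⟩, ?_⟩
    simp

end atoms

namespace IsIndepScattered

variable {Ω : Type*} [MeasurableSpace Ω] {S : Type*} [MeasurableSpace S] {P : Measure Ω}
  {ψ : ℝ → ℂ} {m : Measure S} {Λ : Set S → Ω → ℝ}

lemma empty_ae (h : IsIndepScattered P ψ m Λ) : ∀ᵐ ω ∂P, Λ ∅ ω = 0 := by
  have := h.sum (fun _ => ∅) (fun _ => MeasurableSet.empty) (by simp) (fun _ _ _ => by simp)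
  filter_upwards [this] with ω hω
  simp only [Finset.sum_const, Finset.card_range, nsmul_eq_mul, iUnion_empty] at hω
  have h2 := (hω.comp (tendsto_add_atTop_nat 1)).sub hω
  simp only [Function.comp_def, Nat.cast_add, Nat.cast_one, sub_self] at h2
  have h3 : Tendsto (fun _ : ℕ => Λ ∅ ω) atTop (𝓝 0) := by
    refine h2.congr fun n => by ring
  exact tendsto_nhds_unique tendsto_const_nhds h3

lemma charFun_map (h : IsIndepScattered P ψ m Λ) {B : Set S} (hB : MeasurableSet B)
    (hm : m B < ⊤) (q : ℝ) :
    charFun (P.map (Λ B)) q = Complex.exp (ψ q * ((m B).toReal : ℂ)) := by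
  rw [charFun_apply_real, integral_map (h.measurable B hB hm).aemeasurable (by fun_prop),
    ← h.charFun_eq B hB hm q]
  congr 1
  ext ω
  congr 1
  ring

/-- The law of `Λ(B)` depends only on the intensity of `B`. -/
lemma map_eq [IsProbabilityMeasure P] (h : IsIndepScattered P ψ m Λ) {B B' : Set S}
    (hB : MeasurableSet B) (hB' : MeasurableSet B') (hm : m B < ⊤) (heq : m B = m B') :
    P.map (Λ B) = P.map (Λ B') := by
  have h1 := h.measurable B hB hm
  have h2 := h.measurable B' hB' (heq ▸ hm)
  have := Measure.isProbabilityMeasure_map (μ := P) h1.aemeasurable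
  have := Measure.isProbabilityMeasure_map (μ := P) h2.aemeasurable
  refine Measure.ext_of_charFun ?_
  ext q
  rw [h.charFun_map hB hm, h.charFun_map hB' (heq ▸ hm), heq]

lemma union_ae (h : IsIndepScattered P ψ m Λ) {A B : Set S} (hA : MeasurableSet A)
    (hB : MeasurableSet B) (hAm : m A < ⊤) (hBm : m B < ⊤) (hd : Disjoint A B) :
    ∀ᵐ ω ∂P, Λ (A ∪ B) ω = Λ A ω + Λ B ω := by
  let C : ℕ → Set S := fun n => if n = 0 then A else if n = 1 then B else ∅
  have hU : ⋃ n, C n = A ∪ B := by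
    ext z
    simp only [mem_iUnion, mem_union]
    constructor
    · rintro ⟨n, hn⟩
      by_cases h0 : n = 0
      · left; simpa [C, h0] using hn
      · by_cases h1 : n = 1
        · right; simpa [C, h1] using hn
        · simp [C, h0, h1] at hn
    · rintro (hz | hz)
      · exact ⟨0, by simpa [C] using hz⟩
      · exact ⟨1, by simpa [C] using hz⟩
  have hCd : Pairwise (Function.onFun Disjoint C) := by
    intro i j hij
    simp only [Function.onFun, C]
    split_ifs <;> first | omega | simp [hd.symm]
  have := h.sum C (fun n => by simp only [C]; split_ifs <;> simp [hA, hB])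
    (by rw [hU]; exact (measure_union_le _ _).trans_lt (ENNReal.add_lt_top.2 ⟨hAm, hBm⟩)) hCd
  rw [hU] at this
  filter_upwards [this, h.empty_ae] with ω hω h0
  refine tendsto_nhds_unique hω (tendsto_const_nhds.congr' ?_)
  filter_upwards [eventually_ge_atTop 2] with n hn
  obtain ⟨k, rfl⟩ := Nat.exists_eq_add_of_le hn
  rw [Finset.sum_range_add, Finset.sum_range_succ, Finset.sum_range_one]
  have : ∑ x ∈ Finset.range k, Λ (C (2 + x)) ω = 0 :=
    Finset.sum_eq_zero fun x _ => by
      simp only [C]; rw [if_neg (by omega), if_neg (by omega), h0]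
  rw [this]
  simp [C]

lemma biUnion_ae {ι : Type*} (h : IsIndepScattered P ψ m Λ) {A : ι → Set S}
    (hA : ∀ i, MeasurableSet (A i)) (hm : ∀ i, m (A i) < ⊤)
    (hd : Pairwise (Function.onFun Disjoint A)) (s : Finset ι) :
    ∀ᵐ ω ∂P, Λ (⋃ i ∈ s, A i) ω = ∑ i ∈ s, Λ (A i) ω := by
  classical
  induction s using Finset.induction_on with
  | empty => simpa using h.empty_ae
  | insert a s ha ih =>
    rw [Finset.set_biUnion_insert]
    have hfin : m (⋃ i ∈ s, A i) < ⊤ :=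
      (measure_biUnion_finset_le s _).trans_lt (ENNReal.sum_lt_top.2 fun i _ => hm i)
    have hdis : Disjoint (A a) (⋃ i ∈ s, A i) := by
      simp only [disjoint_iUnion_right]
      intro i hi
      exact hd (fun hai => ha (hai ▸ hi))
    filter_upwards [ih, h.union_ae (hA a) (s.measurableSet_biUnion fun i _ => hA i) (hm a) hfin
      hdis] with ω h1 h2
    rw [h2, h1, Finset.sum_insert ha]

lemma iIndepFun_of_finite {ι : Type*} [Fintype ι] (h : IsIndepScattered P ψ m Λ) {A : ι → Set S}
    (hA : ∀ i, MeasurableSet (A i)) (hm : ∀ i, m (A i) < ⊤)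
    (hd : Pairwise (Function.onFun Disjoint A)) : iIndepFun (fun i => Λ (A i)) P := by
  let e := Fintype.equivFin ι
  let B : ℕ → Set S := fun n =>
    if hn : n < Fintype.card ι then A (e.symm ⟨n, hn⟩) else ∅
  have hBe : ∀ i, B (e i) = A i := fun i => by simp [B]
  have := h.indep B (fun n => by simp only [B]; split_ifs <;> simp [hA])
    (fun n => by simp only [B]; split_ifs <;> simp [hm]) (by
      intro i j hij
      simp only [Function.onFun, B]
      split_ifs with h1 h2
      · apply hd
        intro heq
        apply hij
        simpa using heq
      all_goals simp)
  have h2 := this.precomp (g := fun i : ι => (e i : ℕ))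
    (fun i j hij => e.injective (Fin.ext hij))
  simpa [hBe] using h2

variable {ι : Type*} [Fintype ι] [DecidableEq ι]

lemma eq_sum_atom_ae (h : IsIndepScattered P ψ m Λ) {B : ι → Set S}
    (hB : ∀ i, MeasurableSet (B i)) (hm : ∀ i, m (B i) < ⊤) :
    ∀ᵐ ω ∂P, ∀ i, Λ (B i) ω = ∑ s : Finset ι, if i ∈ s then Λ (atom B s) ω else 0 := by
  refine ae_all_iff.2 fun i => ?_
  filter_upwards [h.biUnion_ae (measurableSet_atom hB) (measure_atom_lt_top hm) (atom_disjoint B)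
    (Finset.univ.filter (fun s : Finset ι => i ∈ s))] with ω hω
  rw [iUnion_atom] at hω
  rw [hω, Finset.sum_filter]

/-- The joint law of finitely many values of `Λ` depends only on the intensities of the atoms of the
family. -/
lemma map_pi_eq [IsProbabilityMeasure P] (h : IsIndepScattered P ψ m Λ) {B B' : ι → Set S}
    (hB : ∀ i, MeasurableSet (B i)) (hB' : ∀ i, MeasurableSet (B' i)) (hm : ∀ i, m (B i) < ⊤)
    (hm' : ∀ i, m (B' i) < ⊤) (heq : ∀ s, m (atom B s) = m (atom B' s)) :
    P.map (fun ω i => Λ (B i) ω) = P.map (fun ω i => Λ (B' i) ω) := by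
  let F : (Finset ι → ℝ) → ι → ℝ := fun x i => ∑ s : Finset ι, if i ∈ s then x s else 0
  have hF : Measurable F := by
    refine measurable_pi_lambda _ fun i => Finset.measurable_sum _ fun s _ => ?_
    split_ifs <;> fun_prop
  have key : ∀ B : ι → Set S, (∀ i, MeasurableSet (B i)) → (∀ i, m (B i) < ⊤) →
      P.map (fun ω i => Λ (B i) ω)
        = (Measure.pi fun s => P.map (Λ (atom B s))).map F := by
    intro B hB hm
    have hmeas : ∀ s, Measurable (Λ (atom B s)) := fun s =>
      h.measurable _ (measurableSet_atom hB s) (measure_atom_lt_top hm s)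
    rw [← (h.iIndepFun_of_finite (measurableSet_atom hB) (measure_atom_lt_top hm)
      (atom_disjoint B)).map_fun_eq_pi_map (fun s => (hmeas s).aemeasurable),
      Measure.map_map hF (by fun_prop)]
    refine Measure.map_congr ?_
    filter_upwards [h.eq_sum_atom_ae hB hm] with ω hω
    ext i
    exact hω i
  rw [key B hB hm, key B' hB' hm']
  congr 2
  ext1 s
  exact h.map_eq (measurableSet_atom hB s) (measurableSet_atom hB' s) (measure_atom_lt_top hm s)
    (heq s)

lemma indepFun_pi (h : IsIndepScattered P ψ m Λ) {B : ι → Set S} {C : Set S}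
    (hB : ∀ i, MeasurableSet (B i)) (hm : ∀ i, m (B i) < ⊤) (hC : MeasurableSet C)
    (hCm : m C < ⊤) (hd : ∀ i, Disjoint C (B i)) :
    IndepFun (Λ C) (fun ω i => Λ (B i) ω) P := by
  let A : Option (Finset ι) → Set S := fun o => o.elim C (atom B)
  have hA : ∀ o, MeasurableSet (A o) := by
    rintro (_ | s)
    · exact hC
    · exact measurableSet_atom hB s
  have hAm : ∀ o, m (A o) < ⊤ := by
    rintro (_ | s)
    · exact hCm
    · exact measure_atom_lt_top hm s
  have hCs : ∀ s, Disjoint C (atom B s) := fun s => by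
    by_cases hs : s.Nonempty
    · obtain ⟨i, hi⟩ := hs
      exact (hd i).mono_right (atom_subset B hi)
    · simp [atom, hs]
  have hAd : Pairwise (Function.onFun Disjoint A) := by
    rintro (_ | s) (_ | t) hst
    · exact absurd rfl hst
    · exact hCs t
    · exact (hCs s).symm
    · exact atom_disjoint B (fun hs => hst (by rw [hs]))
  have hmeas : ∀ o, Measurable (Λ (A o)) := fun o => h.measurable _ (hA o) (hAm o)
  have hi := (h.iIndepFun_of_finite hA hAm hAd).indepFun_finset {none}
    (Finset.univ.filter (fun o => o ≠ none)) (by simp) hmeas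
  have hs : ∀ s : Finset ι, (some s : Option (Finset ι)) ∈
      (Finset.univ.filter (fun o : Option (Finset ι) => o ≠ none)) := by simp
  let T : Finset (Option (Finset ι)) := Finset.univ.filter (fun o => o ≠ none)
  let f : (({none} : Finset (Option (Finset ι))) → ℝ) → ℝ := fun x => x ⟨none, by simp⟩
  let g : (T → ℝ) → ι → ℝ := fun x i => ∑ s : Finset ι, if i ∈ s then x ⟨some s, hs s⟩ else 0
  have hg : Measurable g := by
    refine measurable_pi_lambda _ fun i => Finset.measurable_sum _ fun s _ => ?_
    split_ifs <;> fun_prop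
  have h3 := hi.comp (φ := f) (ψ := g) (by fun_prop) hg
  refine h3.congr (ae_of_all _ fun ω => rfl) ?_
  filter_upwards [h.eq_sum_atom_ae hB hm] with ω hω
  ext i
  exact (hω i).symm

/-- Mixed exponential moments: `E ∏ᵢ e^{Λ(Bᵢ)} = exp ∑ₛ φ(|s|) m(atom s)`. -/
lemma lintegral_prod_exp (h : IsIndepScattered P ψ m Λ) {φ : ℕ → ℝ}
    (hφ : ∀ k : ℕ, ∀ A, MeasurableSet A → m A < ⊤ →
      ∫⁻ ω, ENNReal.ofReal (Real.exp (k * Λ A ω)) ∂P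
        = ENNReal.ofReal (Real.exp (φ k * (m A).toReal)))
    {B : ι → Set S} (hB : ∀ i, MeasurableSet (B i)) (hm : ∀ i, m (B i) < ⊤) :
    ∫⁻ ω, ∏ i, ENNReal.ofReal (Real.exp (Λ (B i) ω)) ∂P
      = ENNReal.ofReal (Real.exp (∑ s : Finset ι, φ s.card * (m (atom B s)).toReal)) := by
  have hmeas : ∀ s, Measurable (Λ (atom B s)) := fun s =>
    h.measurable _ (measurableSet_atom hB s) (measure_atom_lt_top hm s)
  have h1 : ∫⁻ ω, ∏ i, ENNReal.ofReal (Real.exp (Λ (B i) ω)) ∂P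
      = ∫⁻ ω, ∏ s : Finset ι, ENNReal.ofReal (Real.exp (s.card * Λ (atom B s) ω)) ∂P := by
    refine lintegral_congr_ae ?_
    filter_upwards [h.eq_sum_atom_ae hB hm] with ω hω
    rw [← ENNReal.ofReal_prod_of_nonneg (fun _ _ => (Real.exp_pos _).le),
      ← ENNReal.ofReal_prod_of_nonneg (fun _ _ => (Real.exp_pos _).le), ← Real.exp_sum,
      ← Real.exp_sum]
    congr 2
    simp_rw [hω]
    rw [Finset.sum_comm]
    refine Finset.sum_congr rfl fun s _ => ?_
    rw [← Finset.sum_filter]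
    simp
  have hind := (h.iIndepFun_of_finite (measurableSet_atom hB) (measure_atom_lt_top hm)
    (atom_disjoint B)).comp (fun s x => ENNReal.ofReal (Real.exp (s.card * x)))
    (fun s => by fun_prop)
  have h2 := lintegral_prod_eq_prod_lintegral_of_indepFun Finset.univ _ hind
    (fun s => by have := hmeas s; simp only [Function.comp_def]; fun_prop)
  simp only [Function.comp_def] at h2
  rw [h1, h2]
  rw [Finset.prod_congr rfl fun s _ => hφ s.card _ (measurableSet_atom hB s)
    (measure_atom_lt_top hm s),
    ← ENNReal.ofReal_prod_of_nonneg (fun _ _ => (Real.exp_pos _).le), ← Real.exp_sum]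

end IsIndepScattered

end

section

/-! ### Hyperbolic areas of cones -/

lemma measurable_re : Measurable (fun z : ℍ => z.re) :=
  Complex.measurable_re.comp UpperHalfPlane.measurable_coe

lemma measurable_im : Measurable (fun z : ℍ => z.im) :=
  Complex.measurable_im.comp UpperHalfPlane.measurable_coe

/-- Hyperbolic area as an integral of the lengths of horizontal slices. -/
lemma volume_eq_lintegral_slices {T : Set (ℝ × ℝ)} (hT : MeasurableSet T) :
    volume {z : ℍ | (z.re, z.im) ∈ T}
      = ∫⁻ y in Ioi (0 : ℝ), ENNReal.ofReal (1 / y ^ 2) * volume {x | (x, y) ∈ T} := by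
  rw [UpperHalfPlane.volume_eq_lintegral]
  let T' : Set (ℝ × ℝ) := T ∩ {q | 0 < q.2}
  have hT' : MeasurableSet T' := hT.inter (measurableSet_lt measurable_const measurable_snd)
  have himg : (UpperHalfPlane.coe '' {z : ℍ | (z.re, z.im) ∈ T})
      = Complex.measurableEquivRealProd ⁻¹' T' := by
    ext w
    simp only [mem_image, mem_ofPred_eq, mem_preimage, Complex.measurableEquivRealProd_apply, T',
      mem_inter_iff]
    constructor
    · rintro ⟨z, hz, rfl⟩
      exact ⟨hz, z.im_pos⟩
    · rintro ⟨h1, h2⟩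
      exact ⟨⟨w, h2⟩, h1, rfl⟩
  rw [himg]
  have hf : Measurable (fun q : ℝ × ℝ => ENNReal.ofReal (1 / q.2 ^ 2)) := by fun_prop
  have h1 : ∫⁻ z in Complex.measurableEquivRealProd ⁻¹' T',
      (((1 / ‖z.im‖₊) ^ 2 : NNReal) : ℝ≥0∞)
      = ∫⁻ q in T', ENNReal.ofReal (1 / q.2 ^ 2) := by
    rw [← Complex.volume_preserving_equiv_real_prod.setLIntegral_comp_preimage hT' hf]
    refine lintegral_congr fun z => ?_
    rw [← ENNReal.ofReal_coe_nnreal]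
    congr 1
    simp [Complex.measurableEquivRealProd_apply]
  rw [h1, ← lintegral_indicator hT', Measure.volume_eq_prod,
    lintegral_prod_symm' _ (hf.indicator hT'), ← lintegral_indicator measurableSet_Ioi]
  refine lintegral_congr fun y => ?_
  by_cases hy : 0 < y
  · rw [indicator_of_mem (by exact hy)]
    have hm : MeasurableSet {x | (x, y) ∈ T} := measurable_prodMk_right hT
    rw [← lintegral_indicator_const hm]
    refine lintegral_congr fun x => ?_
    by_cases hx : (x, y) ∈ T
    · rw [indicator_of_mem (by exact ⟨hx, hy⟩), indicator_of_mem (by exact hx)]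
    · rw [indicator_of_notMem (fun h => hx h.1), indicator_of_notMem (by exact hx)]
  · rw [indicator_of_notMem (by exact hy)]
    refine lintegral_eq_zero_of_ae_eq_zero (ae_of_all _ fun x => ?_)
    exact indicator_of_notMem (fun h => hy h.2) _

lemma mem_cone_iff {t : ℝ} {z : ℍ} :
    z ∈ cone t ↔ t - z.im / 2 < z.re ∧ z.re ≤ t + z.im / 2 := by
  simp only [cone, mem_ofPred_eq]
  constructor <;> rintro ⟨h1, h2⟩ <;> constructor <;> linarith

lemma mem_coneInter_Icc_iff {b : ℝ} (hb : 0 ≤ b) {z : ℍ} :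
    z ∈ coneInter (Icc 0 b) ↔ b - z.im / 2 < z.re ∧ z.re ≤ z.im / 2 := by
  simp only [coneInter, mem_iInter, mem_cone_iff, mem_Icc]
  constructor
  · intro h
    have h1 := h b ⟨hb, le_rfl⟩
    have h2 := h 0 ⟨le_rfl, hb⟩
    exact ⟨h1.1, by linarith [h2.2]⟩
  · rintro ⟨h1, h2⟩ t ⟨h3, h4⟩
    constructor <;> linarith

lemma measurableSet_cone (t : ℝ) : MeasurableSet (cone t) := by
  have : cone t = {z : ℍ | t - z.im / 2 < z.re} ∩ {z : ℍ | z.re ≤ t + z.im / 2} := by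
    ext z; exact mem_cone_iff
  rw [this]
  have h1 := measurable_re
  have h2 := measurable_im
  exact (measurableSet_lt (by fun_prop) h1).inter (measurableSet_le h1 (by fun_prop))

lemma measurableSet_coneInter {b : ℝ} (hb : 0 ≤ b) : MeasurableSet (coneInter (Icc 0 b)) := by
  have : coneInter (Icc 0 b) = {z : ℍ | b - z.im / 2 < z.re} ∩ {z : ℍ | z.re ≤ z.im / 2} := by
    ext z; exact mem_coneInter_Icc_iff hb
  rw [this]
  have h1 := measurable_re
  have h2 := measurable_im
  exact (measurableSet_lt (by fun_prop) h1).inter (measurableSet_le h1 (by fun_prop))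

lemma measurableSet_truncCone {b : ℝ} (hb : 0 ≤ b) (ε t : ℝ) :
    MeasurableSet (truncCone (Icc 0 b) ε t) :=
  ((measurableSet_cone t).diff (measurableSet_coneInter hb)).inter
    (measurableSet_le measurable_const measurable_im)

/-- Integral against `y⁻² dy` of the widths of the horizontal slices of an intersection of two
cones. -/
lemma lintegral_slice {l b : ℝ} (hlb : l ≤ b) (hb : 0 < b) (hb1 : b ≤ 1) :
    ∫⁻ y in Ici b, ENNReal.ofReal (1 / y ^ 2) * ENNReal.ofReal (max (y - l) 0 - max (y - 1) 0)
      = ENNReal.ofReal (1 - l / b + Real.log (1 / b)) := by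
  have hsplit : Ioi b = Ioc b 1 ∪ Ioi 1 := (Ioc_union_Ioi_eq_Ioi hb1).symm
  rw [setLIntegral_congr Ioi_ae_eq_Ici.symm, hsplit,
    lintegral_union measurableSet_Ioi (by
      rw [Set.disjoint_left]; intro x hx hx'; exact absurd hx.2 (not_le.2 hx'))]
  have h1 : ∫⁻ y in Ioc b 1,
      ENNReal.ofReal (1 / y ^ 2) * ENNReal.ofReal (max (y - l) 0 - max (y - 1) 0)
      = ENNReal.ofReal (Real.log (1 / b) + l - l / b) := by
    have e1 : ∫⁻ y in Ioc b 1,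
        ENNReal.ofReal (1 / y ^ 2) * ENNReal.ofReal (max (y - l) 0 - max (y - 1) 0)
        = ∫⁻ y in Ioc b 1, ENNReal.ofReal (1 / y - l / y ^ 2) := by
      refine setLIntegral_congr_fun measurableSet_Ioc fun y hy => ?_
      have hy0 : 0 < y := hb.trans hy.1
      rw [← ENNReal.ofReal_mul (by positivity), max_eq_left (by linarith [hy.1]),
        max_eq_right (by linarith [hy.2])]
      congr 1
      field_simp
      ring
    have hcont : ContinuousOn (fun y : ℝ => 1 / y - l / y ^ 2) (uIcc b 1) := by
      rw [uIcc_of_le hb1]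
      intro y hy
      have hy0 : y ≠ 0 := (hb.trans_le hy.1).ne'
      have : ContinuousAt (fun y : ℝ => 1 / y - l / y ^ 2) y := by
        fun_prop (disch := positivity)
      exact this.continuousWithinAt
    have hint := hcont.intervalIntegrable (μ := volume)
    rw [e1, ← ofReal_integral_eq_lintegral_ofReal
      ((intervalIntegrable_iff_integrableOn_Ioc_of_le hb1).1 hint)]
    · congr 1
      rw [← intervalIntegral.integral_of_le hb1,
        intervalIntegral.integral_eq_sub_of_hasDerivAt (f := fun y => Real.log y + l / y)
          (fun y hy => ?_) hint]
      · simp only [Real.log_one, div_one, one_div, Real.log_inv]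
        ring
      · rw [uIcc_of_le hb1] at hy
        have hy0 : y ≠ 0 := (hb.trans_le hy.1).ne'
        have := (Real.hasDerivAt_log hy0).add ((hasDerivAt_const y l).div (hasDerivAt_id y) hy0)
        convert! this using 1
        simp only [id_eq, zero_mul, mul_one, zero_sub]
        ring
    · rw [EventuallyLE, ae_restrict_iff' measurableSet_Ioc]
      refine ae_of_all _ fun y hy => ?_
      have hy0 : 0 < y := hb.trans hy.1
      have : 1 / y - l / y ^ 2 = (y - l) / y ^ 2 := by field_simp
      simp only [Pi.zero_apply, this]
      exact div_nonneg (by linarith [hy.1]) (by positivity)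
  have h2 : ∫⁻ y in Ioi (1 : ℝ),
      ENNReal.ofReal (1 / y ^ 2) * ENNReal.ofReal (max (y - l) 0 - max (y - 1) 0)
      = ENNReal.ofReal (1 - l) := by
    have e1 : ∫⁻ y in Ioi (1 : ℝ),
        ENNReal.ofReal (1 / y ^ 2) * ENNReal.ofReal (max (y - l) 0 - max (y - 1) 0)
        = ∫⁻ y in Ioi (1 : ℝ), ENNReal.ofReal ((1 - l) * y ^ (-2 : ℝ)) := by
      refine setLIntegral_congr_fun measurableSet_Ioi fun y hy => ?_
      have hy1 : (1 : ℝ) < y := hy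
      have hy0 : 0 < y := by linarith
      rw [← ENNReal.ofReal_mul (by positivity), max_eq_left (by linarith),
        max_eq_left (by linarith), Real.rpow_neg hy0.le]
      congr 1
      norm_cast
      field_simp
      ring
    have hint : IntegrableOn (fun y : ℝ => (1 - l) * y ^ (-2 : ℝ)) (Ioi 1) :=
      (integrableOn_Ioi_rpow_of_lt (by norm_num) one_pos).const_mul _
    rw [e1, ← ofReal_integral_eq_lintegral_ofReal hint]
    · rw [integral_const_mul, integral_Ioi_rpow_of_lt (by norm_num) one_pos]
      norm_num
    · rw [EventuallyLE, ae_restrict_iff' measurableSet_Ioi]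
      refine ae_of_all _ fun y hy => ?_
      have hy1 : (1 : ℝ) < y := hy
      simp only [Pi.zero_apply]
      exact mul_nonneg (by linarith) (Real.rpow_nonneg (by linarith) _)
  rw [h1, h2, ← ENNReal.ofReal_add _ (by linarith)]
  · congr 1; ring
  · have hlog : 1 - b ≤ Real.log (1 / b) := by
      rw [one_div, Real.log_inv]
      linarith [Real.log_le_sub_one_of_pos hb]
    have h3 : l / b - l ≤ 1 - b := by
      rw [div_sub' hb.ne', div_le_iff₀ hb]
      nlinarith
    linarith

lemma volume_truncCone_inter_eq {ε s t : ℝ} (hε : 0 < ε) (hs : 0 ≤ s) (hst : s ≤ t) (ht : t ≤ 1) :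
    volume (truncCone (Icc 0 1) ε s ∩ truncCone (Icc 0 1) ε t)
      = ∫⁻ y in Ici ε, ENNReal.ofReal (1 / y ^ 2)
          * ENNReal.ofReal (max (y - (t - s)) 0 - max (y - 1) 0) := by
  let T : Set (ℝ × ℝ) := ({q | ε ≤ q.2} ∩ ({q | t - q.2 / 2 < q.1} ∩ {q | q.1 ≤ s + q.2 / 2})) \
    ({q | 1 - q.2 / 2 < q.1} ∩ {q | q.1 ≤ q.2 / 2})
  have hT : MeasurableSet T := by
    refine ((measurableSet_le (by fun_prop) (by fun_prop)).inter
      ((measurableSet_lt (by fun_prop) (by fun_prop)).inter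
        (measurableSet_le (by fun_prop) (by fun_prop)))).diff
      ((measurableSet_lt (by fun_prop) (by fun_prop)).inter
        (measurableSet_le (by fun_prop) (by fun_prop)))
  have hset : truncCone (Icc 0 1) ε s ∩ truncCone (Icc 0 1) ε t
      = {z : ℍ | (z.re, z.im) ∈ T} := by
    ext z
    simp only [truncCone, mem_inter_iff, Set.mem_sdiff, mem_cone_iff,
      mem_coneInter_Icc_iff zero_le_one, mem_ofPred_eq, T]
    have := z.im_pos
    constructor
    · rintro ⟨⟨⟨h1, h2⟩, h3⟩, ⟨h4, h5⟩, h6⟩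
      exact ⟨⟨h3, h4.1, h1.2⟩, h2⟩
    · rintro ⟨⟨h3, h4, h5⟩, h2⟩
      exact ⟨⟨⟨⟨by linarith, h5⟩, h2⟩, h3⟩, ⟨⟨h4, by linarith⟩, h2⟩, h3⟩
  have hind : ∀ f : ℝ → ℝ≥0∞, ∫⁻ y in Ici ε, f y = ∫⁻ y in Ioi 0, (Ici ε).indicator f y := by
    intro f
    rw [lintegral_indicator measurableSet_Ici, Measure.restrict_restrict measurableSet_Ici]
    congr 2
    refine (inter_eq_left.2 fun y hy => ?_).symm
    exact hε.trans_le (mem_Ici.1 hy)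
  rw [hset, volume_eq_lintegral_slices hT, hind]
  refine setLIntegral_congr_fun measurableSet_Ioi fun y hy => ?_
  by_cases hyε : ε ≤ y
  · rw [indicator_of_mem (by exact hyε)]
    congr 1
    have hsl : {x | (x, y) ∈ T} = Ioc (t - y / 2) (s + y / 2) \ Ioc (1 - y / 2) (y / 2) := by
      ext x
      simp [T, hyε]
    rw [hsl]
    by_cases hy1 : 1 ≤ y
    · rw [measure_sdiff (Ioc_subset_Ioc (by linarith) (by linarith))
        nullMeasurableSet_Ioc (by simp), Real.volume_Ioc, Real.volume_Ioc,
        ← ENNReal.ofReal_sub _ (by linarith), max_eq_left (by linarith),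
        max_eq_left (by linarith)]
      congr 1
      ring
    · rw [Ioc_eq_empty (show ¬ 1 - y / 2 < y / 2 by linarith), sdiff_empty, Real.volume_Ioc,
        max_eq_right (b := (0 : ℝ)) (a := y - 1) (by linarith)]
      by_cases hyl : t - s ≤ y
      · rw [max_eq_left (by linarith)]
        congr 1
        ring
      · rw [max_eq_right (by linarith), ENNReal.ofReal_of_nonpos (by linarith)]
        simp
  · rw [indicator_of_notMem (by exact hyε)]
    have : {x | (x, y) ∈ T} = ∅ := by
      ext x
      simp [T, hyε]
    simp [this]

lemma volume_truncCone {ε t : ℝ} (hε : 0 < ε) (hε1 : ε ≤ 1) (ht : t ∈ Icc (0 : ℝ) 1) :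
    volume (truncCone (Icc 0 1) ε t) = ENNReal.ofReal (1 + Real.log (1 / ε)) := by
  have := volume_truncCone_inter_eq hε ht.1 le_rfl ht.2
  rw [inter_self, sub_self, lintegral_slice hε.le hε hε1] at this
  simpa using this

lemma truncCone_anti {J : Set ℝ} {ε ε' : ℝ} (h : ε ≤ ε') (t : ℝ) :
    truncCone J ε' t ⊆ truncCone J ε t :=
  fun _ hz => ⟨hz.1, h.trans hz.2⟩

lemma volume_truncCone_lt_top {ε t : ℝ} (hε : 0 < ε) (ht : t ∈ Icc (0 : ℝ) 1) :
    volume (truncCone (Icc 0 1) ε t) < ⊤ := by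
  refine (measure_mono (truncCone_anti (min_le_left ε 1) t)).trans_lt ?_
  rw [volume_truncCone (lt_min hε one_pos) (min_le_right _ _) ht]
  exact ENNReal.ofReal_lt_top

/-- The truncated cones are logarithmically correlated: if `ε` is at most the distance of the base
points, their intersection does not depend on the truncation. -/
lemma volume_truncCone_inter {ε s t : ℝ} (hε : 0 < ε) (hs : 0 ≤ s) (hst : s < t) (ht : t ≤ 1)
    (hεl : ε ≤ t - s) :
    volume (truncCone (Icc 0 1) ε s ∩ truncCone (Icc 0 1) ε t)
      = ENNReal.ofReal (Real.log (1 / (t - s))) := by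
  have hl : 0 < t - s := sub_pos.2 hst
  rw [volume_truncCone_inter_eq hε hs hst.le ht, ← Ico_union_Ici_eq_Ici hεl,
    lintegral_union measurableSet_Ici (by
      rw [Set.disjoint_left]; intro x hx hx'; exact absurd hx.2 (not_lt.2 hx')),
    lintegral_slice le_rfl hl (by linarith), div_self hl.ne', sub_self, zero_add]
  have : ∫⁻ y in Ico ε (t - s), ENNReal.ofReal (1 / y ^ 2)
      * ENNReal.ofReal (max (y - (t - s)) 0 - max (y - 1) 0) = 0 := by
    rw [setLIntegral_congr_fun (g := fun _ => 0) measurableSet_Ico fun y hy => ?_]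
    · simp
    · simp only
      rw [max_eq_right (by linarith [hy.2]), max_eq_right (by linarith [hy.2])]
      simp
  rw [this, zero_add]

lemma volume_truncCone_inter_le {ε s t : ℝ} (hε : 0 < ε) (hs : 0 ≤ s) (hst : s < t)
    (ht : t ≤ 1) :
    volume (truncCone (Icc 0 1) ε s ∩ truncCone (Icc 0 1) ε t)
      ≤ ENNReal.ofReal (Real.log (1 / (t - s))) := by
  have hl : 0 < t - s := sub_pos.2 hst
  rw [← volume_truncCone_inter (lt_min hε hl) hs hst ht (min_le_right _ _)]
  exact measure_mono (inter_subset_inter (truncCone_anti (min_le_left _ _) _)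
    (truncCone_anti (min_le_left _ _) _))

/-- A vertical strip above height one; its hyperbolic area is its width. -/
def strip (c d : ℝ) : Set ℍ := {z | 1 ≤ z.im ∧ c < z.re ∧ z.re ≤ d}

lemma measurableSet_strip (c d : ℝ) : MeasurableSet (strip c d) :=
  (measurableSet_le measurable_const measurable_im).inter
    ((measurableSet_lt measurable_const measurable_re).inter
      (measurableSet_le measurable_re measurable_const))

lemma volume_strip (c d : ℝ) : volume (strip c d) = ENNReal.ofReal (d - c) := by
  let T : Set (ℝ × ℝ) := {q | 1 ≤ q.2} ∩ ({q | c < q.1} ∩ {q | q.1 ≤ d})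
  have hT : MeasurableSet T :=
    (measurableSet_le (by fun_prop) (by fun_prop)).inter
      ((measurableSet_lt (by fun_prop) (by fun_prop)).inter
        (measurableSet_le (by fun_prop) (by fun_prop)))
  have := volume_eq_lintegral_slices hT
  have e : ∀ y ∈ Ioi (0 : ℝ), ENNReal.ofReal (1 / y ^ 2) * volume {x | (x, y) ∈ T}
      = (Ici (1 : ℝ)).indicator (fun y => ENNReal.ofReal (d - c)
        * (ENNReal.ofReal (1 / y ^ 2)
          * ENNReal.ofReal (max (y - 0) 0 - max (y - 1) 0))) y := by
    intro y hy
    by_cases hy1 : 1 ≤ y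
    · rw [indicator_of_mem (by exact hy1)]
      have : {x | (x, y) ∈ T} = Ioc c d := by ext x; simp [T, hy1]
      rw [this, Real.volume_Ioc, max_eq_left (by linarith), max_eq_left (by linarith)]
      simp [mul_comm]
    · rw [indicator_of_notMem (by exact hy1)]
      have : {x | (x, y) ∈ T} = ∅ := by ext x; simp [T, hy1]
      simp [this]
  have hsub : Ici (1 : ℝ) ⊆ Ioi 0 := fun y hy => one_pos.trans_le (mem_Ici.1 hy)
  rw [setLIntegral_congr_fun measurableSet_Ioi e, lintegral_indicator measurableSet_Ici,
    Measure.restrict_restrict measurableSet_Ici,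
    inter_eq_left.2 hsub, lintegral_const_mul _ (by fun_prop),
    lintegral_slice zero_le_one one_pos le_rfl] at this
  simpa [T, strip] using this

lemma strip_disjoint {c d c' d' : ℝ} (h : d ≤ c') : Disjoint (strip c d) (strip c' d') :=
  Set.disjoint_left.2 fun _ hz hz' => absurd (hz.2.2.trans h) (not_le.2 hz'.2.1)

lemma strip_union {c d e : ℝ} (h1 : c ≤ d) (h2 : d ≤ e) : strip c d ∪ strip d e = strip c e := by
  ext z
  simp only [strip, mem_union, mem_ofPred_eq]
  constructor
  · rintro (⟨h, h', h''⟩ | ⟨h, h', h''⟩)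
    · exact ⟨h, h', h''.trans h2⟩
    · exact ⟨h, h1.trans_lt h', h''⟩
  · rintro ⟨h, h', h''⟩
    rcases le_or_gt z.re d with hd | hd
    · exact Or.inl ⟨h, h', hd⟩
    · exact Or.inr ⟨h, hd, h''⟩

/-! ### Restriction to the left half of the interval -/

/-- `V([0, 1/2]) \ V([0, 1])`, the part of the cones over `[0, 1/2]` common to all of them. -/
def halfCore : Set ℍ := coneInter (Icc 0 (1 / 2)) \ coneInter (Icc 0 1)

lemma measurableSet_halfCore : MeasurableSet halfCore :=
  (measurableSet_coneInter (by norm_num)).diff (measurableSet_coneInter zero_le_one)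

lemma half_lt_im_of_mem_coneInter {z : ℍ} (hz : z ∈ coneInter (Icc 0 (1 / 2))) :
    1 / 2 < z.im := by
  rw [mem_coneInter_Icc_iff (by norm_num)] at hz
  linarith [hz.1, hz.2]

/-- Over `[0, 1/2]`, the cones of `[0, 1]` differ from those of `[0, 1/2]` by a set which does not
depend on the base point. -/
lemma truncCone_eq_union {ε t : ℝ} (hε : ε ≤ 1 / 2) (ht : t ∈ Icc (0 : ℝ) (1 / 2)) :
    truncCone (Icc 0 1) ε t = halfCore ∪ truncCone (Icc 0 (1 / 2)) ε t := by
  have hsub1 : coneInter (Icc 0 1) ⊆ coneInter (Icc 0 (1 / 2)) :=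
    biInter_subset_biInter_left (Icc_subset_Icc_right (by norm_num))
  have hsub2 : coneInter (Icc 0 (1 / 2)) ⊆ cone t := biInter_subset_of_mem ht
  ext z
  simp only [truncCone, halfCore, mem_union, mem_inter_iff, Set.mem_sdiff, mem_ofPred_eq]
  constructor
  · rintro ⟨⟨h1, h2⟩, h3⟩
    by_cases h : z ∈ coneInter (Icc 0 (1 / 2))
    · exact Or.inl ⟨h, h2⟩
    · exact Or.inr ⟨⟨h1, h⟩, h3⟩
  · rintro (⟨h1, h2⟩ | ⟨⟨h1, h2⟩, h3⟩)
    · exact ⟨⟨hsub2 h1, h2⟩, hε.trans (half_lt_im_of_mem_coneInter h1).le⟩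
    · exact ⟨⟨h1, fun h => h2 (hsub1 h)⟩, h3⟩

lemma halfCore_disjoint (ε t : ℝ) : Disjoint halfCore (truncCone (Icc 0 (1 / 2)) ε t) :=
  Set.disjoint_left.2 fun _ hz hz' => hz'.1.2 hz.1

lemma volume_halfCore : volume halfCore = ENNReal.ofReal (Real.log 2) := by
  have : halfCore = truncCone (Icc 0 1) (1 / 2) 0 ∩ truncCone (Icc 0 1) (1 / 2) (1 / 2) := by
    ext z
    simp only [truncCone, halfCore, mem_inter_iff, Set.mem_sdiff, mem_cone_iff, mem_ofPred_eq,
      mem_coneInter_Icc_iff zero_le_one,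
      mem_coneInter_Icc_iff (show (0 : ℝ) ≤ 1 / 2 by norm_num)]
    have := z.im_pos
    constructor
    · rintro ⟨⟨h1, h2⟩, h3⟩
      refine ⟨⟨⟨⟨?_, ?_⟩, h3⟩, ?_⟩, ⟨⟨h1, ?_⟩, h3⟩, ?_⟩ <;> linarith
    · rintro ⟨⟨⟨h1, h2⟩, h3⟩, ⟨⟨h4, h5⟩, h6⟩⟩
      exact ⟨⟨h4.1, by linarith [h1.2]⟩, h2⟩
  rw [this, volume_truncCone_inter (by norm_num) le_rfl (by norm_num) (by norm_num) (by norm_num)]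
  norm_num

/-- The hyperbolic isometry `z ↦ 2z`. -/
def dilate (z : ℍ) : ℍ :=
  Matrix.GeneralLinearGroup.mkOfDetNeZero !![(2 : ℝ), 0; 0, 1] (by simp) • z

lemma measurePreserving_dilate : MeasurePreserving dilate :=
  measurePreserving_smul _ _

lemma coe_dilate (z : ℍ) : (dilate z : ℂ) = 2 * z := by
  rw [dilate, UpperHalfPlane.coe_smul_of_det_pos
    (by simp [Matrix.GeneralLinearGroup.mkOfDetNeZero])]
  simp [UpperHalfPlane.num, UpperHalfPlane.denom, Matrix.GeneralLinearGroup.mkOfDetNeZero]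

lemma dilate_re (z : ℍ) : (dilate z).re = 2 * z.re := by
  rw [← UpperHalfPlane.coe_re, coe_dilate]; simp

lemma dilate_im (z : ℍ) : (dilate z).im = 2 * z.im := by
  rw [← UpperHalfPlane.coe_im, coe_dilate]; simp

lemma preimage_dilate_truncCone (ε t : ℝ) :
    dilate ⁻¹' truncCone (Icc 0 1) (2 * ε) (2 * t) = truncCone (Icc 0 (1 / 2)) ε t := by
  ext z
  simp only [truncCone, mem_preimage, mem_inter_iff, Set.mem_sdiff, mem_cone_iff, mem_ofPred_eq,
      mem_coneInter_Icc_iff zero_le_one,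
      mem_coneInter_Icc_iff (show (0 : ℝ) ≤ 1 / 2 by norm_num), dilate_re, dilate_im]
  refine and_congr (and_congr (and_congr ?_ ?_) (not_congr (and_congr ?_ ?_))) ?_ <;>
    constructor <;> intro h <;> linarith

end

section

/-! ### Right end-point Riemann sums of càdlàg functions -/

/-- The first point of the grid `(n + 1)⁻¹ ℤ` to the right of `t`, capped at `1`. -/
def gridPt (n : ℕ) (t : ℝ) : ℝ := min 1 ((⌊(n + 1 : ℝ) * t⌋₊ + 1) / (n + 1))

lemma gridPt_mem (n : ℕ) (t : ℝ) : gridPt n t ∈ Icc (0 : ℝ) 1 :=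
  ⟨le_min zero_le_one (by positivity), min_le_left _ _⟩

lemma gridPt_eq {n k : ℕ} (hk : k < n + 1) {t : ℝ}
    (ht : t ∈ Ico ((k : ℝ) / (n + 1)) ((k + 1 : ℝ) / (n + 1))) :
    gridPt n t = (k + 1) / (n + 1) := by
  have hn : (0 : ℝ) < n + 1 := by positivity
  have h0 : ⌊(n + 1 : ℝ) * t⌋₊ = k := by
    rw [mem_Ico, div_le_iff₀ hn, lt_div_iff₀ hn] at ht
    rw [Nat.floor_eq_iff (by nlinarith [(Nat.cast_nonneg k : (0 : ℝ) ≤ k)])]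
    constructor <;> linarith
  rw [gridPt, h0, min_eq_right]
  rw [div_le_one hn]
  exact_mod_cast hk

lemma tendsto_gridPt {t : ℝ} (ht : t ∈ Ico (0 : ℝ) 1) :
    Tendsto (fun n => gridPt n t) atTop (𝓝[≥] t) := by
  refine tendsto_nhdsWithin_iff.2 ⟨?_, ?_⟩
  · have h1 : Tendsto (fun n : ℕ => min 1 (t + 1 / ((n : ℝ) + 1))) atTop (𝓝 (min 1 (t + 0))) :=
      tendsto_const_nhds.min (tendsto_const_nhds.add tendsto_one_div_add_atTop_nhds_zero_nat)
    rw [add_zero, min_eq_right ht.2.le] at h1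
    refine tendsto_of_tendsto_of_tendsto_of_le_of_le tendsto_const_nhds h1 ?_ ?_
    · intro n
      have hn : (0 : ℝ) < n + 1 := by positivity
      refine le_min ht.2.le ?_
      rw [le_div_iff₀ hn, mul_comm]
      exact (Nat.lt_floor_add_one _).le
    · intro n
      have hn : (0 : ℝ) < n + 1 := by positivity
      refine min_le_min_left _ ?_
      rw [div_le_iff₀ hn, add_mul t, div_mul_cancel₀ _ hn.ne', mul_comm t]
      gcongr
      exact Nat.floor_le (by have := ht.1; positivity)
  · refine Eventually.of_forall fun n => ?_
    have hn : (0 : ℝ) < n + 1 := by positivity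
    refine le_min ht.2.le ?_
    rw [le_div_iff₀ hn, mul_comm]
    exact (Nat.lt_floor_add_one _).le

lemma measurable_comp_gridPt {α β : Type*} [MeasurableSpace α] [MeasurableSpace β] (n : ℕ)
    {f : ℝ → α → β} (hf : ∀ t ∈ Icc (0 : ℝ) 1, Measurable (f t)) :
    Measurable (fun p : ℝ × α => f (gridPt n p.1) p.2) := by
  have h1 : Measurable (fun p : ℕ × α => f (min 1 ((p.1 + 1 : ℝ) / (n + 1))) p.2) := by
    refine measurable_from_prod_countable_right fun k => ?_
    exact hf (min 1 ((k + 1 : ℝ) / (n + 1)))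
      ⟨le_min zero_le_one (by positivity), min_le_left _ _⟩
  have h2 : Measurable (fun p : ℝ × α => (⌊(n + 1 : ℝ) * p.1⌋₊, p.2)) :=
    (Nat.measurable_floor.comp (by fun_prop)).prodMk measurable_snd
  exact h1.comp h2

lemma measurable_fun_gridPt {β : Type*} [MeasurableSpace β] (n : ℕ) (g : ℝ → β) :
    Measurable (fun t => g (gridPt n t)) := by
  have h1 : Measurable (fun k : ℕ => g (min 1 ((k + 1 : ℝ) / (n + 1)))) := measurable_from_nat
  have h2 : Measurable (fun t : ℝ => ⌊(n + 1 : ℝ) * t⌋₊) :=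
    Nat.measurable_floor.comp (measurable_const_mul _)
  exact h1.comp h2

/-- The Riemann sum of `f` over `[0, 1]` with `n + 1` equal steps and right end-points. -/
def riemannSum (n : ℕ) (f : ℝ → ℝ≥0∞) : ℝ≥0∞ :=
  ∑ k ∈ Finset.range (n + 1), ENNReal.ofReal (1 / (n + 1)) * f ((k + 1) / (n + 1))

lemma lintegral_comp_gridPt (n : ℕ) (f : ℝ → ℝ≥0∞) :
    ∫⁻ t in Ico (0 : ℝ) 1, f (gridPt n t) = riemannSum n f := by
  have hn : (0 : ℝ) < n + 1 := by positivity
  have key : ∀ m ≤ n + 1, ∫⁻ t in Ico (0 : ℝ) (m / (n + 1)), f (gridPt n t)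
      = ∑ k ∈ Finset.range m, ENNReal.ofReal (1 / (n + 1)) * f ((k + 1) / (n + 1)) := by
    intro m hm
    induction m with
    | zero => simp
    | succ m ih =>
      have hle : (m : ℝ) / (n + 1) ≤ (m + 1) / (n + 1) := by gcongr; linarith
      have h0 : Ico (0 : ℝ) ((m + 1 : ℕ) / (n + 1))
          = Ico (0 : ℝ) (m / (n + 1)) ∪ Ico ((m : ℝ) / (n + 1)) ((m + 1) / (n + 1)) := by
        rw [Ico_union_Ico_eq_Ico (by positivity) hle]
        push_cast
        rfl
      rw [h0, lintegral_union measurableSet_Ico (by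
        rw [Set.disjoint_left]; intro x hx hx'; exact absurd hx.2 (not_lt.2 hx'.1)),
        ih (by omega), Finset.sum_range_succ]
      congr 1
      rw [setLIntegral_congr_fun measurableSet_Ico
        (fun t ht => by rw [gridPt_eq (by omega) ht]), setLIntegral_const, Real.volume_Ico,
        mul_comm]
      congr 2
      ring
  have := key (n + 1) le_rfl
  rw [riemannSum, ← this]
  congr 3
  push_cast
  rw [div_self hn.ne']

lemma IsCadlagOn.bounded {f : ℝ → ℝ} (hf : IsCadlagOn f 0 1) :
    ∃ K, ∀ t ∈ Icc (0 : ℝ) 1, |f t| ≤ K := by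
  refine isCompact_Icc.induction_on (p := fun s => ∃ K, ∀ t ∈ s, |f t| ≤ K) ?_ ?_ ?_ ?_
  · exact ⟨0, by simp⟩
  · rintro s t hst ⟨K, hK⟩
    exact ⟨K, fun x hx => hK x (hst hx)⟩
  · rintro s t ⟨K, hK⟩ ⟨L, hL⟩
    refine ⟨max K L, fun x hx => ?_⟩
    rcases hx with hx | hx
    · exact (hK x hx).trans (le_max_left _ _)
    · exact (hL x hx).trans (le_max_right _ _)
  · intro t ht
    -- one-sided bounds on punctured neighbourhoods, glued with the value at `t`
    have hr : ∃ K, ∀ᶠ x in 𝓝[Icc 0 1] t, t < x → |f x| ≤ K := by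
      rcases ht.2.lt_or_eq with h1 | h1
      · have h2 := (hf.1 t ⟨ht.1, h1⟩).abs
        have h3 : ∀ᶠ x in 𝓝[Ici t] t, |f x| ≤ |f t| + 1 :=
          (h2.eventually (gt_mem_nhds (lt_add_one _))).mono fun x hx => le_of_lt hx
        refine ⟨|f t| + 1, ?_⟩
        rw [eventually_nhdsWithin_iff] at h3
        exact (h3.filter_mono nhdsWithin_le_nhds).mono fun x hx htx => hx htx.le
      · refine ⟨0, eventually_nhdsWithin_of_forall fun x hx htx => ?_⟩
        exact absurd hx.2 (not_le.2 (h1 ▸ htx))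
    have hl : ∃ K, ∀ᶠ x in 𝓝[Icc 0 1] t, x < t → |f x| ≤ K := by
      rcases ht.1.lt_or_eq with h1 | h1
      · obtain ⟨l, hl⟩ := hf.2 t ⟨h1, ht.2⟩
        have h3 : ∀ᶠ x in 𝓝[<] t, |f x| ≤ |l| + 1 :=
          (hl.abs.eventually (gt_mem_nhds (lt_add_one _))).mono fun x hx => le_of_lt hx
        refine ⟨|l| + 1, ?_⟩
        rw [eventually_nhdsWithin_iff] at h3
        exact (h3.filter_mono nhdsWithin_le_nhds).mono fun x hx htx => hx htx
      · refine ⟨0, eventually_nhdsWithin_of_forall fun x hx htx => ?_⟩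
        exact absurd hx.1 (not_le.2 (h1 ▸ htx))
    obtain ⟨K, hK⟩ := hr
    obtain ⟨L, hL⟩ := hl
    refine ⟨_, hK.and hL, max (max K L) |f t|, fun x hx => ?_⟩
    rcases lt_trichotomy x t with h | h | h
    · exact (hx.2 h).trans ((le_max_right _ _).trans (le_max_left _ _))
    · exact h ▸ le_max_right _ _
    · exact (hx.1 h).trans ((le_max_left _ _).trans (le_max_left _ _))

lemma IsCadlagOn.tendsto_gridPt {f : ℝ → ℝ} (hf : IsCadlagOn f 0 1) {t : ℝ}
    (ht : t ∈ Ico (0 : ℝ) 1) : Tendsto (fun n => f (gridPt n t)) atTop (𝓝 (f t)) :=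
  (hf.1 t ht).tendsto.comp (LogIDCascade.tendsto_gridPt ht)

lemma IsCadlagOn.tendsto_riemannSum {f : ℝ → ℝ} (hf : IsCadlagOn f 0 1) :
    Tendsto (fun n => riemannSum n (fun t => ENNReal.ofReal (f t))) atTop
      (𝓝 (∫⁻ t in Ico (0 : ℝ) 1, ENNReal.ofReal (f t))) := by
  obtain ⟨K, hK⟩ := hf.bounded
  simp_rw [← lintegral_comp_gridPt]
  refine tendsto_lintegral_of_dominated_convergence (fun _ => ENNReal.ofReal K) (fun n => ?_)
    (fun n => ae_of_all _ fun t => ?_) (by simp [ENNReal.ofReal_ne_top]) ?_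
  · exact measurable_fun_gridPt n (fun t => ENNReal.ofReal (f t))
  · exact ENNReal.ofReal_le_ofReal ((le_abs_self _).trans (hK _ (gridPt_mem n t)))
  · rw [ae_restrict_iff' measurableSet_Ico]
    exact ae_of_all _ fun t ht => (ENNReal.continuous_ofReal.tendsto _).comp (hf.tendsto_gridPt ht)

/-! ### The truncated cascade -/

variable {Ω : Type*} [MeasurableSpace Ω]

/-- The density `e^{Λ(V_ε(t))}` of the truncated cascade. -/
def dens (Λ : Set ℍ → Ω → ℝ) (ε t : ℝ) (ω : Ω) : ℝ≥0∞ :=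
  ENNReal.ofReal (Real.exp (Λ (truncCone (Icc 0 1) ε t) ω))

/-- The regularization of `dens` along the grids; unlike `dens` it is jointly measurable in `t`
and `ω`, and it is almost surely equal to the càdlàg modification. -/
def regDens (Λ : Set ℍ → Ω → ℝ) (ε t : ℝ) (ω : Ω) : ℝ≥0∞ :=
  limsup (fun n => dens Λ ε (gridPt n t) ω) atTop

variable {P : Measure Ω} {ψ : ℝ → ℂ} {Λ : Set ℍ → Ω → ℝ}

lemma measurable_dens (hΛ : IsIndepScattered P ψ volume Λ) {ε t : ℝ} (hε : 0 < ε)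
    (ht : t ∈ Icc (0 : ℝ) 1) : Measurable (dens Λ ε t) := by
  have := hΛ.measurable _ (measurableSet_truncCone zero_le_one ε t) (volume_truncCone_lt_top hε ht)
  unfold dens
  fun_prop

lemma measurable_regDens (hΛ : IsIndepScattered P ψ volume Λ) {ε : ℝ} (hε : 0 < ε) :
    Measurable (fun p : ℝ × Ω => regDens Λ ε p.1 p.2) :=
  .limsup fun n => measurable_comp_gridPt n fun _ ht => measurable_dens hΛ hε ht

lemma measurable_riemannSum_dens (hΛ : IsIndepScattered P ψ volume Λ) {ε : ℝ} (hε : 0 < ε)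
    (n : ℕ) : Measurable (fun ω => riemannSum n (fun t => dens Λ ε t ω)) := by
  refine Finset.measurable_sum _ fun k hk => (measurable_dens hΛ hε ⟨by positivity, ?_⟩).const_mul _
  rw [div_le_one (by positivity)]
  exact_mod_cast Finset.mem_range.1 hk

namespace IsCascadeLimit

variable {X : ℝ → ℝ → Ω → ℝ} {M : ℝ → Ω → FiniteMeasure ℝ} {μ : Ω → FiniteMeasure ℝ}

lemma mass_eq (hμ : IsCascadeLimit P Λ 0 1 X M μ) {ε : ℝ} (hε : 0 < ε) :
    ∀ᵐ ω ∂P, ((M ε ω).mass : ℝ≥0∞) = ∫⁻ t in Ico (0 : ℝ) 1, ENNReal.ofReal (X ε t ω) := by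
  filter_upwards [hμ.density ε hε] with ω hω
  rw [FiniteMeasure.ennreal_mass, hω, withDensity_apply _ MeasurableSet.univ,
    Measure.restrict_univ, setLIntegral_congr Ico_ae_eq_Icc.symm]
  simp

lemma dens_grid (hμ : IsCascadeLimit P Λ 0 1 X M μ) {ε : ℝ} (hε : 0 < ε) :
    ∀ᵐ ω ∂P, ∀ n k : ℕ, k < n + 1 →
      ENNReal.ofReal (X ε ((k + 1) / (n + 1)) ω) = dens Λ ε ((k + 1) / (n + 1)) ω := by
  refine ae_all_iff.2 fun n => ae_all_iff.2 fun k => ?_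
  by_cases hk : k < n + 1
  · filter_upwards [hμ.modification ε hε ((k + 1) / (n + 1)) ⟨by positivity, by
      rw [div_le_one (by positivity)]; exact_mod_cast hk⟩] with ω hω _
    rw [hω, dens]
  · exact ae_of_all _ fun _ h => absurd h hk

lemma dens_gridPt (hμ : IsCascadeLimit P Λ 0 1 X M μ) {ε : ℝ} (hε : 0 < ε) :
    ∀ᵐ ω ∂P, ∀ n : ℕ, ∀ t ∈ Ico (0 : ℝ) 1,
      ENNReal.ofReal (X ε (gridPt n t) ω) = dens Λ ε (gridPt n t) ω := by
  filter_upwards [hμ.dens_grid hε] with ω hω n t ht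
  have hn : (0 : ℝ) < n + 1 := by positivity
  have hk : ⌊(n + 1 : ℝ) * t⌋₊ < n + 1 := by
    rw [Nat.floor_lt (by have := ht.1; positivity)]
    push_cast
    nlinarith [ht.2]
  have ht0 := ht.1
  rw [gridPt_eq hk ⟨?_, ?_⟩]
  · exact hω n _ hk
  · rw [div_le_iff₀ hn, mul_comm]
    exact Nat.floor_le (by positivity)
  · rw [lt_div_iff₀ hn, mul_comm]
    exact Nat.lt_floor_add_one _

lemma tendsto_riemannSum (hμ : IsCascadeLimit P Λ 0 1 X M μ) {ε : ℝ} (hε : 0 < ε) :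
    ∀ᵐ ω ∂P, Tendsto (fun n => riemannSum n (fun t => dens Λ ε t ω)) atTop
      (𝓝 ((M ε ω).mass : ℝ≥0∞)) := by
  filter_upwards [hμ.mass_eq hε, hμ.cadlag ε hε, hμ.dens_grid hε] with ω h1 h2 h3
  rw [h1]
  refine h2.tendsto_riemannSum.congr fun n => ?_
  refine Finset.sum_congr rfl fun k hk => ?_
  beta_reduce
  rw [h3 n k (Finset.mem_range.1 hk)]

lemma regDens_eq (hμ : IsCascadeLimit P Λ 0 1 X M μ) {ε : ℝ} (hε : 0 < ε) :
    ∀ᵐ ω ∂P, ∀ t ∈ Ico (0 : ℝ) 1, regDens Λ ε t ω = ENNReal.ofReal (X ε t ω) := by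
  filter_upwards [hμ.cadlag ε hε, hμ.dens_gridPt hε] with ω h2 h3 t ht
  refine Tendsto.limsup_eq ?_
  simp_rw [← h3 _ t ht]
  exact (ENNReal.continuous_ofReal.tendsto _).comp (h2.tendsto_gridPt ht)

lemma regDens_eq_dens (hμ : IsCascadeLimit P Λ 0 1 X M μ) {ε t : ℝ} (hε : 0 < ε)
    (ht : t ∈ Ico (0 : ℝ) 1) : ∀ᵐ ω ∂P, regDens Λ ε t ω = dens Λ ε t ω := by
  filter_upwards [hμ.regDens_eq hε, hμ.modification ε hε t ⟨ht.1, ht.2.le⟩] with ω h1 h2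
  rw [h1 t ht, h2, dens]

/-- The mass of the truncated cascade in terms of `Λ` alone. -/
lemma mass_eq_regDens (hμ : IsCascadeLimit P Λ 0 1 X M μ) {ε : ℝ} (hε : 0 < ε) :
    ∀ᵐ ω ∂P, ((M ε ω).mass : ℝ≥0∞) = ∫⁻ t in Ioo (0 : ℝ) 1, regDens Λ ε t ω := by
  filter_upwards [hμ.mass_eq hε, hμ.regDens_eq hε] with ω h1 h2
  rw [h1, setLIntegral_congr Ioo_ae_eq_Ico]
  exact setLIntegral_congr_fun measurableSet_Ico fun t ht => (h2 t ht).symm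

lemma tendsto_mass (hμ : IsCascadeLimit P Λ 0 1 X M μ) {u : ℕ → ℝ}
    (hu : Tendsto u atTop atTop) :
    ∀ᵐ ω ∂P, Tendsto (fun m => ((M (1 / u m) ω).mass : ℝ≥0∞)) atTop (𝓝 ((μ ω).mass : ℝ≥0∞)) := by
  filter_upwards [hμ.tendsto] with ω hω
  refine ENNReal.tendsto_coe.2 ?_
  exact ((FiniteMeasure.continuous_mass.tendsto _).comp hω).comp hu

lemma aemeasurable_mass_trunc (hμ : IsCascadeLimit P Λ 0 1 X M μ)
    (hΛ : IsIndepScattered P ψ volume Λ) {ε : ℝ} (hε : 0 < ε) :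
    AEMeasurable (fun ω => ((M ε ω).mass : ℝ≥0∞)) P :=
  aemeasurable_of_tendsto_metrizable_ae atTop
    (fun n => (measurable_riemannSum_dens hΛ hε n).aemeasurable) (hμ.tendsto_riemannSum hε)

lemma aemeasurable_mass (hμ : IsCascadeLimit P Λ 0 1 X M μ)
    (hΛ : IsIndepScattered P ψ volume Λ) :
    AEMeasurable (fun ω => ((μ ω).mass : ℝ≥0∞)) P := by
  refine aemeasurable_of_tendsto_metrizable_ae atTop (fun n : ℕ => ?_)
    (hμ.tendsto_mass (u := fun n => (n : ℝ) + 1)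
      (tendsto_atTop_add_const_right _ _ tendsto_natCast_atTop_atTop))
  exact hμ.aemeasurable_mass_trunc hΛ (by positivity)

end IsCascadeLimit

end

section

/-! ### Compound Poisson laws on the negative half-line -/

/-- The convolution powers of a measure on the line. -/
def convPow (κ : Measure ℝ) : ℕ → Measure ℝ
  | 0 => Measure.dirac 0
  | n + 1 => (convPow κ n).conv κ

/-- The compound Poisson law with finite jump measure `κ`. -/
def compoundPoisson (κ : Measure ℝ) : Measure ℝ :=
  Measure.sum fun n : ℕ => ENNReal.ofReal (Real.exp (-κ.real univ) / n.factorial) • convPow κ n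

instance isFiniteMeasure_convPow (κ : Measure ℝ) [IsFiniteMeasure κ] (n : ℕ) :
    IsFiniteMeasure (convPow κ n) := by
  induction n with
  | zero => simp only [convPow]; infer_instance
  | succ n ih => simp only [convPow]; infer_instance

lemma convPow_univ (κ : Measure ℝ) [IsFiniteMeasure κ] (n : ℕ) :
    convPow κ n univ = κ univ ^ n := by
  induction n with
  | zero => simp [convPow]
  | succ n ih =>
    rw [convPow, Measure.conv, Measure.map_apply (by fun_prop) MeasurableSet.univ, preimage_univ,
      Measure.prod_apply MeasurableSet.univ]
    simp [ih, pow_succ, mul_comm]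

lemma ae_convPow_nonpos {κ : Measure ℝ} [IsFiniteMeasure κ] (h : ∀ᵐ x ∂κ, x ≤ 0) (n : ℕ) :
    ∀ᵐ x ∂(convPow κ n), x ≤ 0 := by
  induction n with
  | zero => simp [convPow, ae_dirac_eq]
  | succ n ih =>
    rw [convPow, Measure.conv, ae_map_iff (by fun_prop) measurableSet_Iic]
    filter_upwards [Measure.quasiMeasurePreserving_fst.ae ih,
      Measure.quasiMeasurePreserving_snd.ae h] with p h1 h2
    linarith

instance isProbabilityMeasure_compoundPoisson (κ : Measure ℝ) [IsFiniteMeasure κ] :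
    IsProbabilityMeasure (compoundPoisson κ) := by
  refine ⟨?_⟩
  rw [compoundPoisson, Measure.sum_apply _ MeasurableSet.univ]
  have h1 : ∀ n : ℕ, (ENNReal.ofReal (Real.exp (-κ.real univ) / n.factorial) • convPow κ n) univ
      = ENNReal.ofReal (Real.exp (-κ.real univ) * (κ.real univ ^ n / n.factorial)) := by
    intro n
    rw [Measure.smul_apply, smul_eq_mul, convPow_univ, ← ofReal_measureReal (μ := κ),
      ← ENNReal.ofReal_pow measureReal_nonneg, ← ENNReal.ofReal_mul (by positivity)]
    congr 1
    ring
  simp_rw [h1]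
  have h2 := (NormedSpace.expSeries_div_hasSum_exp (κ.real univ : ℝ)).mul_left
    (Real.exp (-κ.real univ))
  rw [← Real.exp_eq_exp_ℝ, ← Real.exp_add, neg_add_cancel, Real.exp_zero] at h2
  rw [← ENNReal.ofReal_tsum_of_nonneg (fun n => by positivity) h2.summable, h2.tsum_eq,
    ENNReal.ofReal_one]

lemma ae_compoundPoisson_nonpos {κ : Measure ℝ} [IsFiniteMeasure κ] (h : ∀ᵐ x ∂κ, x ≤ 0) :
    ∀ᵐ x ∂(compoundPoisson κ), x ≤ 0 := by
  rw [compoundPoisson, Measure.ae_sum_iff]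
  exact fun n => Measure.ae_smul_measure (ae_convPow_nonpos h n) _

lemma integrable_of_norm_le_one_of_nonpos {κ : Measure ℝ} [IsFiniteMeasure κ]
    (h : ∀ᵐ x ∂κ, x ≤ 0) {χ : ℝ → ℂ} (hc : Continuous χ) (hb : ∀ x ≤ 0, ‖χ x‖ ≤ 1) :
    Integrable χ κ :=
  Integrable.of_bound hc.aestronglyMeasurable 1 (h.mono hb)

/-- Integrals of characters of the additive monoid `(-∞, 0]`. -/
lemma integral_convPow {κ : Measure ℝ} [IsFiniteMeasure κ]
    (h : ∀ᵐ x ∂κ, x ≤ 0) {χ : ℝ → ℂ} (hc : Continuous χ) (hb : ∀ x ≤ 0, ‖χ x‖ ≤ 1)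
    (h0 : χ 0 = 1) (hadd : ∀ x y, χ (x + y) = χ x * χ y) (n : ℕ) :
    ∫ x, χ x ∂(convPow κ n) = (∫ x, χ x ∂κ) ^ n := by
  induction n with
  | zero => simp [convPow, h0]
  | succ n ih =>
    have hint : Integrable χ ((convPow κ n).conv κ) :=
      integrable_of_norm_le_one_of_nonpos (κ := convPow κ (n + 1)) (ae_convPow_nonpos h (n + 1))
        hc hb
    rw [convPow, integral_conv hint]
    simp_rw [hadd, integral_const_mul, integral_mul_const, ih, pow_succ]

lemma integral_compoundPoisson {κ : Measure ℝ} [IsFiniteMeasure κ]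
    (h : ∀ᵐ x ∂κ, x ≤ 0) {χ : ℝ → ℂ} (hc : Continuous χ) (hb : ∀ x ≤ 0, ‖χ x‖ ≤ 1)
    (h0 : χ 0 = 1) (hadd : ∀ x y, χ (x + y) = χ x * χ y) :
    ∫ x, χ x ∂(compoundPoisson κ) = Complex.exp ((∫ x, χ x ∂κ) - κ.real univ) := by
  have hint : Integrable χ (compoundPoisson κ) :=
    integrable_of_norm_le_one_of_nonpos (ae_compoundPoisson_nonpos h) hc hb
  have h1 := hasSum_integral_measure hint
  have h2 := (NormedSpace.expSeries_div_hasSum_exp (∫ x, χ x ∂κ)).mul_left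
    (Complex.exp (-κ.real univ))
  rw [← Complex.exp_eq_exp_ℂ, ← Complex.exp_add, neg_add_eq_sub] at h2
  refine h1.unique (h2.congr_fun fun n => ?_)
  rw [integral_smul_measure, integral_convPow h hc hb h0 hadd,
    ENNReal.toReal_ofReal (by positivity), Complex.real_smul]
  push_cast
  ring

/-- The law with drift `c` and compound Poisson jumps. -/
lemma integral_map_add_compoundPoisson {κ : Measure ℝ} [IsFiniteMeasure κ]
    (h : ∀ᵐ x ∂κ, x ≤ 0) {χ : ℝ → ℂ} (hc : Continuous χ) (hb : ∀ x ≤ 0, ‖χ x‖ ≤ 1)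
    (h0 : χ 0 = 1) (hadd : ∀ x y, χ (x + y) = χ x * χ y) (c : ℝ) :
    ∫ x, χ x ∂((compoundPoisson κ).map (· + c))
      = χ c * Complex.exp ((∫ x, χ x ∂κ) - κ.real univ) := by
  rw [integral_map (by fun_prop) hc.aestronglyMeasurable]
  simp_rw [hadd, integral_mul_const]
  rw [integral_compoundPoisson h hc hb h0 hadd, mul_comm]

/-! ### Exponential moments of spectrally negative laws of finite variation -/

/-- The exponent `φ(p) = γ p - ∫ (1 - e^{px}) ν(dx)` of the moments `E(e^{pΛ(B)}) = e^{φ(p)λ(B)}`. -/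
def momentExp (ν : Measure ℝ) (p : ℝ) : ℝ := gam ν * p - ∫ x, (1 - Real.exp (p * x)) ∂ν

lemma measurable_trunc : Measurable trunc :=
  Measurable.ite (measurableSet_le (by fun_prop) measurable_const) measurable_id measurable_const

section

variable {σ : ℝ} {ν : Measure ℝ}

namespace SubcriticalNegative

lemma ae_neg (h : SubcriticalNegative σ ν) (hν : IsLevyMeasure ν) : ∀ᵐ x ∂ν, x < 0 := by
  have h1 : ν (Ici 0) = 0 := by
    rw [← Ioi_union_left, measure_union_null_iff]
    exact ⟨h.2.1, hν.zero_notAtom⟩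
  rw [ae_iff]
  convert h1 using 2
  ext x
  simp

lemma restrict_Iic (h : SubcriticalNegative σ ν) (hν : IsLevyMeasure ν) :
    ν.restrict (Iic 0) = ν :=
  Measure.restrict_eq_self_of_ae_mem ((h.ae_neg hν).mono fun _ hx => hx.le)

lemma gam_eq (h : SubcriticalNegative σ ν) (hν : IsLevyMeasure ν) :
    gam ν = ∫ x, (1 - Real.exp x) ∂ν := by
  rw [gam, h.restrict_Iic hν]

lemma integrable_min (h : SubcriticalNegative σ ν) (hν : IsLevyMeasure ν) :
    Integrable (fun x => min 1 |x|) ν := by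
  refine ⟨by fun_prop, ?_⟩
  have := h.2.2.1
  rw [h.restrict_Iic hν] at this
  rw [hasFiniteIntegral_iff_norm]
  convert this using 4 with x
  rw [Real.norm_of_nonneg (le_min zero_le_one (abs_nonneg x))]

lemma integrable_of_le (h : SubcriticalNegative σ ν) (hν : IsLevyMeasure ν)
    {E : Type*} [NormedAddCommGroup E] {f : ℝ → E} (hf : AEStronglyMeasurable f ν) (C : ℝ)
    (hC : ∀ x < 0, ‖f x‖ ≤ C * min 1 |x|) : Integrable f ν :=
  ((h.integrable_min hν).const_mul C).mono' hf ((h.ae_neg hν).mono hC)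

lemma integrable_one_sub_exp (h : SubcriticalNegative σ ν) (hν : IsLevyMeasure ν) {p : ℝ}
    (hp : 0 ≤ p) : Integrable (fun x => 1 - Real.exp (p * x)) ν := by
  refine h.integrable_of_le hν (by fun_prop) (1 + p) fun x hx => ?_
  have h1 : Real.exp (p * x) ≤ 1 := Real.exp_le_one_iff.2 (mul_nonpos_of_nonneg_of_nonpos hp hx.le)
  rw [Real.norm_of_nonneg (by linarith), abs_of_neg hx, mul_min_of_nonneg _ _ (by linarith)]
  refine le_min ?_ ?_
  · linarith [Real.exp_pos (p * x)]
  · nlinarith [Real.add_one_le_exp (p * x)]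

lemma norm_cexp_sub_one_le (q x : ℝ) :
    ‖Complex.exp (Complex.I * q * x) - 1‖ ≤ (2 + |q|) * min 1 |x| := by
  rw [mul_min_of_nonneg _ _ (by positivity)]
  have e : Complex.I * q * x = Complex.I * ((q * x : ℝ) : ℂ) := by push_cast; ring
  refine le_min ?_ ?_
  · refine (norm_sub_le _ _).trans ?_
    rw [e, mul_comm Complex.I, Complex.norm_exp_ofReal_mul_I]
    norm_num
  · rw [e]
    refine (Real.norm_exp_I_mul_ofReal_sub_one_le).trans ?_
    rw [Real.norm_eq_abs, abs_mul]
    nlinarith [abs_nonneg x, abs_nonneg q]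

lemma integrable_cexp_sub_one (h : SubcriticalNegative σ ν) (hν : IsLevyMeasure ν) (q : ℝ) :
    Integrable (fun x : ℝ => Complex.exp (Complex.I * q * x) - 1) ν :=
  h.integrable_of_le hν (by fun_prop) _ fun x _ => norm_cexp_sub_one_le q x

lemma integrable_trunc (h : SubcriticalNegative σ ν) (hν : IsLevyMeasure ν) :
    Integrable trunc ν := by
  refine h.integrable_of_le hν measurable_trunc.aestronglyMeasurable 1 fun x _ => ?_
  rw [trunc, one_mul]
  split_ifs with hx
  · rw [Real.norm_eq_abs, min_eq_right hx]
  · simp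

lemma levyExponent_eq (h : SubcriticalNegative σ ν) (hν : IsLevyMeasure ν) (q : ℝ) :
    levyExponent (normDrift σ ν) σ ν q
      = Complex.I * q * gam ν + ∫ x : ℝ, (Complex.exp (Complex.I * q * x) - 1) ∂ν := by
  have hσ : σ = 0 := h.1
  have h1 : ∫ x : ℝ, (Real.exp x - 1 - trunc x) ∂ν = - gam ν - ∫ x, trunc x ∂ν := by
    rw [h.gam_eq hν, ← integral_neg, ← integral_sub _ (h.integrable_trunc hν)]
    · congr 1; ext x; ring
    · refine (h.integrable_one_sub_exp hν zero_le_one).neg.congr (ae_of_all _ fun x => ?_)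
      simp
  have h2 : ∫ x : ℝ, (Complex.exp (Complex.I * q * x) - 1 - Complex.I * q * (trunc x : ℂ)) ∂ν
      = (∫ x : ℝ, (Complex.exp (Complex.I * q * x) - 1) ∂ν)
        - Complex.I * q * ((∫ x, trunc x ∂ν : ℝ) : ℂ) := by
    have ht : Integrable (fun x : ℝ => Complex.I * q * (trunc x : ℂ)) ν :=
      (h.integrable_trunc hν).ofReal.const_mul _
    rw [integral_sub (h.integrable_cexp_sub_one hν q) ht, integral_const_mul, integral_complex_ofReal]
  rw [levyExponent, normDrift, h1, h2, hσ]
  push_cast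
  ring

lemma tendsto_setIntegral_jumps (h : SubcriticalNegative σ ν) (hν : IsLevyMeasure ν)
    {f : ℝ → ℂ} (hf : Integrable f ν) :
    Tendsto (fun k : ℕ => ∫ x in Iio (-(1 / ((k : ℝ) + 1))), f x ∂ν) atTop (𝓝 (∫ x, f x ∂ν)) := by
  have hU : ⋃ k : ℕ, Iio (-(1 / ((k : ℝ) + 1))) = Iio 0 := by
    ext x
    simp only [mem_iUnion, mem_Iio]
    constructor
    · rintro ⟨k, hk⟩
      exact hk.trans (neg_neg_of_pos (by positivity))
    · intro hx
      obtain ⟨k, hk⟩ := exists_nat_one_div_lt (neg_pos.2 hx)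
      exact ⟨k, by linarith⟩
  have := tendsto_setIntegral_of_monotone (μ := ν) (f := f)
    (s := fun k : ℕ => Iio (-(1 / ((k : ℝ) + 1)))) (fun k => measurableSet_Iio) (by
      intro k l hkl
      refine Iio_subset_Iio (neg_le_neg ?_)
      exact one_div_le_one_div_of_le (by positivity) (by exact_mod_cast Nat.succ_le_succ hkl))
    hf.integrableOn
  have h0 : ν.restrict (Iio 0) = ν := Measure.restrict_eq_self_of_ae_mem (h.ae_neg hν)
  rwa [hU, h0] at this

lemma measure_jumps_lt_top (h : SubcriticalNegative σ ν) (hν : IsLevyMeasure ν) (k : ℕ) :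
    ν (Iio (-(1 / ((k : ℝ) + 1)))) < ⊤ := by
  have hk : (0 : ℝ) < 1 / ((k : ℝ) + 1) := by positivity
  refine lt_of_le_of_lt (measure_mono (t := {x | 1 / ((k : ℝ) + 1) ≤ min 1 |x|}) ?_)
    ((h.integrable_min hν).measure_ge_lt_top hk)
  intro x hx
  have hx' : x < -(1 / ((k : ℝ) + 1)) := hx
  change 1 / ((k : ℝ) + 1) ≤ min 1 |x|
  refine le_min ?_ ?_
  · rw [div_le_one (by positivity)]
    linarith [(Nat.cast_nonneg k : (0 : ℝ) ≤ k)]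
  · rw [abs_of_neg (by linarith)]
    linarith

/-- The moments of a law with characteristic exponent `τ ψ`: the law is a weak limit of
compound Poisson laws with drift `τ γ`, all carried by `(-∞, τ γ]`, where `x ↦ e^{px}` is
bounded. -/
lemma lintegral_exp_eq (h : SubcriticalNegative σ ν) (hν : IsLevyMeasure ν) {τ : ℝ} (hτ : 0 ≤ τ)
    {π : Measure ℝ} [IsProbabilityMeasure π]
    (hπ : ∀ q, charFun π q = Complex.exp (levyExponent (normDrift σ ν) σ ν q * τ))
    {p : ℝ} (hp : 0 ≤ p) :
    ∫⁻ x, ENNReal.ofReal (Real.exp (p * x)) ∂π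
      = ENNReal.ofReal (Real.exp (momentExp ν p * τ)) := by
  let s : ℕ → Set ℝ := fun k => Iio (-(1 / ((k : ℝ) + 1)))
  let κ : ℕ → Measure ℝ := fun k => ENNReal.ofReal τ • ν.restrict (s k)
  have hfin : ∀ k, IsFiniteMeasure (κ k) := fun k => by
    have : IsFiniteMeasure (ν.restrict (s k)) := ⟨by simpa [s] using h.measure_jumps_lt_top hν k⟩
    exact Measure.smul_finite _ ENNReal.ofReal_ne_top
  have hκ : ∀ k, ∀ᵐ x ∂(κ k), x ≤ 0 := fun k =>
    Measure.ae_smul_measure (ae_restrict_of_ae ((h.ae_neg hν).mono fun _ hx => hx.le)) _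
  let c : ℝ := gam ν * τ
  let ρ : ℕ → Measure ℝ := fun k => (compoundPoisson (κ k)).map (· + c)
  have hρ : ∀ k, IsProbabilityMeasure (ρ k) := fun k =>
    Measure.isProbabilityMeasure_map (by fun_prop)
  have hρc : ∀ k, ∀ᵐ x ∂(ρ k), x ≤ c := fun k => by
    rw [ae_map_iff (by fun_prop) measurableSet_Iic]
    filter_upwards [ae_compoundPoisson_nonpos (hκ k)] with x hx
    linarith
  -- the integrals of a character against the approximations converge
  have key : ∀ χ : ℝ → ℂ, Continuous χ → (∀ x ≤ 0, ‖χ x‖ ≤ 1) → χ 0 = 1 →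
      (∀ x y, χ (x + y) = χ x * χ y) → Integrable (fun x => χ x - 1) ν →
      Tendsto (fun k => ∫ x, χ x ∂(ρ k)) atTop
        (𝓝 (χ c * Complex.exp (τ * ∫ x, (χ x - 1) ∂ν))) := by
    intro χ hc hb h0 hadd hint
    have h1 : ∀ k, ∫ x, χ x ∂(ρ k)
        = χ c * Complex.exp (τ * ∫ x in s k, (χ x - 1) ∂ν) := by
      intro k
      have : IsFiniteMeasure (ν.restrict (s k)) := ⟨by simpa [s] using h.measure_jumps_lt_top hν k⟩
      have hi : Integrable χ (ν.restrict (s k)) :=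
        integrable_of_norm_le_one_of_nonpos
          (ae_restrict_of_ae ((h.ae_neg hν).mono fun _ hx => hx.le)) hc hb
      rw [integral_map_add_compoundPoisson (hκ k) hc hb h0 hadd, integral_smul_measure,
        integral_sub hi (integrable_const _), ENNReal.toReal_ofReal hτ]
      simp only [κ, measureReal_ennreal_smul_apply, integral_const, Complex.real_smul,
        ENNReal.toReal_ofReal hτ]
      congr 2
      push_cast
      ring
    simp_rw [h1]
    exact tendsto_const_nhds.mul ((Complex.continuous_exp.tendsto _).comp
      (tendsto_const_nhds.mul (h.tendsto_setIntegral_jumps hν hint)))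
  let ρ' : ℕ → ProbabilityMeasure ℝ := fun k => ⟨ρ k, hρ k⟩
  let π' : ProbabilityMeasure ℝ := ⟨π, inferInstance⟩
  have hweak : Tendsto ρ' atTop (𝓝 π') := by
    rw [ProbabilityMeasure.tendsto_iff_tendsto_charFun]
    intro t
    change Tendsto (fun k => charFun (ρ k) t) atTop (𝓝 (charFun π t))
    rw [hπ]
    simp only [charFun_apply_real]
    have e : ∀ x : ℝ, Complex.exp (t * x * Complex.I) = Complex.exp (Complex.I * t * x) :=
      fun x => by congr 1; ring
    simp_rw [e]
    have := key (fun x => Complex.exp (Complex.I * t * x)) (by fun_prop) (fun x _ => by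
        have : Complex.I * t * x = ((t * x : ℝ) : ℂ) * Complex.I := by push_cast; ring
        rw [this, Complex.norm_exp_ofReal_mul_I])
      (by simp) (fun x y => by rw [← Complex.exp_add]; congr 1; push_cast; ring)
      (h.integrable_cexp_sub_one hν t)
    convert! this using 2
    rw [← Complex.exp_add, h.levyExponent_eq hν]
    congr 1
    simp only [c]
    push_cast
    ring
  let f : ℝ → ℝ := fun x => Real.exp (p * min x c)
  have hfc : Continuous f := by fun_prop
  have hfb : ∀ x, ‖f x‖ ≤ Real.exp (p * c) := fun x => by
    rw [Real.norm_of_nonneg (Real.exp_pos _).le]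
    exact Real.exp_le_exp.2 (mul_le_mul_of_nonneg_left (min_le_right _ _) hp)
  let F : BoundedContinuousFunction ℝ ℝ := BoundedContinuousFunction.ofNormedAddCommGroup f hfc _ hfb
  have hπc : ∀ᵐ x ∂π, x ≤ c := by
    have h1 := ProbabilityMeasure.le_liminf_measure_open_of_tendsto hweak (isOpen_Ioi (a := c))
    have h2 : ∀ k, ρ k (Ioi c) = 0 := fun k => by
      have := hρc k
      rw [ae_iff] at this
      simpa [Ioi, not_le] using this
    have h3 : π (Ioi c) ≤ liminf (fun k => ρ k (Ioi c)) atTop := h1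
    simp only [h2, liminf_const, nonpos_iff_eq_zero] at h3
    rw [ae_iff]
    simpa [Ioi, not_le] using h3
  have hlim1 : Tendsto (fun k => ∫ x, f x ∂(ρ k)) atTop (𝓝 (∫ x, f x ∂π)) :=
    ProbabilityMeasure.tendsto_iff_forall_integral_tendsto.1 hweak F
  have hlim2 : Tendsto (fun k => ∫ x, f x ∂(ρ k)) atTop (𝓝 (Real.exp (momentExp ν p * τ))) := by
    have h1 := key (fun x => (Real.exp (p * x) : ℂ)) (by fun_prop) (fun x hx => by
        rw [Complex.norm_real, Real.norm_of_nonneg (Real.exp_pos _).le]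
        exact Real.exp_le_one_iff.2 (mul_nonpos_of_nonneg_of_nonpos hp hx))
      (by simp) (fun x y => by rw [mul_add, Real.exp_add, Complex.ofReal_mul])
      (by
        have := (h.integrable_one_sub_exp hν hp).neg.ofReal (𝕜 := ℂ)
        refine this.congr (ae_of_all _ fun x => ?_)
        simp)
    have e1 : ∫ x, ((Real.exp (p * x) : ℂ) - 1) ∂ν
        = ((-∫ x, (1 - Real.exp (p * x)) ∂ν : ℝ) : ℂ) := by
      rw [← integral_neg, ← integral_complex_ofReal]
      congr 1
      ext x
      push_cast
      ring
    have e2 : ((Real.exp (p * c) : ℝ) : ℂ)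
        * Complex.exp (τ * ∫ x, ((Real.exp (p * x) : ℂ) - 1) ∂ν)
        = ((Real.exp (momentExp ν p * τ) : ℝ) : ℂ) := by
      rw [e1, ← Complex.ofReal_mul, ← Complex.ofReal_exp, ← Complex.ofReal_mul, ← Real.exp_add,
        momentExp]
      congr 2
      simp only [c]
      ring
    rw [e2] at h1
    have h2 := (Complex.continuous_re.tendsto _).comp h1
    rw [Complex.ofReal_re] at h2
    refine h2.congr fun k => ?_
    simp only [Function.comp_apply]
    rw [integral_complex_ofReal, Complex.ofReal_re]
    refine integral_congr_ae ((hρc k).mono fun x hx => ?_)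
    simp only [f, min_eq_left hx]
  have hval := tendsto_nhds_unique hlim1 hlim2
  have hfi : Integrable f π := Integrable.of_bound hfc.aestronglyMeasurable _ (ae_of_all _ hfb)
  rw [← hval, ofReal_integral_eq_lintegral_ofReal hfi (ae_of_all _ fun x => (Real.exp_pos _).le)]
  refine lintegral_congr_ae (hπc.mono fun x hx => ?_)
  simp only [f, min_eq_left hx]

end SubcriticalNegative

end

end

section

/-! ### Small-time asymptotics of infinitely divisible laws -/

open scoped FourierTransform SchwartzMap

namespace IsLevyMeasure

variable {ν : Measure ℝ}

lemma integrable_min_sq (hν : IsLevyMeasure ν) : Integrable (fun x => min 1 (|x| ^ 2)) ν := by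
  refine ⟨by fun_prop, ?_⟩
  rw [hasFiniteIntegral_iff_norm]
  convert hν.lintegral_lt_top using 4 with x
  rw [Real.norm_of_nonneg (by positivity)]

lemma sigmaFinite (hν : IsLevyMeasure ν) : SigmaFinite ν := by
  let f : ℝ → ℝ≥0∞ := fun x => ENNReal.ofReal (min 1 (|x| ^ 2))
  have hf : Measurable f := by fun_prop
  have h0 : ∀ᵐ x ∂ν, f x ≠ 0 := by
    have : ∀ᵐ x ∂ν, x ≠ 0 := by
      rw [ae_iff]
      simpa using hν.zero_notAtom
    filter_upwards [this] with x hx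
    simp [f, hx]
  have h1 : ∀ᵐ x ∂ν, f x ≠ ⊤ := ae_of_all _ fun x => ENNReal.ofReal_ne_top
  have : IsFiniteMeasure (ν.withDensity f) :=
    isFiniteMeasure_withDensity hν.lintegral_lt_top.ne
  rw [← withDensity_inv_same hf h0 h1]
  refine SigmaFinite.withDensity_of_ne_top ?_
  filter_upwards [(withDensity_absolutelyContinuous ν f).ae_le h0] with x hx
  exact ENNReal.inv_ne_top.2 hx

end IsLevyMeasure

/-- The integrand of the Lévy exponent is dominated by `1 ∧ x²`, locally uniformly in `q`. -/
lemma norm_levyKernel_le (q x : ℝ) :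
    ‖Complex.exp (Complex.I * q * x) - 1 - Complex.I * q * (trunc x : ℂ)‖
      ≤ (2 + 3 * q ^ 2) * min 1 (|x| ^ 2) := by
  have e : Complex.I * q * x = Complex.I * ((q * x : ℝ) : ℂ) := by push_cast; ring
  have hn : ‖Complex.exp (Complex.I * ((q * x : ℝ) : ℂ))‖ = 1 := by
    rw [mul_comm, Complex.norm_exp_ofReal_mul_I]
  by_cases hx : |x| ≤ 1
  · have hx2 : |x| ^ 2 ≤ 1 := pow_le_one₀ (abs_nonneg x) hx
    rw [trunc, if_pos hx, min_eq_right hx2, e]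
    have h3 : ‖Complex.exp (Complex.I * ((q * x : ℝ) : ℂ)) - 1 - Complex.I * ((q * x : ℝ) : ℂ)‖
        ≤ 3 * |q * x| ^ 2 := by
      have hI : ‖Complex.I * ((q * x : ℝ) : ℂ)‖ = |q * x| := by
        rw [norm_mul, Complex.norm_I, one_mul, Complex.norm_real, Real.norm_eq_abs]
      rcases le_or_gt |q * x| 1 with h | h
      · have := Complex.norm_exp_sub_one_sub_id_le (x := Complex.I * ((q * x : ℝ) : ℂ))
          (by rwa [hI])
        rw [hI] at this
        nlinarith [sq_nonneg |q * x|]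
      · refine (norm_sub_le _ _).trans ((add_le_add_left (norm_sub_le _ _) _).trans ?_)
        rw [hn, hI, norm_one]
        nlinarith
    rw [abs_mul, mul_pow, sq_abs q] at h3
    nlinarith [sq_nonneg |x|, sq_nonneg q]
  · have hx2 : 1 ≤ |x| ^ 2 := one_le_pow₀ (not_le.1 hx).le
    rw [trunc, if_neg hx, min_eq_left hx2, e, Complex.ofReal_zero, mul_zero, sub_zero]
    refine (norm_sub_le _ _).trans ?_
    rw [hn, norm_one]
    nlinarith [sq_nonneg q]

section generator

variable {a σ : ℝ} {ν : Measure ℝ}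

lemma norm_levyExponent_le (hν : IsLevyMeasure ν) (q : ℝ) :
    ‖levyExponent a σ ν q‖ ≤ |a| * |q| + σ ^ 2 * q ^ 2
      + (2 + 3 * q ^ 2) * ∫ x, min 1 (|x| ^ 2) ∂ν := by
  rw [levyExponent]
  refine (norm_add_le _ _).trans (add_le_add ((norm_sub_le _ _).trans (add_le_add ?_ ?_)) ?_)
  · simp
  · simp only [norm_mul, norm_pow, Complex.norm_real, Real.norm_eq_abs, sq_abs]
    norm_num
    nlinarith [mul_nonneg (sq_nonneg σ) (sq_nonneg q)]
  · rw [← integral_const_mul]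
    exact norm_integral_le_of_norm_le (hν.integrable_min_sq.const_mul _)
      (ae_of_all _ fun x => norm_levyKernel_le q x)

lemma norm_exp_sub_one_le_of_norm_exp_le {z : ℂ} (hz : ‖Complex.exp z‖ ≤ 1) :
    ‖Complex.exp z - 1‖ ≤ 2 * ‖z‖ := by
  rcases le_or_gt ‖z‖ 1 with h | h
  · exact Complex.norm_exp_sub_one_le h
  · refine (norm_sub_le _ _).trans ?_
    rw [norm_one]
    linarith

/-- `∫ F dπ = ∫ 𝓕F(ξ) π̂(2πξ) dξ` for Schwartz functions. -/
lemma integral_schwartz_eq (F : 𝓢(ℝ, ℂ)) (π : Measure ℝ) [IsFiniteMeasure π] :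
    ∫ x, F x ∂π = ∫ ξ : ℝ, 𝓕 F ξ * charFun π (2 * Real.pi * ξ) := by
  have h1 : ∀ x, F x = ∫ ξ : ℝ, Complex.exp (Complex.I * (2 * Real.pi * ξ : ℝ) * x) * 𝓕 F ξ := by
    intro x
    have hF : (𝓕⁻ (𝓕 F : 𝓢(ℝ, ℂ)) : 𝓢(ℝ, ℂ)) = F := FourierTransform.fourierInv_fourier_eq F
    conv_lhs => rw [← hF, SchwartzMap.fourierInv_coe]
    rw [Real.fourierInv_eq']
    congr 1
    ext ξ
    rw [smul_eq_mul]
    congr 2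
    simp
    ring
  have hint : Integrable (fun p : ℝ × ℝ => Complex.exp (Complex.I * (2 * Real.pi * p.2 : ℝ) * p.1)
      * 𝓕 F p.2) (π.prod volume) := by
    have hg : Integrable (fun p : ℝ × ℝ => (1 : ℂ) * 𝓕 F p.2) (π.prod volume) :=
      (integrable_const (1 : ℂ)).mul_prod (𝓕 F).integrable
    refine hg.mono (by
      have := (𝓕 F).continuous
      exact Continuous.aestronglyMeasurable (by fun_prop)) (ae_of_all _ fun p => ?_)
    have : Complex.I * (2 * Real.pi * p.2 : ℝ) * p.1
        = ((2 * Real.pi * p.2 * p.1 : ℝ) : ℂ) * Complex.I := by push_cast; ring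
    rw [norm_mul, norm_mul, this, Complex.norm_exp_ofReal_mul_I, norm_one]
  simp_rw [h1]
  rw [integral_integral_swap hint]
  congr 1
  ext ξ
  rw [integral_mul_const, mul_comm, charFun_apply_real]
  congr 2
  ext x
  congr 1
  push_cast
  ring

lemma integral_fourier_mul (F : 𝓢(ℝ, ℂ)) :
    ∫ ξ : ℝ, Complex.I * (2 * Real.pi * ξ : ℝ) * 𝓕 F ξ = deriv F 0 := by
  let F1 : 𝓢(ℝ, ℂ) := SchwartzMap.derivCLM ℂ ℂ F
  have h1 : ∀ ξ : ℝ, 𝓕 F1 ξ = Complex.I * (2 * Real.pi * ξ : ℝ) * 𝓕 F ξ := by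
    intro ξ
    have := Real.fourier_deriv F.integrable F.differentiable F1.integrable
    have h2 := congrFun this ξ
    rw [smul_eq_mul] at h2
    rw [SchwartzMap.fourier_coe, SchwartzMap.fourier_coe]
    refine Eq.trans h2 ?_
    push_cast
    ring
  simp_rw [← h1]
  have h3 := integral_schwartz_eq F1 (Measure.dirac 0)
  rw [integral_dirac] at h3
  simp only [charFun_dirac, inner_zero_left, Complex.ofReal_zero, zero_mul, Complex.exp_zero,
    mul_one] at h3
  rw [← h3]
  rfl

lemma integral_fourier (F : 𝓢(ℝ, ℂ)) : ∫ ξ : ℝ, 𝓕 F ξ = F 0 := by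
  have h3 := integral_schwartz_eq F (Measure.dirac 0)
  rw [integral_dirac] at h3
  simp only [charFun_dirac, inner_zero_left, Complex.ofReal_zero, zero_mul, Complex.exp_zero,
    mul_one] at h3
  exact h3.symm

/-- The generator, at `0`, of the semigroup with Lévy exponent `ψ`, applied to a test function
vanishing to second order at `0`. -/
lemma integral_fourier_mul_levyExponent (hν : IsLevyMeasure ν) (F : 𝓢(ℝ, ℂ)) (h0 : F 0 = 0)
    (h1 : deriv F 0 = 0) :
    ∫ ξ : ℝ, 𝓕 F ξ * levyExponent a σ ν (2 * Real.pi * ξ)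
      = (σ ^ 2 / 2 : ℝ) * deriv (deriv F) 0 + ∫ x, F x ∂ν := by
  have := hν.sigmaFinite
  let g : 𝓢(ℝ, ℂ) := 𝓕 F
  let F1 : 𝓢(ℝ, ℂ) := SchwartzMap.derivCLM ℂ ℂ F
  have hg1 : ∀ ξ : ℝ, 𝓕 F1 ξ = Complex.I * (2 * Real.pi * ξ : ℝ) * g ξ := by
    intro ξ
    have := Real.fourier_deriv F.integrable F.differentiable F1.integrable
    have h2 := congrFun this ξ
    rw [smul_eq_mul] at h2
    rw [SchwartzMap.fourier_coe]
    refine Eq.trans h2 ?_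
    push_cast
    rw [← SchwartzMap.fourier_coe]
    ring
  have hI0 : ∫ ξ : ℝ, g ξ = 0 := (integral_fourier F).trans h0
  have hI1 : ∫ ξ : ℝ, Complex.I * (2 * Real.pi * ξ : ℝ) * g ξ = 0 :=
    (integral_fourier_mul F).trans h1
  have hI2 : ∫ ξ : ℝ, Complex.I * (2 * Real.pi * ξ : ℝ)
      * (Complex.I * (2 * Real.pi * ξ : ℝ) * g ξ) = deriv (deriv F) 0 := by
    rw [← show deriv F1 0 = deriv (deriv F) 0 from rfl, ← integral_fourier_mul F1]
    simp_rw [hg1]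
  have hi0 : Integrable (g : ℝ → ℂ) := g.integrable
  have hi1 : Integrable (fun ξ : ℝ => Complex.I * (2 * Real.pi * ξ : ℝ) * g ξ) := by
    simp_rw [← hg1]; exact (𝓕 F1).integrable
  have hi2 : Integrable (fun ξ : ℝ => Complex.I * (2 * Real.pi * ξ : ℝ)
      * (Complex.I * (2 * Real.pi * ξ : ℝ) * g ξ)) := by
    have := (𝓕 (SchwartzMap.derivCLM ℂ ℂ F1) : 𝓢(ℝ, ℂ)).integrable (μ := volume)
    refine this.congr (ae_of_all _ fun ξ => ?_)
    have h3 := congrFun (Real.fourier_deriv F1.integrable F1.differentiable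
      (SchwartzMap.derivCLM ℂ ℂ F1).integrable) ξ
    rw [smul_eq_mul] at h3
    rw [SchwartzMap.fourier_coe]
    refine Eq.trans h3 ?_
    rw [← SchwartzMap.fourier_coe, hg1]
    push_cast
    ring
  -- Fubini for the jump part, with an integrable bound in product form
  let K : ℝ → ℝ → ℂ := fun ξ x => Complex.exp (Complex.I * (2 * Real.pi * ξ : ℝ) * x) - 1
    - Complex.I * (2 * Real.pi * ξ : ℝ) * (trunc x : ℂ)
  have hmeas : Measurable (fun p : ℝ × ℝ => g p.1 * K p.1 p.2) := by
    have h1 := measurable_trunc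
    have h2 := g.continuous.measurable
    fun_prop
  have hbi : Integrable (fun ξ : ℝ => (2 : ℝ) * ‖g ξ‖
      + 3 * ‖Complex.I * (2 * Real.pi * ξ : ℝ) * (Complex.I * (2 * Real.pi * ξ : ℝ) * g ξ)‖) :=
    (hi0.norm.const_mul _).add (hi2.norm.const_mul _)
  have hprod : Integrable (fun p : ℝ × ℝ => g p.1 * K p.1 p.2) (volume.prod ν) := by
    refine (hbi.mul_prod hν.integrable_min_sq).mono' hmeas.aestronglyMeasurable
      (ae_of_all _ fun p => ?_)
    rw [norm_mul]
    refine (mul_le_mul_of_nonneg_left (norm_levyKernel_le _ _) (norm_nonneg _)).trans (le_of_eq ?_)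
    simp only [norm_mul, Complex.norm_I, Complex.norm_real, one_mul, Real.norm_eq_abs]
    rw [← sq_abs (2 * Real.pi * p.1), abs_mul, abs_mul]
    ring
  have hswap : ∫ ξ : ℝ, g ξ * ∫ x, K ξ x ∂ν = ∫ x, F x ∂ν := by
    simp_rw [← integral_const_mul]
    rw [integral_integral_swap hprod]
    congr 1
    ext x
    have e1 : ∀ ξ : ℝ, g ξ * K ξ x = g ξ * Complex.exp (Complex.I * (2 * Real.pi * ξ : ℝ) * x)
        - g ξ - (trunc x : ℂ) * (Complex.I * (2 * Real.pi * ξ : ℝ) * g ξ) := by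
      intro ξ
      simp only [K]
      ring
    have hie : Integrable (fun ξ : ℝ => g ξ * Complex.exp (Complex.I * (2 * Real.pi * ξ : ℝ) * x)) := by
      refine hi0.norm.mono' (by
        have := g.continuous
        exact Continuous.aestronglyMeasurable (by fun_prop)) (ae_of_all _ fun ξ => ?_)
      have : Complex.I * (2 * Real.pi * ξ : ℝ) * x
        = ((2 * Real.pi * ξ * x : ℝ) : ℂ) * Complex.I := by push_cast; ring
      rw [norm_mul, this, Complex.norm_exp_ofReal_mul_I, mul_one]
    simp_rw [e1]
    have hA : Integrable (fun ξ : ℝ =>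
        g ξ * Complex.exp (Complex.I * (2 * Real.pi * ξ : ℝ) * x) - g ξ) := hie.sub hi0
    rw [integral_sub hA (hi1.const_mul _), integral_sub hie hi0, integral_const_mul,
      hI0, hI1, mul_zero, sub_zero, sub_zero]
    have h3 := integral_schwartz_eq F (Measure.dirac x)
    rw [integral_dirac] at h3
    rw [h3]
    congr 1
    ext ξ
    rw [charFun_dirac]
    congr 2
    simp
    ring
  have hK : ∀ q : ℝ, Integrable (fun x => K q x) ν := fun q =>
    (hν.integrable_min_sq.const_mul _).mono' (by
      have h1 := measurable_trunc
      exact Measurable.aestronglyMeasurable (by fun_prop))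
      (ae_of_all _ fun x => norm_levyKernel_le _ x)
  have hiK : Integrable (fun ξ : ℝ => g ξ * ∫ x, K ξ x ∂ν) := by
    have := hprod.integral_prod_left
    simpa only [integral_const_mul] using this
  have e2 : ∀ ξ : ℝ, 𝓕 F ξ * levyExponent a σ ν (2 * Real.pi * ξ)
      = (a : ℂ) * (Complex.I * (2 * Real.pi * ξ : ℝ) * g ξ)
        + ((σ ^ 2 / 2 : ℝ) : ℂ) * (Complex.I * (2 * Real.pi * ξ : ℝ)
          * (Complex.I * (2 * Real.pi * ξ : ℝ) * g ξ))
        + g ξ * ∫ x, K ξ x ∂ν := by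
    intro ξ
    simp only [levyExponent, g, K]
    have : Complex.I * (2 * Real.pi * ξ : ℝ) * (Complex.I * (2 * Real.pi * ξ : ℝ) * 𝓕 F ξ)
        = -((2 * Real.pi * ξ : ℝ) : ℂ) ^ 2 * 𝓕 F ξ := by
      linear_combination (((2 * Real.pi * ξ : ℝ) : ℂ) ^ 2 * 𝓕 F ξ) * Complex.I_sq
    rw [this]
    push_cast
    ring
  simp_rw [e2]
  have hA : Integrable (fun ξ : ℝ => (a : ℂ) * (Complex.I * (2 * Real.pi * ξ : ℝ) * g ξ)
      + ((σ ^ 2 / 2 : ℝ) : ℂ) * (Complex.I * (2 * Real.pi * ξ : ℝ)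
        * (Complex.I * (2 * Real.pi * ξ : ℝ) * g ξ))) :=
    (hi1.const_mul _).add (hi2.const_mul _)
  rw [integral_add hA hiK,
    integral_add (hi1.const_mul _) (hi2.const_mul _), integral_const_mul, integral_const_mul, hI1,
    hI2, hswap, mul_zero, zero_add]

/-- Small-time asymptotics of the laws with Lévy exponent `ψ`, for test functions vanishing to
second order at `0`.  Only the values of the laws at a sequence of times are needed. -/
lemma tendsto_integral_div (hν : IsLevyMeasure ν) (F : 𝓢(ℝ, ℂ)) (h0 : F 0 = 0)
    (h1 : deriv F 0 = 0) {τ : ℕ → ℝ} (hτ : ∀ n, 0 < τ n) (hτ0 : Tendsto τ atTop (𝓝 0))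
    {π : ℕ → Measure ℝ} [∀ n, IsProbabilityMeasure (π n)]
    (hπ : ∀ n q, charFun (π n) q = Complex.exp (levyExponent a σ ν q * τ n)) :
    Tendsto (fun n => (∫ x, F x ∂(π n)) / (τ n : ℂ)) atTop
      (𝓝 ((σ ^ 2 / 2 : ℝ) * deriv (deriv F) 0 + ∫ x, F x ∂ν)) := by
  rw [← integral_fourier_mul_levyExponent (a := a) hν F h0 h1]
  have hg := (𝓕 F : 𝓢(ℝ, ℂ)).integrable (μ := volume)
  have e1 : ∀ n, (∫ x, F x ∂(π n)) / (τ n : ℂ)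
      = ∫ ξ : ℝ, 𝓕 F ξ * ((charFun (π n) (2 * Real.pi * ξ) - 1) / (τ n : ℂ)) := by
    intro n
    have hb : Integrable (fun ξ : ℝ => 𝓕 F ξ * charFun (π n) (2 * Real.pi * ξ)) := by
      refine hg.mul_bdd (c := 1) ?_ (ae_of_all _ fun ξ => norm_charFun_le_one _)
      exact (measurable_charFun.comp (measurable_const_mul _)).aestronglyMeasurable
    have e : ∀ ξ : ℝ, 𝓕 F ξ * ((charFun (π n) (2 * Real.pi * ξ) - 1) / (τ n : ℂ))
        = (𝓕 F ξ * charFun (π n) (2 * Real.pi * ξ) - 𝓕 F ξ) / (τ n : ℂ) := fun ξ => by ring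
    simp_rw [e]
    rw [integral_div, integral_sub hb hg, ← integral_schwartz_eq, integral_fourier, h0, sub_zero]
  simp_rw [e1]
  let C : ℝ := ∫ x, min 1 (|x| ^ 2) ∂ν
  have hC : 0 ≤ C := integral_nonneg fun x => by positivity
  have hbd : Integrable (fun ξ : ℝ => (2 * (|a| * (2 * Real.pi) + σ ^ 2 * (2 * Real.pi) ^ 2
      + (2 + 3 * (2 * Real.pi) ^ 2) * C)) * (‖(𝓕 F) ξ‖ + ‖ξ‖ ^ 1 * ‖(𝓕 F) ξ‖
        + ‖ξ‖ ^ 2 * ‖(𝓕 F) ξ‖)) :=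
    ((hg.norm.add ((𝓕 F : 𝓢(ℝ, ℂ)).integrable_pow_mul volume 1)).add
      ((𝓕 F : 𝓢(ℝ, ℂ)).integrable_pow_mul volume 2)).const_mul _
  refine tendsto_integral_of_dominated_convergence _ (fun n => ?_) hbd
    (fun n => ae_of_all _ fun ξ => ?_) (ae_of_all _ fun ξ => ?_)
  · have h2 := (𝓕 F : 𝓢(ℝ, ℂ)).continuous
    have h3 : Measurable (fun ξ : ℝ => charFun (π n) (2 * Real.pi * ξ)) :=
      measurable_charFun.comp (measurable_const_mul _)
    exact (h2.measurable.mul ((h3.sub_const _).div_const _)).aestronglyMeasurable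
  · rw [norm_mul, norm_div, Complex.norm_real, Real.norm_of_nonneg (hτ n).le]
    have h2 : ‖charFun (π n) (2 * Real.pi * ξ) - 1‖
        ≤ 2 * (‖levyExponent a σ ν (2 * Real.pi * ξ)‖ * τ n) := by
      have h3 : ‖charFun (π n) (2 * Real.pi * ξ)‖ ≤ 1 := norm_charFun_le_one _
      rw [hπ] at h3 ⊢
      refine (norm_exp_sub_one_le_of_norm_exp_le h3).trans (le_of_eq ?_)
      rw [norm_mul, Complex.norm_real, Real.norm_of_nonneg (hτ n).le]
    have h4 : ‖charFun (π n) (2 * Real.pi * ξ) - 1‖ / τ n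
        ≤ 2 * ‖levyExponent a σ ν (2 * Real.pi * ξ)‖ := by
      rw [div_le_iff₀ (hτ n)]
      linarith
    have h5 := norm_levyExponent_le (a := a) (σ := σ) hν (2 * Real.pi * ξ)
    have h6 : |a| * |2 * Real.pi * ξ| + σ ^ 2 * (2 * Real.pi * ξ) ^ 2
        + (2 + 3 * (2 * Real.pi * ξ) ^ 2) * C
        ≤ (|a| * (2 * Real.pi) + σ ^ 2 * (2 * Real.pi) ^ 2 + (2 + 3 * (2 * Real.pi) ^ 2) * C)
          * (1 + |ξ| + |ξ| ^ 2) := by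
      rw [abs_mul, abs_of_pos (by positivity : (0 : ℝ) < 2 * Real.pi), mul_pow, ← sq_abs ξ]
      have p1 : 0 ≤ |a| * (2 * Real.pi) := by positivity
      have p2 : 0 ≤ σ ^ 2 * (2 * Real.pi) ^ 2 := by positivity
      have p3 : 0 ≤ (2 * Real.pi) ^ 2 * C := by positivity
      have p4 := abs_nonneg ξ
      have p5 := sq_nonneg |ξ|
      have q1 := mul_nonneg p1 p5
      have q2 := mul_nonneg p2 p4
      have q3 := mul_nonneg p3 p4
      have q4 := mul_nonneg hC p4
      have q5 := mul_nonneg hC p5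
      nlinarith
    calc ‖(𝓕 F) ξ‖ * (‖charFun (π n) (2 * Real.pi * ξ) - 1‖ / τ n)
        ≤ ‖(𝓕 F) ξ‖ * (2 * ((|a| * (2 * Real.pi) + σ ^ 2 * (2 * Real.pi) ^ 2
          + (2 + 3 * (2 * Real.pi) ^ 2) * C) * (1 + |ξ| + |ξ| ^ 2))) := by
          refine mul_le_mul_of_nonneg_left ?_ (norm_nonneg _)
          linarith [h5.trans h6]
      _ = _ := by
          simp only [Real.norm_eq_abs]
          ring
  · refine tendsto_const_nhds.mul ?_
    simp_rw [hπ]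
    have hd : HasDerivAt (fun t : ℂ => Complex.exp (levyExponent a σ ν (2 * Real.pi * ξ) * t))
        (levyExponent a σ ν (2 * Real.pi * ξ)) 0 := by
      have := ((hasDerivAt_id (0 : ℂ)).const_mul (levyExponent a σ ν (2 * Real.pi * ξ))).cexp
      simpa using this
    have ht : Tendsto (fun n => (τ n : ℂ)) atTop (𝓝[≠] 0) := by
      refine tendsto_nhdsWithin_iff.2 ⟨?_, Eventually.of_forall fun n => ?_⟩
      · have := (Complex.continuous_ofReal.tendsto 0).comp hτ0
        simpa [Function.comp_def] using this
      · simpa using (hτ n).ne'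
    have := hd.tendsto_slope.comp ht
    refine this.congr fun n => ?_
    simp [slope_def_field]

end generator

end

section

/-! ### Infinitely divisible laws whose small-time marginals satisfy `Y_τ ≤ τ` -/

lemma min_one_abs_le {x : ℝ} (hx : x ≤ 0) : min 1 |x| ≤ 2 * (1 - Real.exp x) := by
  have h1 : 0 < 1 - x := by linarith
  have h2 : Real.exp x ≤ 1 / (1 - x) := by
    rw [le_div_iff₀ h1]
    have h3 := Real.add_one_le_exp (-x)
    calc Real.exp x * (1 - x) ≤ Real.exp x * Real.exp (-x) :=
          mul_le_mul_of_nonneg_left (by linarith) (Real.exp_pos x).le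
      _ = 1 := by rw [← Real.exp_add]; simp
  have h4 : min 1 |x| ≤ 2 * (1 - 1 / (1 - x)) := by
    rw [abs_of_nonpos hx]
    have h5 : 1 - 1 / (1 - x) = -x / (1 - x) := by field_simp; ring
    rw [h5, ← mul_div_assoc, le_div_iff₀ h1]
    rcases le_total 1 (-x) with h | h
    · rw [min_eq_left h]; linarith
    · rw [min_eq_right h]; nlinarith
  linarith

/-- Laws with Lévy exponent `ψ` at times tending to `0`, at most `τ` at time `τ`, with exponential
mean at least one. -/
structure SmallTimeBounded (a σ : ℝ) (ν : Measure ℝ) (τ : ℕ → ℝ) (π : ℕ → Measure ℝ) : Prop where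
  pos : ∀ n, 0 < τ n
  tendsto : Tendsto τ atTop (𝓝 0)
  prob : ∀ n, IsProbabilityMeasure (π n)
  charFun_eq : ∀ n q, charFun (π n) q = Complex.exp (levyExponent a σ ν q * τ n)
  ae_le : ∀ n, ∀ᵐ x ∂(π n), x ≤ τ n
  one_le : ∀ n, 1 ≤ ∫⁻ x, ENNReal.ofReal (Real.exp x) ∂(π n)

namespace SmallTimeBounded

variable {a σ : ℝ} {ν : Measure ℝ} {τ : ℕ → ℝ} {π : ℕ → Measure ℝ}

/-- For a test function dominated by `κ (1 - e^x)` on the left and by `K x²` on the right,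
`E f(Y_τ) ≤ κ (e^τ - 1) + K τ²` because `Y_τ ≤ τ` and `E e^{Y_τ} ≥ 1`. -/
lemma generator_le (h : SmallTimeBounded a σ ν τ π) (hν : IsLevyMeasure ν) {f : ℝ → ℝ}
    (hf : ContDiff ℝ (⊤ : ℕ∞) f) (hs : HasCompactSupport f) (hnn : ∀ x, 0 ≤ f x) (h0 : f 0 = 0)
    {κ K : ℝ} (hκ : 0 ≤ κ) (hK : 0 ≤ K) (hl : ∀ x ≤ 0, f x ≤ κ * (1 - Real.exp x))
    (hr : ∀ x, 0 ≤ x → f x ≤ K * x ^ 2) :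
    σ ^ 2 / 2 * deriv (deriv f) 0 + ∫ x, f x ∂ν ≤ κ := by
  have := h.prob
  have hs' : HasCompactSupport (fun x => (f x : ℂ)) := hs.comp_left (g := fun x : ℝ => (x : ℂ)) rfl
  have hf' : ContDiff ℝ (⊤ : ℕ∞) (fun x => (f x : ℂ)) := Complex.ofRealCLM.contDiff.comp hf
  let F : SchwartzMap ℝ ℂ := hs'.toSchwartzMap hf'
  have hFx : ∀ x, F x = f x := fun x => rfl
  have hdf : Differentiable ℝ f := hf.differentiable (by simp)
  have hF1 : ∀ x, deriv F x = (deriv f x : ℝ) := fun x =>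
    ((hdf x).hasDerivAt.ofReal_comp).deriv
  have hdf2 : Differentiable ℝ (deriv f) :=
    ((contDiff_infty_iff_deriv.1 hf).2).differentiable (by simp)
  have hF2 : deriv (deriv F) 0 = (deriv (deriv f) 0 : ℝ) := by
    have : deriv F = fun x => ((deriv f x : ℝ) : ℂ) := funext hF1
    rw [this]
    exact ((hdf2 0).hasDerivAt.ofReal_comp).deriv
  have hmin : deriv f 0 = 0 :=
    IsLocalMin.deriv_eq_zero (Eventually.of_forall fun x => by rw [h0]; exact hnn x)
  have hlim := tendsto_integral_div hν F (by rw [hFx, h0]; simp) (by rw [hF1, hmin]; simp)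
    h.pos h.tendsto h.charFun_eq
  have hlim' : Tendsto (fun n => (∫ x, f x ∂(π n)) / τ n) atTop
      (𝓝 (σ ^ 2 / 2 * deriv (deriv f) 0 + ∫ x, f x ∂ν)) := by
    have := (Complex.continuous_re.tendsto _).comp hlim
    simp only [hFx, hF2, integral_complex_ofReal] at this
    convert! this using 2
    · simp only [Function.comp_apply]
      rw [← Complex.ofReal_div, Complex.ofReal_re]
    · rw [← Complex.ofReal_mul, ← Complex.ofReal_add, Complex.ofReal_re]
  have hup : Tendsto (fun n => κ * ((Real.exp (τ n) - 1) / τ n) + K * τ n) atTop (𝓝 κ) := by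
    have h1 : Tendsto (fun n => (Real.exp (τ n) - 1) / τ n) atTop (𝓝 1) := by
      have hd := (Real.hasDerivAt_exp 0).tendsto_slope
      rw [Real.exp_zero] at hd
      have ht : Tendsto τ atTop (𝓝[≠] 0) :=
        tendsto_nhdsWithin_iff.2 ⟨h.tendsto, Eventually.of_forall fun n => (h.pos n).ne'⟩
      refine (hd.comp ht).congr fun n => ?_
      simp [slope_def_field]
    have := (h1.const_mul κ).add (h.tendsto.const_mul K)
    simpa using this
  refine le_of_tendsto_of_tendsto' hlim' hup fun n => ?_
  have hτ := h.pos n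
  have hei : Integrable (fun x => Real.exp x) (π n) :=
    Integrable.of_bound (by fun_prop) (Real.exp (τ n)) ((h.ae_le n).mono fun x hx => by
      rw [Real.norm_of_nonneg (Real.exp_pos _).le]
      exact Real.exp_le_exp.2 hx)
  have he1 : 1 ≤ ∫ x, Real.exp x ∂(π n) := by
    have := h.one_le n
    rw [← ofReal_integral_eq_lintegral_ofReal hei (ae_of_all _ fun x => (Real.exp_pos _).le),
      ENNReal.one_le_ofReal] at this
    exact this
  have hfi : Integrable f (π n) := hf.continuous.integrable_of_hasCompactSupport hs
  have hgi : Integrable (fun x => κ * (1 - Real.exp x) + (κ * (Real.exp (τ n) - 1) + K * τ n ^ 2))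
      (π n) := (((integrable_const _).sub hei).const_mul κ).add (integrable_const _)
  have hle : ∫ x, f x ∂(π n)
      ≤ ∫ x, (κ * (1 - Real.exp x) + (κ * (Real.exp (τ n) - 1) + K * τ n ^ 2)) ∂(π n) := by
    refine integral_mono_ae hfi hgi ((h.ae_le n).mono fun x hx => ?_)
    have hex := Real.exp_le_exp.2 hx
    rcases le_total x 0 with hx0 | hx0
    · have h1 := hl x hx0
      have h2 : 0 ≤ κ * (Real.exp (τ n) - 1) :=
        mul_nonneg hκ (by linarith [Real.add_one_le_exp (τ n)])
      have h3 : 0 ≤ K * τ n ^ 2 := by positivity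
      simp only
      linarith
    · have h1 := hr x hx0
      have h2 : K * x ^ 2 ≤ K * τ n ^ 2 := by gcongr
      have h3 : 0 ≤ κ * (Real.exp (τ n) - Real.exp x) := mul_nonneg hκ (by linarith)
      simp only
      linarith
  have hval : ∫ x, (κ * (1 - Real.exp x) + (κ * (Real.exp (τ n) - 1) + K * τ n ^ 2)) ∂(π n)
      = κ * (1 - ∫ x, Real.exp x ∂(π n)) + (κ * (Real.exp (τ n) - 1) + K * τ n ^ 2) := by
    have hi : Integrable (fun x => κ * (1 - Real.exp x)) (π n) :=
      ((integrable_const _).sub hei).const_mul κ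
    rw [integral_add hi (integrable_const _), integral_const_mul,
      integral_sub (integrable_const _) hei]
    simp
  rw [hval] at hle
  have h2 : κ * (1 - ∫ x, Real.exp x ∂(π n)) ≤ 0 :=
    mul_nonpos_of_nonneg_of_nonpos hκ (by linarith)
  rw [div_le_iff₀ hτ, add_mul, mul_assoc, div_mul_cancel₀ _ hτ.ne']
  nlinarith

lemma deriv_deriv_eq_zero {f : ℝ → ℝ} {x : ℝ} (h : f =ᶠ[𝓝 x] fun _ => 0) :
    deriv (deriv f) x = 0 := by
  have h1 : deriv f =ᶠ[𝓝 x] fun _ => 0 := by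
    refine h.deriv.trans (Eventually.of_forall fun y => ?_)
    simp
  rw [h1.deriv_eq]
  simp

/-- Test functions supported in the positive half-line satisfy `generator_le` with `κ = 0`. -/
lemma measure_Ioi (h : SmallTimeBounded a σ ν τ π) (hν : IsLevyMeasure ν) : ν (Ioi 0) = 0 := by
  refine measure_null_of_locally_null _ fun x hx => ?_
  have hx0 : (0 : ℝ) < x := hx
  let b : ContDiffBump x := ⟨x / 4, x / 2, by positivity, by linarith⟩
  have hsupp : ∀ y, y ≤ x / 2 → b y = 0 := fun y hy => by
    refine b.zero_of_le_dist ?_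
    rw [Real.dist_eq, abs_of_nonpos (by linarith)]
    change x / 2 ≤ _
    linarith
  have h1 := h.generator_le hν (f := b) b.contDiff b.hasCompactSupport (fun y => b.nonneg)
    (hsupp 0 (by linarith)) (κ := 0) (K := 4 / x ^ 2) le_rfl (by positivity)
    (fun y hy => by rw [hsupp y (by linarith)]; simp) (fun y hy => by
      rcases le_or_gt y (x / 2) with hy2 | hy2
      · rw [hsupp y hy2]; positivity
      · refine b.le_one.trans ?_
        rw [div_mul_eq_mul_div, le_div_iff₀ (by positivity)]
        nlinarith)
  have h2 : deriv (deriv b) 0 = 0 := deriv_deriv_eq_zero <| by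
    filter_upwards [gt_mem_nhds (show (0 : ℝ) < x / 2 by positivity)] with y hy
    exact hsupp y (le_of_lt hy)
  rw [h2, mul_zero, zero_add] at h1
  have hb_int : Integrable b ν := by
    refine (hν.integrable_min_sq.const_mul (1 + 4 / x ^ 2)).mono' b.continuous.aestronglyMeasurable
      (ae_of_all _ fun y => ?_)
    rw [Real.norm_of_nonneg b.nonneg]
    rcases le_or_gt y (x / 2) with hy2 | hy2
    · rw [hsupp y hy2]; positivity
    · refine b.le_one.trans ?_
      rw [mul_min_of_nonneg _ _ (by positivity)]
      refine le_min (by have : 0 ≤ 4 / x ^ 2 := by positivity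
                        linarith) ?_
      have : 1 ≤ 4 / x ^ 2 * |y| ^ 2 := by
        rw [div_mul_eq_mul_div, le_div_iff₀ (by positivity), sq_abs]
        nlinarith
      nlinarith [sq_nonneg |y|]
  have h3 : ∫ y, b y ∂ν = 0 := le_antisymm h1 (integral_nonneg fun y => b.nonneg)
  rw [integral_eq_zero_iff_of_nonneg (fun y => b.nonneg) hb_int] at h3
  refine ⟨Metric.closedBall x (x / 4), mem_nhdsWithin_of_mem_nhds
    (Metric.closedBall_mem_nhds x (by positivity)), ?_⟩
  refine measure_mono_null (fun y hy => ?_) (ae_iff.1 h3)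
  have : b y = 1 := b.one_of_mem_closedBall hy
  change ¬ (b y = 0)
  rw [this]
  norm_num

/-- The test functions are `x²` times a bump function of width `δ`, for which `κ` is of order
`δ`. -/
lemma sigma_eq_zero (h : SmallTimeBounded a σ ν τ π) (hν : IsLevyMeasure ν) : σ = 0 := by
  have key : ∀ δ : ℝ, 0 < δ → δ ≤ 1 → σ ^ 2 ≤ 2 * δ := by
    intro δ hδ hδ1
    let b : ContDiffBump (0 : ℝ) := ⟨δ / 2, δ, by positivity, by linarith⟩
    let f : ℝ → ℝ := fun x => x ^ 2 * b x
    have hsupp : ∀ y, δ ≤ |y| → b y = 0 := fun y hy => by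
      refine b.zero_of_le_dist ?_
      rw [Real.dist_eq, sub_zero]
      exact hy
    have h1 := h.generator_le hν (f := f) (by
      have : ContDiff ℝ (⊤ : ℕ∞) b := b.contDiff
      fun_prop) b.hasCompactSupport.mul_left
      (fun y => mul_nonneg (sq_nonneg _) b.nonneg) (by simp [f]) (κ := 2 * δ) (K := 1)
      (by positivity) zero_le_one (fun y hy => by
        have hy1 : 0 ≤ 1 - Real.exp y := by linarith [Real.exp_le_one_iff.2 hy]
        rcases le_or_gt δ |y| with hy2 | hy2
        · simp only [f, hsupp y hy2, mul_zero]
          positivity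
        · have h3 := min_one_abs_le hy
          rw [min_eq_right (by linarith)] at h3
          calc y ^ 2 * b y ≤ y ^ 2 * 1 := mul_le_mul_of_nonneg_left b.le_one (sq_nonneg _)
            _ = |y| * |y| := by rw [← sq_abs]; ring
            _ ≤ δ * (2 * (1 - Real.exp y)) := mul_le_mul hy2.le h3 (abs_nonneg _) hδ.le
            _ = 2 * δ * (1 - Real.exp y) := by ring)
      (fun y _ => by
        rw [one_mul]
        exact mul_le_of_le_one_right (sq_nonneg _) b.le_one)
    have h2 : deriv (deriv f) 0 = 2 := by
      have e1 : f =ᶠ[𝓝 0] fun x => x ^ 2 := by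
        filter_upwards [b.eventuallyEq_one] with y hy
        simp only [f, hy]
        simp
      have e2 : deriv f =ᶠ[𝓝 0] fun x => 2 * x := by
        refine e1.deriv.trans (Eventually.of_forall fun y => ?_)
        simp
      rw [e2.deriv_eq]
      simp
    have h3 : 0 ≤ ∫ x, f x ∂ν := integral_nonneg fun y => mul_nonneg (sq_nonneg _) b.nonneg
    rw [h2] at h1
    linarith
  have : σ ^ 2 ≤ 0 := by
    refine le_of_forall_pos_le_add fun e he => ?_
    have := key (min (e / 2) 1) (by positivity) (min_le_right _ _)
    linarith [min_le_left (e / 2) 1]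
  exact pow_eq_zero_iff two_ne_zero |>.1 (le_antisymm this (sq_nonneg _))

/-- The test functions are `1 - e^x` times bump functions increasing to the indicator of
`(-∞, 0)`, for which `κ = 1`. -/
lemma lintegral_one_sub_exp_le (h : SmallTimeBounded a σ ν τ π) (hν : IsLevyMeasure ν) :
    ∫⁻ x in Iio 0, ENNReal.ofReal (1 - Real.exp x) ∂ν ≤ 1 := by
  let b : ∀ n : ℕ, ContDiffBump (-((n : ℝ) + 1)) := fun n =>
    ⟨n + 1 - 1 / (n + 2), n + 1 - 1 / (n + 3), by
      have : 1 / ((n : ℝ) + 2) < 1 := by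
        rw [div_lt_one (by positivity)]
        linarith [(Nat.cast_nonneg n : (0 : ℝ) ≤ n)]
      linarith [(Nat.cast_nonneg n : (0 : ℝ) ≤ n)], by
      have : 1 / ((n : ℝ) + 3) < 1 / ((n : ℝ) + 2) :=
        one_div_lt_one_div_of_lt (by positivity) (by linarith)
      linarith⟩
  have hsupp : ∀ n : ℕ, ∀ y, -(1 / ((n : ℝ) + 3)) ≤ y → b n y = 0 := fun n y hy => by
    refine (b n).zero_of_le_dist ?_
    rw [Real.dist_eq]
    refine le_trans ?_ (le_abs_self _)
    change (n : ℝ) + 1 - 1 / (n + 3) ≤ _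
    linarith
  have hpos : ∀ n : ℕ, (0 : ℝ) < 1 / ((n : ℝ) + 3) := fun n => by positivity
  let f : ℕ → ℝ → ℝ := fun n x => (1 - Real.exp x) * b n x
  have hfnn : ∀ n x, 0 ≤ f n x := fun n x => by
    rcases le_total 0 x with hx | hx
    · simp [f, hsupp n x (by linarith [hpos n])]
    · exact mul_nonneg (by linarith [Real.exp_le_one_iff.2 hx]) (b n).nonneg
  have hle : ∀ n, ∫ x, f n x ∂ν ≤ 1 := by
    intro n
    have h1 := h.generator_le hν (f := f n) (by
      have : ContDiff ℝ (⊤ : ℕ∞) (b n) := (b n).contDiff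
      have h2 : ContDiff ℝ (⊤ : ℕ∞) Real.exp := Real.contDiff_exp
      simp only [f]
      fun_prop) (b n).hasCompactSupport.mul_left (hfnn n) (by simp [f]) (κ := 1) (K := 0)
      zero_le_one le_rfl (fun y hy => by
        rw [one_mul]
        exact mul_le_of_le_one_right (by linarith [Real.exp_le_one_iff.2 hy]) (b n).le_one)
      (fun y hy => by simp [f, hsupp n y (by linarith [hpos n])])
    have h2 : deriv (deriv (f n)) 0 = 0 := deriv_deriv_eq_zero <| by
      filter_upwards [lt_mem_nhds (show -(1 / ((n : ℝ) + 3)) < 0 by linarith [hpos n])] with y hy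
      simp [f, hsupp n y (le_of_lt hy)]
    rwa [h2, mul_zero, zero_add] at h1
  have hfm : ∀ n, Measurable (f n) := fun n => by
    have := (b n).continuous.measurable
    simp only [f]
    fun_prop
  have hint : ∀ n, Integrable (f n) ν := fun n => by
    refine (hν.integrable_min_sq.const_mul (1 + ((n : ℝ) + 3) ^ 2)).mono'
      (hfm n).aestronglyMeasurable (ae_of_all _ fun y => ?_)
    rw [Real.norm_of_nonneg (hfnn n y)]
    rcases le_or_gt (-(1 / ((n : ℝ) + 3))) y with hy2 | hy2
    · simp only [f, hsupp n y hy2, mul_zero]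
      positivity
    · have hy0 : y ≤ 0 := by linarith [hpos n]
      have h1 : f n y ≤ 1 :=
        mul_le_one₀ (by linarith [Real.exp_pos y]) (b n).nonneg (b n).le_one
      refine h1.trans ?_
      rw [mul_min_of_nonneg _ _ (by positivity)]
      refine le_min (by nlinarith [sq_nonneg ((n : ℝ) + 3)]) ?_
      have h3 : 1 ≤ ((n : ℝ) + 3) * |y| := by
        rw [abs_of_nonpos hy0]
        have := mul_lt_mul_of_pos_left hy2 (show (0 : ℝ) < (n : ℝ) + 3 by positivity)
        have h4 : ((n : ℝ) + 3) * -(1 / ((n : ℝ) + 3)) = -1 := by field_simp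
        linarith
      nlinarith [sq_nonneg |y|]
  have hlim : ∀ x ∈ Iio (0 : ℝ), ENNReal.ofReal (1 - Real.exp x)
      = liminf (fun n => ENNReal.ofReal (f n x)) atTop := by
    intro x hx
    have hx0 : x < 0 := hx
    refine (Tendsto.liminf_eq (tendsto_const_nhds.congr' ?_)).symm
    obtain ⟨N, hN⟩ := exists_nat_one_div_lt (neg_pos.2 hx0)
    obtain ⟨N', hN'⟩ := exists_nat_ge (-x)
    filter_upwards [eventually_ge_atTop (max N N')] with n hn
    have hnN : (N : ℝ) ≤ n := by exact_mod_cast (le_max_left _ _).trans hn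
    have hnN' : (N' : ℝ) ≤ n := by exact_mod_cast (le_max_right _ _).trans hn
    have h1 : 1 / ((n : ℝ) + 2) ≤ 1 / ((N : ℝ) + 1) :=
      one_div_le_one_div_of_le (by positivity) (by linarith)
    have h2 : 1 / ((n : ℝ) + 2) ≤ 1 := by
      rw [div_le_one (by positivity)]
      linarith [(Nat.cast_nonneg n : (0 : ℝ) ≤ n)]
    have : b n x = 1 := by
      refine (b n).one_of_mem_closedBall ?_
      rw [Metric.mem_closedBall, Real.dist_eq, abs_le]
      change -((n : ℝ) + 1 - 1 / (n + 2)) ≤ _ ∧ _ ≤ (n : ℝ) + 1 - 1 / (n + 2)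
      constructor <;> linarith
    simp [f, this]
  rw [setLIntegral_congr_fun measurableSet_Iio hlim]
  refine (lintegral_liminf_le fun n => (hfm n).ennreal_ofReal).trans ?_
  refine liminf_le_of_le (by isBoundedDefault) fun c hc => ?_
  obtain ⟨n, hn⟩ := hc.exists
  refine hn.trans ((setLIntegral_le_lintegral _ _).trans ?_)
  rw [← ofReal_integral_eq_lintegral_ofReal (hint n) (ae_of_all _ (hfnn n))]
  exact ENNReal.ofReal_le_one.2 (hle n)

theorem subcriticalNegative (h : SmallTimeBounded a σ ν τ π) (hν : IsLevyMeasure ν) :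
    SubcriticalNegative σ ν := by
  have h1 := h.lintegral_one_sub_exp_le hν
  have hres : ν.restrict (Iic 0) = ν.restrict (Iio 0) := by
    refine Measure.restrict_congr_set ?_
    have : ∀ᵐ x ∂ν, x ≠ 0 := by
      rw [ae_iff]
      simpa using hν.zero_notAtom
    filter_upwards [this] with x hx
    exact propext ⟨fun h => lt_of_le_of_ne h hx, fun h => le_of_lt h⟩
  refine ⟨h.sigma_eq_zero hν, h.measure_Ioi hν, ?_, ?_⟩
  · rw [hres]
    calc ∫⁻ x in Iio 0, ENNReal.ofReal (min 1 |x|) ∂ν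
        ≤ ∫⁻ x in Iio 0, ENNReal.ofReal 2 * ENNReal.ofReal (1 - Real.exp x) ∂ν := by
          refine setLIntegral_mono (by fun_prop) fun x hx => ?_
          rw [← ENNReal.ofReal_mul zero_le_two]
          exact ENNReal.ofReal_le_ofReal (min_one_abs_le (le_of_lt hx))
      _ = ENNReal.ofReal 2 * ∫⁻ x in Iio 0, ENNReal.ofReal (1 - Real.exp x) ∂ν :=
          lintegral_const_mul _ (by fun_prop)
      _ < ⊤ := ENNReal.mul_lt_top ENNReal.ofReal_lt_top (h1.trans_lt ENNReal.one_lt_top)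
  · rw [gam, hres, integral_eq_lintegral_of_nonneg_ae]
    · exact ENNReal.toReal_le_of_le_ofReal zero_le_one (by simpa using h1)
    · rw [EventuallyLE, ae_restrict_iff' measurableSet_Iio]
      exact ae_of_all _ fun x hx => by
        have : Real.exp x ≤ 1 := Real.exp_le_one_iff.2 (le_of_lt hx)
        simpa using this
    · fun_prop

end SmallTimeBounded

end

section

/-! ### Finiteness of all moments forces small bounded laws -/

/-- Fatou's lemma for an almost surely convergent sequence with controlled integrals. -/
lemma lintegral_le_of_tendsto_ae {α : Type*} [MeasurableSpace α] {m : Measure α}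
    {f : ℕ → α → ℝ≥0∞} {g : α → ℝ≥0∞} (hf : ∀ n, AEMeasurable (f n) m)
    (h : ∀ᵐ x ∂m, Tendsto (fun n => f n x) atTop (𝓝 (g x))) {c : ℕ → ℝ≥0∞}
    (hc : ∀ n, ∫⁻ x, f n x ∂m ≤ c n) {C : ℝ≥0∞} (hC : Tendsto c atTop (𝓝 C)) :
    ∫⁻ x, g x ∂m ≤ C := by
  calc ∫⁻ x, g x ∂m = ∫⁻ x, liminf (fun n => f n x) atTop ∂m :=
        lintegral_congr_ae (h.mono fun x hx => hx.liminf_eq.symm)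
    _ ≤ liminf (fun n => ∫⁻ x, f n x ∂m) atTop := lintegral_liminf_le' hf
    _ ≤ liminf c atTop := liminf_le_liminf (Eventually.of_forall hc)
    _ = C := hC.liminf_eq

variable {Ω : Type*} [MeasurableSpace Ω] {P : Measure Ω} {ψ : ℝ → ℂ} {Λ : Set ℍ → Ω → ℝ}

namespace IsIndepScattered

section pairs

variable {S : Type*} [MeasurableSpace S] {m : Measure S} {Λ : Set S → Ω → ℝ}

lemma indepFun_pair (h : IsIndepScattered P ψ m Λ) {A B : Set S} (hA : MeasurableSet A)
    (hB : MeasurableSet B) (hAm : m A < ⊤) (hBm : m B < ⊤) (hd : Disjoint A B) :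
    IndepFun (Λ A) (Λ B) P := by
  have := h.iIndepFun_of_finite (A := fun b : Bool => cond b A B)
    (by rintro (_ | _) <;> assumption) (by rintro (_ | _) <;> assumption) (by
      rintro (_ | _) (_ | _) hij
      · exact absurd rfl hij
      · exact hd.symm
      · exact hd
      · exact absurd rfl hij)
  exact this.indepFun (i := true) (j := false) (by simp)

end pairs

lemma lintegral_exp_strip [IsProbabilityMeasure P] (h : IsIndepScattered P ψ volume Λ) {τ : ℝ}
    (hτ : 0 ≤ τ) (n : ℕ) :
    ∫⁻ ω, ENNReal.ofReal (Real.exp (Λ (strip 0 (n * τ)) ω)) ∂P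
      = (∫⁻ ω, ENNReal.ofReal (Real.exp (Λ (strip 0 τ) ω)) ∂P) ^ n := by
  have hfin : ∀ c d, volume (strip c d) < ⊤ := fun c d => by
    rw [volume_strip]; exact ENNReal.ofReal_lt_top
  have hmeas : ∀ c d, Measurable (Λ (strip c d)) := fun c d =>
    h.measurable _ (measurableSet_strip c d) (hfin c d)
  have hexp : Measurable fun x : ℝ => ENNReal.ofReal (Real.exp x) := by fun_prop
  induction n with
  | zero =>
    have h0 : strip 0 0 = ∅ := by
      ext z; simp only [strip, mem_ofPred_eq, mem_empty_iff_false, iff_false]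
      rintro ⟨_, h1, h2⟩; linarith
    simp only [Nat.cast_zero, zero_mul, h0, pow_zero]
    rw [lintegral_congr_ae (g := fun _ => 1)]
    · simp
    · filter_upwards [h.empty_ae] with ω hω
      simp [hω]
  | succ n ih =>
    have hu : strip 0 ((n + 1 : ℕ) * τ) = strip 0 (n * τ) ∪ strip (n * τ) ((n + 1 : ℕ) * τ) := by
      rw [strip_union (by positivity)]
      push_cast; nlinarith
    have hd : Disjoint (strip 0 (n * τ)) (strip (n * τ) ((n + 1 : ℕ) * τ)) := strip_disjoint le_rfl
    rw [pow_succ, ← ih, hu]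
    have hind := h.indepFun_pair (measurableSet_strip _ _) (measurableSet_strip _ _) (hfin _ _)
      (hfin _ _) hd
    have h2 := lintegral_mul_eq_lintegral_mul_lintegral_of_indepFun
      (hexp.comp (hmeas 0 (n * τ))) (hexp.comp (hmeas (n * τ) ((n + 1 : ℕ) * τ)))
      (hind.comp hexp hexp)
    have hlaw : ∫⁻ ω, ENNReal.ofReal (Real.exp (Λ (strip (n * τ) ((n + 1 : ℕ) * τ)) ω)) ∂P
        = ∫⁻ ω, ENNReal.ofReal (Real.exp (Λ (strip 0 τ) ω)) ∂P := by
      rw [← lintegral_map hexp (hmeas _ _), ← lintegral_map hexp (hmeas _ _),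
        h.map_eq (measurableSet_strip _ _) (measurableSet_strip _ _) (hfin _ _)]
      rw [volume_strip, volume_strip]
      congr 1; push_cast; ring
    rw [← hlaw]
    refine Eq.trans ?_ h2
    refine lintegral_congr_ae ?_
    filter_upwards [h.union_ae (measurableSet_strip _ _) (measurableSet_strip _ _) (hfin _ _)
      (hfin _ _) hd] with ω hω
    simp only [Pi.mul_apply, Function.comp_apply]
    rw [hω, Real.exp_add, ENNReal.ofReal_mul (Real.exp_pos _).le]

/-- The value of `Λ` on a strip of width `(n + 1)τ` is the sum of `n + 1` independent copies of its
value on a strip of width `τ`, and it exceeds `(n + 1)τ` if all of them exceed `τ`. -/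
lemma pow_measure_strip_le [IsProbabilityMeasure P] (h : IsIndepScattered P ψ volume Λ) {τ : ℝ}
    (hτ : 0 ≤ τ) (n : ℕ) :
    (P {ω | τ < Λ (strip 0 τ) ω}) ^ (n + 1)
      ≤ P {ω | (n + 1 : ℕ) * τ < Λ (strip 0 ((n + 1 : ℕ) * τ)) ω} := by
  have hfin : ∀ c d, volume (strip c d) < ⊤ := fun c d => by
    rw [volume_strip]; exact ENNReal.ofReal_lt_top
  have hmeas : ∀ c d, Measurable (Λ (strip c d)) := fun c d =>
    h.measurable _ (measurableSet_strip c d) (hfin c d)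
  induction n with
  | zero => simp
  | succ n ih =>
    have hu : strip 0 ((n + 1 + 1 : ℕ) * τ)
        = strip 0 ((n + 1 : ℕ) * τ) ∪ strip ((n + 1 : ℕ) * τ) ((n + 1 + 1 : ℕ) * τ) := by
      rw [strip_union (by positivity)]
      push_cast; nlinarith
    have hd : Disjoint (strip 0 ((n + 1 : ℕ) * τ))
        (strip ((n + 1 : ℕ) * τ) ((n + 1 + 1 : ℕ) * τ)) := strip_disjoint le_rfl
    have hind := h.indepFun_pair (measurableSet_strip _ _) (measurableSet_strip _ _) (hfin _ _)
      (hfin _ _) hd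
    have hlaw : P {ω | τ < Λ (strip ((n + 1 : ℕ) * τ) ((n + 1 + 1 : ℕ) * τ)) ω}
        = P {ω | τ < Λ (strip 0 τ) ω} := by
      have := congrArg (fun π => π (Ioi τ)) (h.map_eq (measurableSet_strip ((n + 1 : ℕ) * τ)
        ((n + 1 + 1 : ℕ) * τ)) (measurableSet_strip 0 τ) (hfin _ _) (by
          rw [volume_strip, volume_strip]; congr 1; push_cast; ring))
      rw [Measure.map_apply (hmeas _ _) measurableSet_Ioi,
        Measure.map_apply (hmeas _ _) measurableSet_Ioi] at this
      exact this
    rw [pow_succ]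
    refine (mul_le_mul_left ih _).trans ?_
    rw [← hlaw]
    have h2 := hind.measure_inter_preimage_eq_mul (Ioi ((n + 1 : ℕ) * τ)) (Ioi τ)
      measurableSet_Ioi measurableSet_Ioi
    refine (ge_of_eq h2).trans ?_
    refine measure_mono_ae ?_
    filter_upwards [h.union_ae (measurableSet_strip _ _) (measurableSet_strip _ _) (hfin _ _)
      (hfin _ _) hd] with ω hω hm
    change ((n + 1 + 1 : ℕ) : ℝ) * τ < Λ _ ω
    rw [hu, hω]
    have h3 : ((n + 1 : ℕ) : ℝ) * τ < Λ (strip 0 ((n + 1 : ℕ) * τ)) ω := hm.1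
    have h4 : τ < Λ (strip ((n + 1 : ℕ) * τ) ((n + 1 + 1 : ℕ) * τ)) ω := hm.2
    push_cast at h3 h4 ⊢
    linarith

end IsIndepScattered

namespace IsCascadeLimit

variable {X : ℝ → ℝ → Ω → ℝ} {M : ℝ → Ω → FiniteMeasure ℝ} {μ : Ω → FiniteMeasure ℝ}

lemma lintegral_riemannSum_dens [IsProbabilityMeasure P] (hΛ : IsIndepScattered P ψ volume Λ)
    {ε : ℝ} (hε : 0 < ε) (hε1 : ε ≤ 1) (n : ℕ) :
    ∫⁻ ω, riemannSum n (fun t => dens Λ ε t ω) ∂P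
      = ∫⁻ ω, ENNReal.ofReal (Real.exp (Λ (strip 0 (1 + Real.log (1 / ε))) ω)) ∂P := by
  have hmem : ∀ k ∈ Finset.range (n + 1), ((k + 1 : ℝ) / (n + 1)) ∈ Icc (0 : ℝ) 1 := by
    intro k hk
    refine ⟨by positivity, ?_⟩
    rw [div_le_one (by positivity)]
    exact_mod_cast Finset.mem_range.1 hk
  have hexp : Measurable fun x : ℝ => ENNReal.ofReal (Real.exp x) := by fun_prop
  simp only [riemannSum]
  rw [lintegral_finsetSum' _ fun k hk =>
    ((measurable_dens hΛ hε (hmem k hk)).const_mul _).aemeasurable]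
  have key : ∀ k ∈ Finset.range (n + 1),
      ∫⁻ ω, ENNReal.ofReal (1 / (n + 1)) * dens Λ ε ((k + 1) / (n + 1)) ω ∂P
        = ENNReal.ofReal (1 / (n + 1)) *
          ∫⁻ ω, ENNReal.ofReal (Real.exp (Λ (strip 0 (1 + Real.log (1 / ε))) ω)) ∂P := by
    intro k hk
    rw [lintegral_const_mul _ (measurable_dens hΛ hε (hmem k hk))]
    congr 1
    have hm1 := hΛ.measurable _ (measurableSet_truncCone zero_le_one ε _)
      (volume_truncCone_lt_top hε (hmem k hk))
    have hfs : volume (strip 0 (1 + Real.log (1 / ε))) < ⊤ := by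
      rw [volume_strip]; exact ENNReal.ofReal_lt_top
    have hm2 := hΛ.measurable _ (measurableSet_strip 0 (1 + Real.log (1 / ε))) hfs
    unfold dens
    rw [← lintegral_map hexp hm1, ← lintegral_map hexp hm2,
      hΛ.map_eq (measurableSet_truncCone zero_le_one ε _) (measurableSet_strip _ _)
        (volume_truncCone_lt_top hε (hmem k hk))]
    rw [volume_truncCone hε hε1 (hmem k hk), volume_strip, sub_zero]
  rw [Finset.sum_congr rfl key, Finset.sum_const, Finset.card_range, nsmul_eq_mul, ← mul_assoc]
  have : ((n + 1 : ℕ) : ℝ≥0∞) * ENNReal.ofReal (1 / (n + 1)) = 1 := by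
    rw [← ENNReal.ofReal_natCast, ← ENNReal.ofReal_mul (by positivity)]
    rw [← ENNReal.ofReal_one]
    congr 1
    push_cast
    field_simp
  rw [this, one_mul]

/-- The expected mass of the truncated cascade is at most that of its Riemann sums, whose terms all
have the law of `e^{Λ(B)}` for a strip `B` of the same intensity as the cones. -/
lemma lintegral_mass_trunc_le [IsProbabilityMeasure P] (hμ : IsCascadeLimit P Λ 0 1 X M μ)
    (hΛ : IsIndepScattered P ψ volume Λ) {ε : ℝ} (hε : 0 < ε) (hε1 : ε ≤ 1) :
    ∫⁻ ω, ((M ε ω).mass : ℝ≥0∞) ∂P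
      ≤ ∫⁻ ω, ENNReal.ofReal (Real.exp (Λ (strip 0 (1 + Real.log (1 / ε))) ω)) ∂P :=
  lintegral_le_of_tendsto_ae (fun n => (measurable_riemannSum_dens hΛ hε n).aemeasurable)
    (hμ.tendsto_riemannSum hε) (fun n => (lintegral_riemannSum_dens hΛ hε hε1 n).le)
    tendsto_const_nhds

/-- If `E e^{Λ(B)} < 1` for some strip, the expected mass of the truncated cascades tends to zero
along a sequence, and the limit vanishes almost surely by Fatou's lemma. -/
lemma one_le_lintegral_exp_strip [IsProbabilityMeasure P] (hμ : IsCascadeLimit P Λ 0 1 X M μ)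
    (hΛ : IsIndepScattered P ψ volume Λ) {q : ℝ} (hq : 0 < q) (hpos : 0 < massMoment P μ q)
    {τ : ℝ} (hτ : 0 < τ) :
    1 ≤ ∫⁻ ω, ENNReal.ofReal (Real.exp (Λ (strip 0 τ) ω)) ∂P := by
  by_contra! hlt
  set g := ∫⁻ ω, ENNReal.ofReal (Real.exp (Λ (strip 0 τ) ω)) ∂P with hg
  obtain ⟨k, hk⟩ := exists_nat_ge (1 / τ)
  have hk' : 1 ≤ k * τ := by rwa [div_le_iff₀ hτ] at hk
  -- at `ε = 1 / u m` the cones have intensity `(m + k) τ`; as `k τ ≥ 1`, this `ε` is at most `1`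
  let u : ℕ → ℝ := fun m => Real.exp ((m + k : ℕ) * τ - 1)
  have hu : Tendsto u atTop atTop := by
    refine Real.tendsto_exp_atTop.comp (tendsto_atTop_add_const_right _ _ ?_)
    exact (tendsto_natCast_atTop_atTop.comp (tendsto_add_atTop_nat k)).atTop_mul_const hτ
  have hle : ∀ m, ∫⁻ ω, ((M (1 / u m) ω).mass : ℝ≥0∞) ∂P ≤ g ^ (m + k) := by
    intro m
    have hu1 : 1 ≤ u m := by
      refine Real.one_le_exp ?_
      push_cast
      have : (0 : ℝ) ≤ m * τ := by positivity
      linarith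
    have h1 := hμ.lintegral_mass_trunc_le hΛ (ε := 1 / u m) (by positivity)
      (by rw [div_le_one (by positivity)]; exact hu1)
    have h2 : 1 + Real.log (1 / (1 / u m)) = (m + k : ℕ) * τ := by
      rw [one_div_one_div, Real.log_exp]; ring
    rw [h2, hΛ.lintegral_exp_strip hτ.le] at h1
    exact h1
  have h0 : ∫⁻ ω, ((μ ω).mass : ℝ≥0∞) ∂P ≤ 0 :=
    lintegral_le_of_tendsto_ae
      (fun m => hμ.aemeasurable_mass_trunc hΛ (by simp only [u]; positivity))
      (hμ.tendsto_mass hu) hle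
      ((ENNReal.tendsto_pow_atTop_nhds_zero_of_lt_one hlt).comp (tendsto_add_atTop_nat k))
  rw [nonpos_iff_eq_zero, lintegral_eq_zero_iff' (hμ.aemeasurable_mass hΛ)] at h0
  refine hpos.ne' ?_
  unfold massMoment
  rw [lintegral_congr_ae (g := fun _ => 0)]
  · simp
  · filter_upwards [h0] with ω hω
    simp only [Pi.zero_apply] at hω
    rw [hω, ENNReal.zero_rpow_of_pos hq]

end IsCascadeLimit

end

section

/-! ### Self-similarity of the total mass -/

variable {Ω : Type*} [MeasurableSpace Ω] {P : Measure Ω} {ψ : ℝ → ℂ} {Λ : Set ℍ → Ω → ℝ}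

lemma preimage_atom {S T ι : Type*} (f : S → T) (B : ι → Set T) (s : Finset ι) :
    f ⁻¹' atom B s = atom (fun i => f ⁻¹' B i) s := rfl

/-- The grid sum of the cascade over `[0, 1/2]` built with the cones of `[0, 1/2]`. -/
def halfSum (Λ : Set ℍ → Ω → ℝ) (ε : ℝ) (n : ℕ) (ω : Ω) : ℝ≥0∞ :=
  riemannSum n (fun t => ENNReal.ofReal (Real.exp (Λ (truncCone (Icc 0 (1 / 2)) ε (t / 2)) ω)))

/-- `riemannSum` as a function of the vector of logarithmic densities on the grid. -/
def vecSum (n : ℕ) (x : Fin (n + 1) → ℝ) : ℝ≥0∞ :=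
  ∑ i : Fin (n + 1), ENNReal.ofReal (1 / (n + 1)) * ENNReal.ofReal (Real.exp (x i))

lemma measurable_vecSum (n : ℕ) : Measurable (vecSum n) := by
  unfold vecSum; fun_prop

lemma riemannSum_exp_eq_vecSum (n : ℕ) (f : ℝ → ℝ) :
    riemannSum n (fun t => ENNReal.ofReal (Real.exp (f t)))
      = vecSum n (fun i => f ((((i : ℕ) : ℝ) + 1) / (n + 1))) := by
  unfold vecSum riemannSum
  rw [Finset.sum_range]

lemma grid_mem {n : ℕ} (i : Fin (n + 1)) : ((((i : ℕ) : ℝ) + 1) / (n + 1)) ∈ Icc (0 : ℝ) 1 := by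
  refine ⟨by positivity, ?_⟩
  rw [div_le_one (by positivity)]
  exact_mod_cast i.2

section

variable {ε : ℝ} (hε : 0 < ε)
include hε

lemma volume_truncCone_half_lt_top {t : ℝ} (ht : t ∈ Icc (0 : ℝ) 1) :
    volume (truncCone (Icc 0 (1 / 2)) ε (t / 2)) < ⊤ := by
  rw [← preimage_dilate_truncCone, measurePreserving_dilate.measure_preimage
    (measurableSet_truncCone zero_le_one _ _).nullMeasurableSet]
  exact volume_truncCone_lt_top (by positivity) (by convert ht using 1; ring)

/-- Scale invariance: dilation by two maps the cones of `[0, 1/2]` at level `ε` to the cones of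
`[0, 1]` at level `2ε`, and preserves the intensity. -/
lemma map_half_vector [IsProbabilityMeasure P] (hΛ : IsIndepScattered P ψ volume Λ) (n : ℕ) :
    P.map (fun ω (i : Fin (n + 1)) =>
        Λ (truncCone (Icc 0 (1 / 2)) ε ((((i : ℕ) : ℝ) + 1) / (n + 1) / 2)) ω)
      = P.map (fun ω (i : Fin (n + 1)) =>
        Λ (truncCone (Icc 0 1) (2 * ε) ((((i : ℕ) : ℝ) + 1) / (n + 1))) ω) := by
  refine hΛ.map_pi_eq (fun i => measurableSet_truncCone (by norm_num) _ _)
    (fun i => measurableSet_truncCone zero_le_one _ _)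
    (fun i => volume_truncCone_half_lt_top hε (grid_mem i))
    (fun i => volume_truncCone_lt_top (by positivity) (grid_mem i)) fun s => ?_
  rw [← measurePreserving_dilate.measure_preimage
    (measurableSet_atom (fun i => measurableSet_truncCone zero_le_one _ _) s).nullMeasurableSet,
    preimage_atom]
  congr 2
  ext1 i
  rw [← preimage_dilate_truncCone]
  congr 2
  ring

lemma indepFun_half_vector (hΛ : IsIndepScattered P ψ volume Λ) (n : ℕ) :
    IndepFun (Λ halfCore) (fun ω (i : Fin (n + 1)) =>
        Λ (truncCone (Icc 0 (1 / 2)) ε ((((i : ℕ) : ℝ) + 1) / (n + 1) / 2)) ω) P :=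
  hΛ.indepFun_pi (fun i => measurableSet_truncCone (by norm_num) _ _)
    (fun i => volume_truncCone_half_lt_top hε (grid_mem i)) measurableSet_halfCore
    (by rw [volume_halfCore]; exact ENNReal.ofReal_lt_top) (fun i => halfCore_disjoint _ _)

lemma measurable_half_vector (hΛ : IsIndepScattered P ψ volume Λ) (n : ℕ) :
    Measurable (fun ω (i : Fin (n + 1)) =>
        Λ (truncCone (Icc 0 (1 / 2)) ε ((((i : ℕ) : ℝ) + 1) / (n + 1) / 2)) ω) :=
  measurable_pi_lambda _ fun i => hΛ.measurable _ (measurableSet_truncCone (by norm_num) _ _)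
    (volume_truncCone_half_lt_top hε (grid_mem i))

/-- The grid points of `[0, 1]` with step `1 / (2n + 2)` contain half the grid points with step
`1 / (n + 1)`; dropping the right half of the interval leaves the grid sum over `[0, 1/2]`. -/
lemma half_le_riemannSum (hε2 : ε ≤ 1 / 2) (hΛ : IsIndepScattered P ψ volume Λ) (n : ℕ) :
    ∀ᵐ ω ∂P, ENNReal.ofReal (Real.exp (Λ halfCore ω) / 2) * halfSum Λ ε n ω
      ≤ riemannSum (2 * n + 1) (fun t => dens Λ ε t ω) := by
  have hcore : volume halfCore < ⊤ := by rw [volume_halfCore]; exact ENNReal.ofReal_lt_top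
  have hall : ∀ᵐ ω ∂P, ∀ i : Fin (n + 1),
      Λ (truncCone (Icc 0 1) ε ((((i : ℕ) : ℝ) + 1) / (n + 1) / 2)) ω = Λ halfCore ω
        + Λ (truncCone (Icc 0 (1 / 2)) ε ((((i : ℕ) : ℝ) + 1) / (n + 1) / 2)) ω := by
    refine ae_all_iff.2 fun i => ?_
    have hmem := grid_mem i
    rw [truncCone_eq_union hε2 ⟨by linarith [hmem.1], by linarith [hmem.2]⟩]
    exact hΛ.union_ae measurableSet_halfCore (measurableSet_truncCone (by norm_num) _ _) hcore
      (volume_truncCone_half_lt_top hε hmem) (halfCore_disjoint _ _)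
  filter_upwards [hall] with ω hω
  unfold halfSum riemannSum
  rw [Finset.mul_sum]
  have hsub : Finset.range (n + 1) ⊆ Finset.range (2 * n + 1 + 1) :=
    Finset.range_subset_range.2 (by omega)
  refine le_trans (le_of_eq ?_) (Finset.sum_le_sum_of_subset hsub)
  refine Finset.sum_congr rfl fun k hk => ?_
  have h1 := hω ⟨k, Finset.mem_range.1 hk⟩
  simp only at h1
  have h2 : ((k : ℝ) + 1) / ((2 * n + 1 : ℕ) + 1) = (k + 1) / (n + 1) / 2 := by
    push_cast; field_simp; ring
  beta_reduce
  rw [h2]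
  unfold dens
  rw [h1, Real.exp_add, ← ENNReal.ofReal_mul (by positivity),
    ← ENNReal.ofReal_mul (by positivity), ← ENNReal.ofReal_mul (by positivity)]
  congr 1
  push_cast
  field_simp
  ring

/-- The self-similarity inequality for the truncated cascades, tested with a monotone function. -/
lemma lintegral_prod_le_lintegral_riemannSum [IsProbabilityMeasure P] (hε2 : ε ≤ 1 / 2)
    (hΛ : IsIndepScattered P ψ volume Λ) {F : ℝ≥0∞ → ℝ≥0∞} (hF : Monotone F) (n : ℕ) :
    ∫⁻ p, F (ENNReal.ofReal (Real.exp p.1 / 2) * riemannSum n (fun t => dens Λ (2 * ε) t p.2))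
        ∂((P.map (Λ halfCore)).prod P)
      ≤ ∫⁻ ω, F (riemannSum (2 * n + 1) (fun t => dens Λ ε t ω)) ∂P := by
  have hcore : volume halfCore < ⊤ := by rw [volume_halfCore]; exact ENNReal.ofReal_lt_top
  have hmc := hΛ.measurable _ measurableSet_halfCore hcore
  have := Measure.isProbabilityMeasure_map (μ := P) hmc.aemeasurable
  have hFm : Measurable F := hF.measurable
  have hv := measurable_half_vector hε hΛ n
  have hv' : Measurable (fun ω (i : Fin (n + 1)) =>
      Λ (truncCone (Icc 0 1) (2 * ε) ((((i : ℕ) : ℝ) + 1) / (n + 1))) ω) :=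
    measurable_pi_lambda _ fun i => hΛ.measurable _ (measurableSet_truncCone zero_le_one _ _)
      (volume_truncCone_lt_top (by positivity) (grid_mem i))
  have hG : Measurable (fun p : ℝ × (Fin (n + 1) → ℝ) =>
      F (ENNReal.ofReal (Real.exp p.1 / 2) * vecSum n p.2)) := by
    have h1 := (measurable_vecSum n).comp
      (measurable_snd : Measurable (Prod.snd : ℝ × (Fin (n + 1) → ℝ) → _))
    have h2 : Measurable fun p : ℝ × (Fin (n + 1) → ℝ) => ENNReal.ofReal (Real.exp p.1 / 2) := by
      fun_prop
    exact hFm.comp (h2.mul h1)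
  calc _ = ∫⁻ y, ∫⁻ x, F (ENNReal.ofReal (Real.exp y / 2) * vecSum n x)
          ∂(P.map (fun ω (i : Fin (n + 1)) =>
            Λ (truncCone (Icc 0 1) (2 * ε) ((((i : ℕ) : ℝ) + 1) / (n + 1))) ω))
          ∂(P.map (Λ halfCore)) := by
        have hS : Measurable (fun p : ℝ × Ω => F (ENNReal.ofReal (Real.exp p.1 / 2)
            * riemannSum n (fun t => dens Λ (2 * ε) t p.2))) := by
          have h1 := (measurable_riemannSum_dens hΛ (ε := 2 * ε) (by positivity) n).comp
            (measurable_snd : Measurable (Prod.snd : ℝ × Ω → _))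
          have h2 : Measurable fun p : ℝ × Ω => ENNReal.ofReal (Real.exp p.1 / 2) := by
            fun_prop
          exact hFm.comp (h2.mul h1)
        rw [lintegral_prod _ hS.aemeasurable]
        refine lintegral_congr fun y => ?_
        refine Eq.trans ?_ (lintegral_map (f := fun x => F (ENNReal.ofReal (Real.exp y / 2)
          * vecSum n x)) (hG.comp measurable_prodMk_left) hv').symm
        refine lintegral_congr fun ω => ?_
        unfold dens
        rw [riemannSum_exp_eq_vecSum]
    _ = ∫⁻ ω, F (ENNReal.ofReal (Real.exp (Λ halfCore ω) / 2) * halfSum Λ ε n ω) ∂P := by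
        rw [← map_half_vector hε hΛ n, ← lintegral_prod _ hG.aemeasurable]
        have := Measure.isProbabilityMeasure_map (μ := P) hv.aemeasurable
        rw [← (indepFun_iff_map_prod_eq_prod_map_map hmc.aemeasurable hv.aemeasurable).1
          (indepFun_half_vector hε hΛ n), lintegral_map hG (hmc.prodMk hv)]
        refine lintegral_congr fun ω => ?_
        rw [halfSum, riemannSum_exp_eq_vecSum n
          (fun t => Λ (truncCone (Icc 0 (1 / 2)) ε (t / 2)) ω)]
    _ ≤ _ := by
        refine lintegral_mono_ae ?_
        filter_upwards [half_le_riemannSum hε hε2 hΛ n] with ω hω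
        exact hF hω

end

namespace IsCascadeLimit

variable {X : ℝ → ℝ → Ω → ℝ} {M : ℝ → Ω → FiniteMeasure ℝ} {μ : Ω → FiniteMeasure ℝ}

/-- The self-similarity inequality for bounded continuous monotone functions of the total mass of
the limit. -/
lemma lintegral_prod_le [IsProbabilityMeasure P] (hμ : IsCascadeLimit P Λ 0 1 X M μ)
    (hΛ : IsIndepScattered P ψ volume Λ) {F : ℝ≥0∞ → ℝ≥0∞} (hF : Monotone F)
    (hFc : Continuous F) {K : ℝ≥0∞} (hK : K ≠ ⊤) (hFK : ∀ x, F x ≤ K) :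
    ∫⁻ p, F (ENNReal.ofReal (Real.exp p.1 / 2) * (μ p.2).mass) ∂((P.map (Λ halfCore)).prod P)
      ≤ ∫⁻ ω, F (μ ω).mass ∂P := by
  have hcore : volume halfCore < ⊤ := by rw [volume_halfCore]; exact ENNReal.ofReal_lt_top
  have hmc := hΛ.measurable _ measurableSet_halfCore hcore
  have := Measure.isProbabilityMeasure_map (μ := P) hmc.aemeasurable
  set ρ := P.map (Λ halfCore)
  have hFm : Measurable F := hF.measurable
  have hexp : Measurable fun p : ℝ × Ω => ENNReal.ofReal (Real.exp p.1 / 2) := by fun_prop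
  have hae : ∀ {f : Ω → ℝ≥0∞}, AEMeasurable f P → AEMeasurable
      (fun p : ℝ × Ω => F (ENNReal.ofReal (Real.exp p.1 / 2) * f p.2)) (ρ.prod P) := by
    intro f hf
    exact hFm.comp_aemeasurable (hexp.aemeasurable.mul
      (hf.comp_quasiMeasurePreserving Measure.quasiMeasurePreserving_snd))
  have hsnd : ∀ {p : Ω → Prop}, (∀ᵐ ω ∂P, p ω) → ∀ᵐ x ∂(ρ.prod P), p x.2 := fun h =>
    Measure.quasiMeasurePreserving_snd.ae h
  have hdom : ∀ {f : ℕ → Ω → ℝ≥0∞} {g : Ω → ℝ≥0∞}, (∀ n, AEMeasurable (f n) P) →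
      (∀ᵐ ω ∂P, Tendsto (fun n => f n ω) atTop (𝓝 (g ω))) →
      Tendsto (fun n => ∫⁻ ω, F (f n ω) ∂P) atTop (𝓝 (∫⁻ ω, F (g ω) ∂P)) := by
    intro f g hf hfg
    refine tendsto_lintegral_of_dominated_convergence' (fun _ => K)
      (fun n => hFm.comp_aemeasurable (hf n)) (fun n => ae_of_all _ fun ω => hFK _) (by simp [hK])
      (hfg.mono fun ω hω => (hFc.tendsto _).comp hω)
  have hlim : ∀ {f : ℕ → Ω → ℝ≥0∞} {g : Ω → ℝ≥0∞},
      (∀ᵐ ω ∂P, Tendsto (fun n => f n ω) atTop (𝓝 (g ω))) →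
      ∀ᵐ p ∂(ρ.prod P), Tendsto (fun n => F (ENNReal.ofReal (Real.exp p.1 / 2) * f n p.2)) atTop
        (𝓝 (F (ENNReal.ofReal (Real.exp p.1 / 2) * g p.2))) := by
    intro f g hfg
    filter_upwards [hsnd hfg] with p hp
    exact (hFc.tendsto _).comp (ENNReal.Tendsto.const_mul hp (Or.inr ENNReal.ofReal_ne_top))
  have hstep : ∀ ε > 0, ε ≤ 1 / 2 →
      ∫⁻ p, F (ENNReal.ofReal (Real.exp p.1 / 2) * (M (2 * ε) p.2).mass) ∂(ρ.prod P)
        ≤ ∫⁻ ω, F (M ε ω).mass ∂P := by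
    intro ε hε hε2
    have hε' : 0 < 2 * ε := by positivity
    have h1 := hlim (f := fun n ω => riemannSum n (fun t => dens Λ (2 * ε) t ω))
      (g := fun ω => ((M (2 * ε) ω).mass : ℝ≥0∞)) (hμ.tendsto_riemannSum hε')
    refine lintegral_le_of_tendsto_ae
      (fun n => hae (measurable_riemannSum_dens hΛ hε' n).aemeasurable) h1
      (fun n => lintegral_prod_le_lintegral_riemannSum hε hε2 hΛ hF n) ?_
    have h2 : Tendsto (fun n : ℕ => 2 * n + 1) atTop atTop :=
      tendsto_atTop_mono (fun n => show n ≤ 2 * n + 1 by omega) tendsto_id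
    have h3 : Tendsto (fun n => ∫⁻ ω, F (riemannSum n (fun t => dens Λ ε t ω)) ∂P) atTop
        (𝓝 (∫⁻ ω, F (M ε ω).mass ∂P)) :=
      hdom (fun n => (measurable_riemannSum_dens hΛ hε n).aemeasurable) (hμ.tendsto_riemannSum hε)
    exact h3.comp h2
  have hu1 : Tendsto (fun n : ℕ => (n : ℝ) + 1) atTop atTop :=
    tendsto_atTop_add_const_right _ _ tendsto_natCast_atTop_atTop
  have hu2 : Tendsto (fun n : ℕ => 2 * ((n : ℝ) + 1)) atTop atTop :=
    hu1.const_mul_atTop two_pos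
  have hpos : ∀ n : ℕ, (0 : ℝ) < 1 / ((n : ℝ) + 1) := fun n => by positivity
  have hpos2 : ∀ n : ℕ, (0 : ℝ) < 1 / (2 * ((n : ℝ) + 1)) := fun n => by positivity
  have h1 := hlim (f := fun n ω => ((M (1 / ((n : ℝ) + 1)) ω).mass : ℝ≥0∞))
    (g := fun ω => ((μ ω).mass : ℝ≥0∞)) (hμ.tendsto_mass hu1)
  have h2 := hdom (f := fun n ω => ((M (1 / (2 * ((n : ℝ) + 1))) ω).mass : ℝ≥0∞))
    (g := fun ω => ((μ ω).mass : ℝ≥0∞)) (fun n => hμ.aemeasurable_mass_trunc hΛ (hpos2 n))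
    (hμ.tendsto_mass hu2)
  refine lintegral_le_of_tendsto_ae
    (fun n => hae (hμ.aemeasurable_mass_trunc hΛ (hpos n))) h1 (fun n => ?_) h2
  have := hstep (1 / (2 * ((n : ℝ) + 1))) (by positivity) (by
    rw [div_le_div_iff_of_pos_left one_pos (by positivity) two_pos]
    linarith [(Nat.cast_nonneg n : (0 : ℝ) ≤ n)])
  rwa [show 2 * (1 / (2 * ((n : ℝ) + 1))) = 1 / ((n : ℝ) + 1) by field_simp] at this

/-- The self-similarity inequality for moments. -/
lemma lintegral_halfCore_mul_massMoment_le [IsProbabilityMeasure P]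
    (hμ : IsCascadeLimit P Λ 0 1 X M μ) (hΛ : IsIndepScattered P ψ volume Λ) {q : ℝ} (hq : 0 < q) :
    (∫⁻ ω, ENNReal.ofReal (Real.exp (Λ halfCore ω) / 2) ^ q ∂P) * massMoment P μ q
      ≤ massMoment P μ q := by
  have hcore : volume halfCore < ⊤ := by rw [volume_halfCore]; exact ENNReal.ofReal_lt_top
  have hmc := hΛ.measurable _ measurableSet_halfCore hcore
  have := Measure.isProbabilityMeasure_map (μ := P) hmc.aemeasurable
  have hmass := hμ.aemeasurable_mass hΛ
  have hexp : Measurable fun y : ℝ => ENNReal.ofReal (Real.exp y / 2) ^ q := by fun_prop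
  have hexp' : Measurable fun y : ℝ => ENNReal.ofReal (Real.exp y / 2) := by fun_prop
  have hlhs : ∫⁻ p, (ENNReal.ofReal (Real.exp p.1 / 2) * (μ p.2).mass) ^ q
      ∂((P.map (Λ halfCore)).prod P)
      = (∫⁻ ω, ENNReal.ofReal (Real.exp (Λ halfCore ω) / 2) ^ q ∂P) * massMoment P μ q := by
    simp_rw [ENNReal.mul_rpow_of_nonneg _ _ hq.le]
    rw [lintegral_prod_mul hexp.aemeasurable (hmass.pow_const q), lintegral_map hexp hmc]
    rfl
  rw [← hlhs]
  -- bounded functions increasing to `x ↦ x ^ q`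
  let F : ℕ → ℝ≥0∞ → ℝ≥0∞ := fun K x => (min x K) ^ q
  refine lintegral_le_of_tendsto_ae (f := fun K p =>
      F K (ENNReal.ofReal (Real.exp p.1 / 2) * (μ p.2).mass)) (fun K => ?_) (ae_of_all _ fun p => ?_)
    (c := fun _ => massMoment P μ q) (fun K => ?_) tendsto_const_nhds
  · refine AEMeasurable.pow_const (AEMeasurable.min ?_ aemeasurable_const) q
    exact (hexp'.comp measurable_fst).aemeasurable.mul
      (hmass.comp_quasiMeasurePreserving Measure.quasiMeasurePreserving_snd)
  · have hx : ENNReal.ofReal (Real.exp p.1 / 2) * ((μ p.2).mass : ℝ≥0∞) ≠ ⊤ :=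
      ENNReal.mul_ne_top ENNReal.ofReal_ne_top ENNReal.coe_ne_top
    refine tendsto_const_nhds.congr' ?_
    obtain ⟨N, hN⟩ := ENNReal.exists_nat_gt hx
    filter_upwards [eventually_ge_atTop N] with K hK
    have : ENNReal.ofReal (Real.exp p.1 / 2) * ((μ p.2).mass : ℝ≥0∞) ≤ K :=
      hN.le.trans (by exact_mod_cast hK)
    simp only [F]
    rw [min_eq_left this]
  · refine (hμ.lintegral_prod_le hΛ (F := F K) ?_ ?_ (K := (K : ℝ≥0∞) ^ q) ?_ ?_).trans ?_
    · intro x y hxy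
      exact ENNReal.rpow_le_rpow (min_le_min_right _ hxy) hq.le
    · exact (ENNReal.continuous_rpow_const).comp (continuous_id.min continuous_const)
    · exact ENNReal.rpow_ne_top_of_nonneg hq.le (ENNReal.natCast_ne_top K)
    · intro x
      exact ENNReal.rpow_le_rpow (min_le_right _ _) hq.le
    · exact lintegral_mono fun ω => ENNReal.rpow_le_rpow (min_le_left _ _) hq.le

/-- By self-similarity `E e^{qΛ(C)} ≤ 2^q` for all `q > 1`, where `C` is the common core; let
`q → ∞` in Markov's inequality. -/
lemma ae_halfCore_le [IsProbabilityMeasure P] (hμ : IsCascadeLimit P Λ 0 1 X M μ)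
    (hΛ : IsIndepScattered P ψ volume Λ)
    (hα : ∀ q : ℝ, 1 < q → 0 < massMoment P μ q ∧ massMoment P μ q < ⊤) :
    ∀ᵐ ω ∂P, Λ halfCore ω ≤ Real.log 2 := by
  have hcore : volume halfCore < ⊤ := by rw [volume_halfCore]; exact ENNReal.ofReal_lt_top
  have hmc := hΛ.measurable _ measurableSet_halfCore hcore
  have hle : ∀ q : ℝ, 1 < q → ∫⁻ ω, ENNReal.ofReal (Real.exp (Λ halfCore ω) / 2) ^ q ∂P ≤ 1 := by
    intro q hq
    have h := hμ.lintegral_halfCore_mul_massMoment_le hΛ (zero_lt_one.trans hq)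
    by_contra! hlt
    have := ENNReal.mul_lt_mul_left (hα q hq).1.ne' (hα q hq).2.ne hlt
    rw [one_mul] at this
    exact absurd h (not_le.2 this)
  have hkey : ∀ n : ℕ, ∀ᵐ ω ∂P, Λ halfCore ω ≤ Real.log 2 + 1 / (n + 1) := by
    intro n
    set δ : ℝ := 1 / (n + 1) with hδ
    have hδ0 : 0 < δ := by positivity
    have hq : ∀ k : ℕ, P {ω | Real.log 2 + δ < Λ halfCore ω}
        ≤ ENNReal.ofReal (Real.exp (-(k + 2 : ℝ) * δ)) := by
      intro k
      have h1 := hle (k + 2) (by linarith [(Nat.cast_nonneg k : (0 : ℝ) ≤ k)])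
      have h2 : ENNReal.ofReal (Real.exp ((k + 2 : ℝ) * δ)) *
          P {ω | Real.log 2 + δ < Λ halfCore ω}
          ≤ ∫⁻ ω, ENNReal.ofReal (Real.exp (Λ halfCore ω) / 2) ^ (k + 2 : ℝ) ∂P := by
        refine le_trans ?_ (mul_meas_ge_le_lintegral₀ (by fun_prop)
          (ENNReal.ofReal (Real.exp ((k + 2 : ℝ) * δ))))
        gcongr
        intro hω
        rename_i ω
        have h3 : Real.exp δ ≤ Real.exp (Λ halfCore ω) / 2 := by
          rw [le_div_iff₀ two_pos]
          have h3 : Real.exp (δ + Real.log 2) ≤ Real.exp (Λ halfCore ω) :=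
            Real.exp_le_exp.2 (by linarith [show Real.log 2 + δ < Λ halfCore ω from hω])
          rwa [Real.exp_add, Real.exp_log two_pos] at h3
        rw [ENNReal.ofReal_rpow_of_nonneg (by positivity) (by positivity)]
        refine ENNReal.ofReal_le_ofReal ?_
        rw [mul_comm, Real.exp_mul]
        exact Real.rpow_le_rpow (by positivity) h3 (by positivity)
      have h4 := h2.trans h1
      calc _ = ENNReal.ofReal (Real.exp (-(k + 2 : ℝ) * δ)) *
            (ENNReal.ofReal (Real.exp ((k + 2 : ℝ) * δ)) *
              P {ω | Real.log 2 + δ < Λ halfCore ω}) := by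
            rw [← mul_assoc, ← ENNReal.ofReal_mul (by positivity), ← Real.exp_add, neg_mul,
              neg_add_cancel, Real.exp_zero, ENNReal.ofReal_one, one_mul]
        _ ≤ ENNReal.ofReal (Real.exp (-(k + 2 : ℝ) * δ)) * 1 := by gcongr
        _ = _ := mul_one _
    have h0 : Tendsto (fun k : ℕ => ENNReal.ofReal (Real.exp (-(k + 2 : ℝ) * δ))) atTop (𝓝 0) := by
      rw [← ENNReal.ofReal_zero]
      refine ENNReal.tendsto_ofReal (Real.tendsto_exp_atBot.comp ?_)
      refine Tendsto.atBot_mul_const hδ0 (tendsto_neg_atTop_atBot.comp ?_)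
      exact tendsto_atTop_add_const_right _ _ tendsto_natCast_atTop_atTop
    have h5 := ge_of_tendsto' h0 hq
    rw [nonpos_iff_eq_zero] at h5
    rw [ae_iff]
    simpa only [not_le] using h5
  filter_upwards [ae_all_iff.2 hkey] with ω hω
  refine le_of_forall_pos_le_add fun e he => ?_
  obtain ⟨n, hn⟩ := exists_nat_one_div_lt he
  exact (hω n).trans (by linarith)

/-- Finiteness and positivity of all moments of the total mass force the law of `Λ` on small
sets to be bounded by the intensity. -/
theorem smallTimeBounded [IsProbabilityMeasure P] {a σ : ℝ} {ν : Measure ℝ}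
    (hμ : IsCascadeLimit P Λ 0 1 X M μ)
    (hΛ : IsIndepScattered P (levyExponent a σ ν) volume Λ)
    (hα : ∀ q : ℝ, 1 < q → 0 < massMoment P μ q ∧ massMoment P μ q < ⊤) :
    SmallTimeBounded a σ ν (fun n => Real.log 2 / (n + 1))
      (fun n => P.map (Λ (strip 0 (Real.log 2 / (n + 1))))) := by
  have hlog : 0 < Real.log 2 := Real.log_pos one_lt_two
  have hfin : ∀ c d, volume (strip c d) < ⊤ := fun c d => by
    rw [volume_strip]; exact ENNReal.ofReal_lt_top
  have hmeas : ∀ c d, Measurable (Λ (strip c d)) := fun c d =>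
    hΛ.measurable _ (measurableSet_strip c d) (hfin c d)
  have hcore : volume halfCore < ⊤ := by rw [volume_halfCore]; exact ENNReal.ofReal_lt_top
  refine ⟨fun n => by positivity, ?_, fun n => Measure.isProbabilityMeasure_map
    (hmeas _ _).aemeasurable, fun n q => ?_, fun n => ?_, fun n => ?_⟩
  · exact tendsto_const_nhds.div_atTop
      (tendsto_atTop_add_const_right _ _ tendsto_natCast_atTop_atTop)
  · rw [hΛ.charFun_map (measurableSet_strip _ _) (hfin _ _), volume_strip, sub_zero,
      ENNReal.toReal_ofReal (by positivity)]
  · have hn : (0 : ℝ) < n + 1 := by positivity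
    have h1 : P {ω | Real.log 2 < Λ (strip 0 (Real.log 2)) ω} = 0 := by
      have h2 := congrArg (fun π => π (Ioi (Real.log 2))) (hΛ.map_eq (measurableSet_strip 0
        (Real.log 2)) measurableSet_halfCore (hfin _ _) (by
          rw [volume_strip, volume_halfCore, sub_zero]))
      have hmc := hΛ.measurable _ measurableSet_halfCore hcore
      rw [Measure.map_apply (hmeas _ _) measurableSet_Ioi,
        Measure.map_apply hmc measurableSet_Ioi] at h2
      refine h2.trans ?_
      have h3 := hμ.ae_halfCore_le hΛ hα
      rw [ae_iff] at h3
      simp only [not_le] at h3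
      exact h3
    have h4 := hΛ.pow_measure_strip_le (τ := Real.log 2 / (n + 1)) (by positivity) n
    rw [show ((n + 1 : ℕ) : ℝ) * (Real.log 2 / (n + 1)) = Real.log 2 by push_cast; field_simp,
      h1, nonpos_iff_eq_zero, pow_eq_zero_iff (by omega)] at h4
    rw [ae_map_iff (hmeas _ _).aemeasurable measurableSet_Iic, ae_iff]
    simpa only [not_le] using h4
  · rw [lintegral_map (by fun_prop) (hmeas _ _)]
    exact hμ.one_le_lintegral_exp_strip hΛ (q := 2) two_pos (hα 2 one_lt_two).1 (by positivity)

end IsCascadeLimit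

end

section

/-! ### The exponents of the moments -/

/-- The second difference `φ(k + 2) - 2 φ(k + 1) + φ(k)`; it is the interaction of two points with
`k` points between them. -/
def secDiff (φ : ℕ → ℝ) (k : ℕ) : ℝ := φ (k + 2) - 2 * φ (k + 1) + φ k

lemma sum_secDiff {φ : ℕ → ℝ} (h0 : φ 0 = 0) (h1 : φ 1 = 0) (m : ℕ) :
    ∑ k ∈ Finset.range m, secDiff φ k = φ (m + 1) - φ m := by
  induction m with
  | zero => simp [h0, h1]
  | succ m ih => rw [Finset.sum_range_succ, ih, secDiff]; ring

namespace SubcriticalNegative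

variable {σ : ℝ} {ν : Measure ℝ}

lemma momentExp_zero : momentExp ν 0 = 0 := by simp [momentExp]

lemma momentExp_one (h : SubcriticalNegative σ ν) (hν : IsLevyMeasure ν) : momentExp ν 1 = 0 := by
  simp [momentExp, h.gam_eq hν]

/-- The increments of the moment exponent fall short of `γ` by an integral which decreases to
zero. -/
lemma momentExp_succ_sub (h : SubcriticalNegative σ ν) (hν : IsLevyMeasure ν) (m : ℕ) :
    momentExp ν ((m + 1 : ℕ) : ℝ) - momentExp ν m
      = gam ν - ∫ x, Real.exp (m * x) * (1 - Real.exp x) ∂ν := by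
  have h1 := integral_sub (h.integrable_one_sub_exp hν (p := ((m + 1 : ℕ) : ℝ)) (by positivity))
    (h.integrable_one_sub_exp hν (p := m) (by positivity))
  have h2 : ∫ x, Real.exp (m * x) * (1 - Real.exp x) ∂ν
      = ∫ x, ((1 - Real.exp (((m + 1 : ℕ) : ℝ) * x)) - (1 - Real.exp (m * x))) ∂ν := by
    refine integral_congr_ae (ae_of_all _ fun x => ?_)
    simp only
    push_cast
    rw [add_mul, one_mul, Real.exp_add]
    ring
  rw [h2, h1, momentExp, momentExp]
  push_cast
  ring

lemma integrable_exp_mul_one_sub (h : SubcriticalNegative σ ν) (hν : IsLevyMeasure ν) (m : ℕ) :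
    Integrable (fun x => Real.exp (m * x) * (1 - Real.exp x)) ν := by
  have h1 := (h.integrable_one_sub_exp hν (p := ((m + 1 : ℕ) : ℝ)) (by positivity)).sub
    (h.integrable_one_sub_exp hν (p := m) (by positivity))
  refine h1.congr (ae_of_all _ fun x => ?_)
  simp only [Pi.sub_apply]
  push_cast
  rw [add_mul, one_mul, Real.exp_add]
  ring

lemma secDiff_nonneg (h : SubcriticalNegative σ ν) (hν : IsLevyMeasure ν) (k : ℕ) :
    0 ≤ secDiff (fun n => momentExp ν n) k := by
  have h1 := h.momentExp_succ_sub hν (k + 1)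
  have h2 := h.momentExp_succ_sub hν k
  have h3 : ∫ x, Real.exp ((k + 1 : ℕ) * x) * (1 - Real.exp x) ∂ν
      ≤ ∫ x, Real.exp (k * x) * (1 - Real.exp x) ∂ν := by
    refine integral_mono_ae (h.integrable_exp_mul_one_sub hν _)
      (h.integrable_exp_mul_one_sub hν _) ?_
    filter_upwards [h.ae_neg hν] with x hx
    have : 0 ≤ 1 - Real.exp x := by linarith [Real.exp_le_one_iff.2 hx.le]
    refine mul_le_mul_of_nonneg_right (Real.exp_le_exp.2 ?_) this
    push_cast
    nlinarith
  unfold secDiff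
  simp only
  rw [show k + 2 = k + 1 + 1 from rfl]
  linarith

lemma sum_secDiff_le (h : SubcriticalNegative σ ν) (hν : IsLevyMeasure ν) (m : ℕ) :
    ∑ k ∈ Finset.range m, secDiff (fun n => momentExp ν n) k ≤ gam ν := by
  rw [sum_secDiff (by simp [momentExp_zero]) (by simpa using h.momentExp_one hν),
    h.momentExp_succ_sub hν]
  have : 0 ≤ ∫ x, Real.exp (m * x) * (1 - Real.exp x) ∂ν := by
    refine integral_nonneg_of_ae ?_
    filter_upwards [h.ae_neg hν] with x hx
    have : 0 ≤ 1 - Real.exp x := by linarith [Real.exp_le_one_iff.2 hx.le]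
    exact mul_nonneg (Real.exp_pos _).le this
  linarith

lemma tendsto_sum_secDiff (h : SubcriticalNegative σ ν) (hν : IsLevyMeasure ν) :
    Tendsto (fun m => ∑ k ∈ Finset.range m, secDiff (fun n => momentExp ν n) k) atTop
      (𝓝 (gam ν)) := by
  have h1 : Tendsto (fun m : ℕ => ∫ x, Real.exp (m * x) * (1 - Real.exp x) ∂ν) atTop
      (𝓝 (∫ _, (0 : ℝ) ∂ν)) := by
    refine tendsto_integral_of_dominated_convergence (fun x => 1 - Real.exp (1 * x))
      (fun m => (h.integrable_exp_mul_one_sub hν m).aestronglyMeasurable)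
      (h.integrable_one_sub_exp hν zero_le_one) (fun m => ?_) ?_
    · filter_upwards [h.ae_neg hν] with x hx
      have h2 : 0 ≤ 1 - Real.exp x := by linarith [Real.exp_le_one_iff.2 hx.le]
      have h3 : Real.exp (m * x) ≤ 1 :=
        Real.exp_le_one_iff.2 (mul_nonpos_of_nonneg_of_nonpos (by positivity) hx.le)
      rw [Real.norm_of_nonneg (mul_nonneg (Real.exp_pos _).le h2), one_mul]
      exact mul_le_of_le_one_left h2 h3
    · filter_upwards [h.ae_neg hν] with x hx
      rw [← zero_mul (1 - Real.exp x)]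
      refine Tendsto.mul_const _ (Real.tendsto_exp_atBot.comp ?_)
      exact tendsto_natCast_atTop_atTop.atTop_mul_const_of_neg hx
  have h2 := (tendsto_const_nhds (x := gam ν)).sub h1
  simp only [integral_zero, sub_zero] at h2
  refine h2.congr fun m => ?_
  rw [sum_secDiff (by simp [momentExp_zero]) (by simpa using h.momentExp_one hν),
    h.momentExp_succ_sub hν]

lemma secDiff_zero_lt (h : SubcriticalNegative σ ν) (hν : IsLevyMeasure ν) (hν0 : ν ≠ 0) :
    secDiff (fun n => momentExp ν n) 0 < gam ν := by
  have h1 := sum_secDiff (φ := fun n : ℕ => momentExp ν n) (by simp [momentExp_zero])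
    (by simpa using h.momentExp_one hν) 1
  rw [Finset.sum_range_one] at h1
  rw [h1, h.momentExp_succ_sub hν 1]
  have : 0 < ∫ x, Real.exp ((1 : ℕ) * x) * (1 - Real.exp x) ∂ν := by
    have hpos : ∀ᵐ x ∂ν, 0 < Real.exp ((1 : ℕ) * x) * (1 - Real.exp x) := by
      filter_upwards [h.ae_neg hν] with x hx
      have h2 : 0 < 1 - Real.exp x := by linarith [show Real.exp x < 1 by simpa using hx]
      positivity
    rw [integral_pos_iff_support_of_nonneg_ae (hpos.mono fun x hx => hx.le)
      (h.integrable_exp_mul_one_sub hν 1)]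
    rw [pos_iff_ne_zero]
    intro h0
    refine hν0 (ae_eq_bot.1 ?_)
    rw [← Filter.eventually_false_iff_eq_bot]
    filter_upwards [hpos, measure_eq_zero_iff_ae_notMem.1 h0] with x hx hx'
    exact hx' hx.ne'
  linarith

end SubcriticalNegative

/-! ### Correlations of ordered points -/

/-- The contribution to the correlation exponent of a point `x` added in front of the list `l`,
whose entries have index distances `k + 1, k + 2, …` to `x`. -/
def rowSum (φ : ℕ → ℝ) (c : ℝ → ℝ → ℝ) : ℕ → ℝ → List ℝ → ℝ
  | _, _, [] => 0
  | k, x, y :: l => secDiff φ k * c x y + rowSum φ c (k + 1) x l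

/-- The correlation exponent `∑ secDiff φ (j - i - 1) * c (tᵢ, tⱼ)` over pairs `i < j`. -/
def corr (φ : ℕ → ℝ) (c : ℝ → ℝ → ℝ) : List ℝ → ℝ
  | [] => 0
  | x :: l => corr φ c l + rowSum φ c 0 x l

section pointwise

variable {S : Type*} (B : ℝ → Set S)

/-- The number of entries `t` of `l` with `z ∈ B t`. -/
def count (z : S) (l : List ℝ) : ℕ := (l.map fun t => (B t).indicator (fun _ => 1) z).sum

/-- The indicator of `z ∈ B x ∩ B y`. -/
def pairInd (z : S) (x y : ℝ) : ℝ := (B x ∩ B y).indicator (fun _ => 1) z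

variable {B}

lemma rowSum_pairInd_of_notMem (φ : ℕ → ℝ) {z : S} {x : ℝ} (hx : z ∉ B x) (l : List ℝ) (k : ℕ) :
    rowSum φ (pairInd B z) k x l = 0 := by
  induction l generalizing k with
  | nil => rfl
  | cons y l ih =>
    rw [rowSum, ih, pairInd, Set.indicator_of_notMem (fun h => hx h.1)]
    simp

lemma rowSum_pairInd_of_forall_notMem (φ : ℕ → ℝ) {z : S} {x : ℝ} {l : List ℝ}
    (hl : ∀ y ∈ l, z ∉ B y) (k : ℕ) :
    rowSum φ (pairInd B z) k x l = 0 := by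
  induction l generalizing k with
  | nil => rfl
  | cons y l ih =>
    rw [rowSum, ih fun w hw => hl w (List.mem_cons_of_mem _ hw), pairInd,
      Set.indicator_of_notMem (fun h => hl y List.mem_cons_self h.2)]
    simp

lemma count_cons_of_mem {z : S} {x : ℝ} (hx : z ∈ B x) (l : List ℝ) :
    count B z (x :: l) = count B z l + 1 := by
  rw [count, List.map_cons, List.sum_cons, Set.indicator_of_mem hx, add_comm]
  rfl

lemma count_cons_of_notMem {z : S} {x : ℝ} (hx : z ∉ B x) (l : List ℝ) :
    count B z (x :: l) = count B z l := by
  rw [count, List.map_cons, List.sum_cons, Set.indicator_of_notMem hx, zero_add]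
  rfl

lemma count_eq_zero {z : S} {l : List ℝ} (hl : ∀ y ∈ l, z ∉ B y) : count B z l = 0 := by
  refine List.sum_eq_zero fun n hn => ?_
  obtain ⟨y, hy, rfl⟩ := List.mem_map.1 hn
  exact Set.indicator_of_notMem (hl y hy) _

/-- If `z ∈ B x`, the entries `t` of `l` with `z ∈ B t` form an initial segment of `l`. -/
lemma rowSum_pairInd_of_mem (φ : ℕ → ℝ) {z : S}
    (hconv : ∀ w y x, w < y → y < x → z ∈ B w → z ∈ B x → z ∈ B y) {x : ℝ} (hx : z ∈ B x)
    {l : List ℝ} (hl : (x :: l).Pairwise (· > ·)) (k : ℕ) :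
    rowSum φ (pairInd B z) k x l = ∑ i ∈ Finset.range (count B z l), secDiff φ (k + i) := by
  induction l generalizing k with
  | nil => simp [rowSum, count]
  | cons y l ih =>
    by_cases hy : z ∈ B y
    · have hl' : (x :: l).Pairwise (· > ·) := hl.sublist (by simp)
      have hxy : z ∈ B x ∩ B y := ⟨hx, hy⟩
      rw [rowSum, ih hl', pairInd, Set.indicator_of_mem hxy, count_cons_of_mem hy,
        Finset.sum_range_succ', mul_one, add_comm, add_zero]
      congr 1
      refine Finset.sum_congr rfl fun i _ => ?_
      congr 1
      ring
    · have hnot : ∀ w ∈ y :: l, z ∉ B w := by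
        intro w hw
        rcases List.mem_cons.1 hw with rfl | hw
        · exact hy
        · intro hzw
          have h1 := List.pairwise_cons.1 hl
          have h2 := List.pairwise_cons.1 h1.2
          exact hy (hconv w y x (h2.1 w hw) (h1.1 y List.mem_cons_self) hzw hx)
      rw [rowSum_pairInd_of_forall_notMem φ hnot, count_eq_zero hnot]
      simp

lemma corr_pairInd {φ : ℕ → ℝ} (h0 : φ 0 = 0) (h1 : φ 1 = 0) {z : S}
    (hconv : ∀ w y x, w < y → y < x → z ∈ B w → z ∈ B x → z ∈ B y)
    {l : List ℝ} (hl : l.Pairwise (· > ·)) :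
    corr φ (pairInd B z) l = φ (count B z l) := by
  induction l with
  | nil => simp [corr, count, h0]
  | cons x l ih =>
    rw [corr, ih (List.pairwise_cons.1 hl).2]
    by_cases hx : z ∈ B x
    · rw [rowSum_pairInd_of_mem φ hconv hx hl]
      simp only [zero_add]
      rw [sum_secDiff h0 h1, count_cons_of_mem hx]
      ring
    · rw [rowSum_pairInd_of_notMem φ hx, count_cons_of_notMem hx, add_zero]

variable [MeasurableSpace S] {m : Measure S}

lemma integral_rowSum_pairInd (φ : ℕ → ℝ) {x : ℝ} {l : List ℝ} (hx : MeasurableSet (B x))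
    (hxm : m (B x) < ⊤) (hl : ∀ y ∈ l, MeasurableSet (B y)) (k : ℕ) :
    Integrable (fun z => rowSum φ (pairInd B z) k x l) m ∧
      ∫ z, rowSum φ (pairInd B z) k x l ∂m
        = rowSum φ (fun x y => (m (B x ∩ B y)).toReal) k x l := by
  induction l generalizing k with
  | nil => simp [rowSum]
  | cons y l ih =>
    have ih' := ih (fun w hw => hl w (List.mem_cons_of_mem _ hw)) (k + 1)
    have hxy : MeasurableSet (B x ∩ B y) := hx.inter (hl y List.mem_cons_self)
    have h1 : Integrable (fun z => secDiff φ k * pairInd B z x y) m := by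
      refine Integrable.const_mul ?_ _
      exact (integrable_indicator_iff hxy).2 (integrableOn_const
        ((measure_mono inter_subset_left).trans_lt hxm).ne)
    refine ⟨h1.add ih'.1, ?_⟩
    simp only [rowSum]
    rw [integral_add h1 ih'.1, ih'.2, integral_const_mul]
    congr 2
    unfold pairInd
    rw [integral_indicator_const _ hxy]
    simp [Measure.real]

lemma integral_corr_pairInd (φ : ℕ → ℝ) {l : List ℝ} (hl : ∀ y ∈ l, MeasurableSet (B y))
    (hlm : ∀ y ∈ l, m (B y) < ⊤) :
    Integrable (fun z => corr φ (pairInd B z) l) m ∧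
      ∫ z, corr φ (pairInd B z) l ∂m = corr φ (fun x y => (m (B x ∩ B y)).toReal) l := by
  induction l with
  | nil => simp [corr]
  | cons x l ih =>
    have hl' : ∀ y ∈ l, MeasurableSet (B y) := fun w hw => hl w (List.mem_cons_of_mem _ hw)
    have ih' := ih hl' (fun w hw => hlm w (List.mem_cons_of_mem _ hw))
    have h1 := integral_rowSum_pairInd φ (m := m) (hl x List.mem_cons_self)
      (hlm x List.mem_cons_self) hl' 0
    refine ⟨ih'.1.add h1.1, ?_⟩
    simp only [corr]
    rw [integral_add ih'.1 h1.1, ih'.2, h1.2]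

/-- The exponent of a mixed moment as an integral over the points of the space. -/
lemma sum_atom_eq_integral {ι : Type*} [Fintype ι] [DecidableEq ι] {φ : ℕ → ℝ} (h0 : φ 0 = 0)
    {A : ι → Set S} (hA : ∀ i, MeasurableSet (A i)) (hm : ∀ i, m (A i) < ⊤) :
    ∑ s : Finset ι, φ s.card * (m (atom A s)).toReal
      = ∫ z, φ (∑ i, (A i).indicator (fun _ => 1) z) ∂m := by
  classical
  have h1 : ∀ z, φ (∑ i, (A i).indicator (fun _ => 1) z)
      = ∑ s : Finset ι, (atom A s).indicator (fun _ => φ s.card) z := by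
    intro z
    have hc : ∑ i, (A i).indicator (fun _ => 1) z
        = (Finset.univ.filter fun i => z ∈ A i).card := by
      rw [Finset.card_filter]
      rfl
    rw [hc, Finset.sum_eq_single (Finset.univ.filter fun i => z ∈ A i)]
    · by_cases hne : (Finset.univ.filter fun i => z ∈ A i).Nonempty
      · rw [Set.indicator_of_mem]
        exact ⟨hne, by simp⟩
      · rw [Set.indicator_of_notMem fun h => hne h.1]
        rw [Finset.not_nonempty_iff_eq_empty.1 hne]
        simpa using h0
    · intro s _ hs
      refine Set.indicator_of_notMem (fun h => hs ?_) _
      ext i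
      simpa using (h.2 i).symm
    · simp
  simp_rw [h1]
  rw [integral_finsetSum]
  · refine Finset.sum_congr rfl fun s _ => ?_
    rw [integral_indicator_const _ (measurableSet_atom hA s), smul_eq_mul, mul_comm]
    rfl
  · intro s _
    exact (integrable_indicator_iff (measurableSet_atom hA s)).2
      (integrableOn_const (measure_atom_lt_top hm s).ne)

end pointwise

lemma truncCone_convex (ε : ℝ) {z : ℍ} (w y x : ℝ) (h1 : w < y) (h2 : y < x)
    (hw : z ∈ truncCone (Icc 0 1) ε w) (hx : z ∈ truncCone (Icc 0 1) ε x) :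
    z ∈ truncCone (Icc 0 1) ε y := by
  have hw' := mem_cone_iff.1 hw.1.1
  have hx' := mem_cone_iff.1 hx.1.1
  refine ⟨⟨mem_cone_iff.2 ⟨?_, ?_⟩, hw.1.2⟩, hw.2⟩ <;> linarith [hw'.2, hx'.1]

/-- The intensity of the intersection of two truncated cones. -/
def pairVol (ε x y : ℝ) : ℝ :=
  (volume (truncCone (Icc 0 1) ε x ∩ truncCone (Icc 0 1) ε y)).toReal

variable {Ω : Type*} [MeasurableSpace Ω] {P : Measure Ω} {ψ : ℝ → ℂ} {Λ : Set ℍ → Ω → ℝ}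

/-- The sequence `φ` with `E e^{kΛ(A)} = e^{φ(k) λ(A)}`, normalized by `φ(0) = φ(1) = 0`. -/
structure IsMomentSeq (P : Measure Ω) (Λ : Set ℍ → Ω → ℝ) (φ : ℕ → ℝ) : Prop where
  zero : φ 0 = 0
  one : φ 1 = 0
  lintegral_exp : ∀ k : ℕ, ∀ A, MeasurableSet A → volume A < ⊤ →
    ∫⁻ ω, ENNReal.ofReal (Real.exp (k * Λ A ω)) ∂P
      = ENNReal.ofReal (Real.exp (φ k * (volume A).toReal))

lemma SubcriticalNegative.isMomentSeq [IsProbabilityMeasure P] {σ : ℝ} {ν : Measure ℝ}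
    (h : SubcriticalNegative σ ν) (hν : IsLevyMeasure ν)
    (hΛ : IsIndepScattered P (levyExponent (normDrift σ ν) σ ν) volume Λ) :
    IsMomentSeq P Λ (fun n => momentExp ν n) := by
  refine ⟨by simp [momentExp_zero], by simpa using h.momentExp_one hν, fun k A hA hm => ?_⟩
  have hmeas := hΛ.measurable A hA hm
  have := Measure.isProbabilityMeasure_map (μ := P) hmeas.aemeasurable
  rw [← h.lintegral_exp_eq hν ENNReal.toReal_nonneg (π := P.map (Λ A))
    (fun q => hΛ.charFun_map hA hm q) (Nat.cast_nonneg k), lintegral_map (by fun_prop) hmeas]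

/-- Mixed moments of the densities at ordered points. -/
lemma IsMomentSeq.lintegral_prod_dens {φ : ℕ → ℝ} (hφ : IsMomentSeq P Λ φ)
    (hΛ : IsIndepScattered P ψ volume Λ) {ε : ℝ} (hε : 0 < ε) {l : List ℝ}
    (hl : l.Pairwise (· > ·)) (hmem : ∀ t ∈ l, t ∈ Icc (0 : ℝ) 1) :
    ∫⁻ ω, (l.map fun t => dens Λ ε t ω).prod ∂P
      = ENNReal.ofReal (Real.exp (corr φ (pairVol ε) l)) := by
  let B : ℝ → Set ℍ := fun t => truncCone (Icc 0 1) ε t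
  have hB : ∀ t ∈ l, MeasurableSet (B t) := fun t _ => measurableSet_truncCone zero_le_one ε t
  have hBm : ∀ t ∈ l, volume (B t) < ⊤ := fun t ht => volume_truncCone_lt_top hε (hmem t ht)
  have h1 := hΛ.lintegral_prod_exp hφ.lintegral_exp (B := fun i : Fin l.length => B l[i])
    (fun i => hB _ (List.getElem_mem _)) (fun i => hBm _ (List.getElem_mem _))
  rw [sum_atom_eq_integral hφ.zero (A := fun i : Fin l.length => B l[i])
    (fun i => hB _ (List.getElem_mem _)) (fun i => hBm _ (List.getElem_mem _))] at h1
  have h2 : ∀ z, φ (∑ i : Fin l.length, (B l[i]).indicator (fun _ => 1) z)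
      = corr φ (pairInd B z) l := by
    intro z
    rw [corr_pairInd hφ.zero hφ.one (fun w y x => truncCone_convex ε w y x) hl, count]
    congr 1
    exact Fin.sum_univ_fun_getElem l fun t => (B t).indicator (fun _ => 1) z
  simp_rw [h2] at h1
  rw [(integral_corr_pairInd φ hB hBm).2] at h1
  rw [show corr φ (pairVol ε) l
    = corr φ (fun x y => (volume (B x ∩ B y)).toReal) l from rfl, ← h1]
  refine lintegral_congr fun ω => ?_
  exact (Fin.prod_univ_fun_getElem l fun t => dens Λ ε t ω).symm

end

section

/-! ### Moments as integrals over ordered points -/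

lemma lintegral_triangle {f g : ℝ → ℝ≥0∞} (hf : Measurable f) (hg : Measurable g) (y : ℝ) :
    ∫⁻ x in Ioo y 1, f x * ∫⁻ z in Ioo x 1, g z = ∫⁻ z in Ioo y 1, g z * ∫⁻ x in Ioo y z, f x := by
  have hT : MeasurableSet {p : ℝ × ℝ | p.1 < p.2} := measurableSet_lt measurable_fst measurable_snd
  have hm : Measurable (fun p : ℝ × ℝ =>
      {p : ℝ × ℝ | p.1 < p.2}.indicator (fun p => f p.1 * g p.2) p) :=
    Measurable.indicator (by fun_prop) hT
  have h1 : ∀ x ∈ Ioo y 1, f x * ∫⁻ z in Ioo x 1, g z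
      = ∫⁻ z in Ioo y 1, {p : ℝ × ℝ | p.1 < p.2}.indicator (fun p => f p.1 * g p.2) (x, z) := by
    intro x hx
    rw [← lintegral_const_mul _ hg]
    have : Ioo x 1 = Ioi x ∩ Ioo y 1 := by
      ext z; simp only [mem_Ioo, mem_inter_iff, mem_Ioi]
      exact ⟨fun h => ⟨h.1, hx.1.trans h.1, h.2⟩, fun h => ⟨h.1, h.2.2⟩⟩
    rw [this, ← setLIntegral_indicator measurableSet_Ioi]
    rfl
  have h2 : ∀ z ∈ Ioo y 1, g z * ∫⁻ x in Ioo y z, f x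
      = ∫⁻ x in Ioo y 1, {p : ℝ × ℝ | p.1 < p.2}.indicator (fun p => f p.1 * g p.2) (x, z) := by
    intro z hz
    rw [← lintegral_const_mul _ hf]
    have : Ioo y z = Iio z ∩ Ioo y 1 := by
      ext x; simp only [mem_Ioo, mem_inter_iff, mem_Iio]
      exact ⟨fun h => ⟨h.2, h.1, h.2.trans hz.2⟩, fun h => ⟨h.2.1, h.1⟩⟩
    simp_rw [mul_comm (g z)]
    rw [this, ← setLIntegral_indicator measurableSet_Iio]
    rfl
  rw [setLIntegral_congr_fun measurableSet_Ioo h1, setLIntegral_congr_fun measurableSet_Ioo h2]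
  exact lintegral_lintegral_swap hm.aemeasurable

lemma measurable_lintegral_Ioo (f : ℝ → ℝ≥0∞) : Measurable fun x => ∫⁻ z in Ioo x 1, f z :=
  Antitone.measurable fun _ _ hxy => lintegral_mono_set (Ioo_subset_Ioo_left hxy)

/-- `F^{n+1} = (n + 1) ∫ f F^n` for the primitive `F(y) = ∫_y^1 f`. -/
lemma pow_lintegral_Ioo {f : ℝ → ℝ≥0∞} (hf : Measurable f) (n : ℕ) (y : ℝ) :
    (∫⁻ t in Ioo y 1, f t) ^ (n + 1)
      = (n + 1) * ∫⁻ x in Ioo y 1, f x * (∫⁻ t in Ioo x 1, f t) ^ n := by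
  set F : ℝ → ℝ≥0∞ := fun x => ∫⁻ t in Ioo x 1, f t with hF
  have hFm : Measurable F := measurable_lintegral_Ioo f
  change F y ^ (n + 1) = (n + 1) * ∫⁻ x in Ioo y 1, f x * F x ^ n
  induction n generalizing y with
  | zero => simp [hF]
  | succ n ih =>
    have hg : Measurable fun z => f z * F z ^ n := by fun_prop
    -- the integral of `f F^{n+1}`, by the induction hypothesis and an exchange of integrals
    have hA : ∫⁻ x in Ioo y 1, f x * F x ^ (n + 1)
        = (n + 1) * ∫⁻ z in Ioo y 1, f z * F z ^ n * ∫⁻ x in Ioo y z, f x := by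
      rw [← lintegral_triangle hf hg, ← lintegral_const_mul']
      · refine lintegral_congr fun x => ?_
        rw [ih]
        ring
      · exact_mod_cast ENNReal.natCast_ne_top (n + 1)
    have hsplit : ∀ z ∈ Ioo y 1, F y = (∫⁻ x in Ioo y z, f x) + F z := by
      intro z hz
      simp only [hF]
      rw [setLIntegral_congr (Ioo_ae_eq_Ioc (a := y) (b := z)),
        ← lintegral_union measurableSet_Ioo]
      · rw [Ioc_union_Ioo_eq_Ioo hz.1.le hz.2]
      · exact Set.disjoint_left.2 fun t ht ht' => absurd ht.2 (not_le.2 ht'.1)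
    have hB : F y ^ (n + 1 + 1) = (n + 1) * ((∫⁻ z in Ioo y 1, f z * F z ^ n * ∫⁻ x in Ioo y z, f x)
        + ∫⁻ z in Ioo y 1, f z * F z ^ (n + 1)) := by
      rw [pow_succ, ih, mul_assoc, ← lintegral_mul_const _ hg,
        ← lintegral_add_right _ (by fun_prop)]
      congr 1
      refine setLIntegral_congr_fun measurableSet_Ioo fun z hz => ?_
      rw [hsplit z hz]
      ring
    rw [hB, mul_add, ← hA]
    push_cast
    ring

variable {Ω : Type*} [MeasurableSpace Ω] {P : Measure Ω} {ψ : ℝ → ℂ} {Λ : Set ℍ → Ω → ℝ}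

lemma measurable_lintegral_Ioo_prod {r : ℝ × Ω → ℝ≥0∞} (hr : Measurable r) :
    Measurable (fun p : ℝ × Ω => ∫⁻ t in Ioo p.1 1, r (t, p.2)) := by
  have h1 : Measurable (fun q : (ℝ × Ω) × ℝ => q.1.1) := measurable_fst.comp measurable_fst
  have hT : MeasurableSet ({q : (ℝ × Ω) × ℝ | q.1.1 < q.2} ∩ {q : (ℝ × Ω) × ℝ | q.2 < 1}) :=
    (measurableSet_lt h1 measurable_snd).inter (measurableSet_lt measurable_snd measurable_const)
  have h2 : Measurable (fun q : (ℝ × Ω) × ℝ => (q.2, q.1.2)) :=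
    measurable_snd.prodMk (measurable_snd.comp measurable_fst)
  have h4 := ((hr.comp h2).indicator hT).lintegral_prod_right' (ν := volume)
  refine (congrArg Measurable (funext fun p => ?_)).mp h4
  rw [← lintegral_indicator measurableSet_Ioo]
  rfl

lemma measurable_lintegral_regDens (hΛ : IsIndepScattered P ψ volume Λ) {ε : ℝ} (hε : 0 < ε) :
    Measurable (fun p : ℝ × Ω => ∫⁻ t in Ioo p.1 1, regDens Λ ε t p.2) :=
  measurable_lintegral_Ioo_prod (measurable_regDens hΛ hε)

lemma measurable_regDens_right (hΛ : IsIndepScattered P ψ volume Λ) {ε : ℝ} (hε : 0 < ε) (ω : Ω) :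
    Measurable fun t => regDens Λ ε t ω := by
  have h1 : Measurable (fun t : ℝ => (t, ω)) := measurable_prodMk_right
  have h2 := (measurable_regDens hΛ hε).comp h1
  exact h2

lemma measurable_regDens_left (hΛ : IsIndepScattered P ψ volume Λ) {ε : ℝ} (hε : 0 < ε) (t : ℝ) :
    Measurable fun ω => regDens Λ ε t ω := by
  have h1 : Measurable (fun ω : Ω => (t, ω)) := measurable_prodMk_left
  have h2 := (measurable_regDens hΛ hε).comp h1
  exact h2

lemma measurable_prod_regDens (hΛ : IsIndepScattered P ψ volume Λ) {ε : ℝ} (hε : 0 < ε)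
    (l : List ℝ) : Measurable (fun ω => (l.map fun t => regDens Λ ε t ω).prod) := by
  induction l with
  | nil => simp
  | cons t l ih =>
    simp only [List.map_cons, List.prod_cons]
    exact (measurable_regDens_left hΛ hε t).mul ih

/-- The integral of the mixed moments of the density at the points of the list `l` and at `n`
further ordered points between the head of `l` and `1`. -/
def orderedMoment (P : Measure Ω) (Λ : Set ℍ → Ω → ℝ) (ε : ℝ) : ℕ → List ℝ → ℝ≥0∞
  | 0, l => ∫⁻ ω, (l.map fun t => regDens Λ ε t ω).prod ∂P
  | n + 1, l => ∫⁻ x in Ioo (l.headD 0) 1, orderedMoment P Λ ε n (x :: l)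

/-- The moments of the mass of the truncated cascade to the right of the head of `l`, weighted by
the densities at the points of `l`, are integrals over ordered points. -/
lemma lintegral_prod_mul_pow [SFinite P] (hΛ : IsIndepScattered P ψ volume Λ) {ε : ℝ} (hε : 0 < ε)
    (n : ℕ) (l : List ℝ) :
    ∫⁻ ω, (l.map fun t => regDens Λ ε t ω).prod
        * (∫⁻ t in Ioo (l.headD 0) 1, regDens Λ ε t ω) ^ n ∂P
      = n.factorial * orderedMoment P Λ ε n l := by
  induction n generalizing l with
  | zero => simp [orderedMoment]
  | succ n ih =>
    have hreg : ∀ ω, Measurable fun t => regDens Λ ε t ω := fun ω =>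
      measurable_regDens_right hΛ hε ω
    have hjoint : Measurable (fun p : Ω × ℝ => (l.map fun t => regDens Λ ε t p.1).prod
        * (regDens Λ ε p.2 p.1 * (∫⁻ t in Ioo p.2 1, regDens Λ ε t p.1) ^ n)) := by
      have hfst : Measurable (Prod.fst : Ω × ℝ → Ω) := measurable_fst
      have hswap : Measurable (Prod.swap : Ω × ℝ → ℝ × Ω) := measurable_swap
      have h1 := (measurable_prod_regDens hΛ hε l).comp hfst
      have h2 := (measurable_regDens hΛ hε).comp hswap
      have h3 := (measurable_lintegral_regDens hΛ hε).comp hswap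
      exact h1.mul (h2.mul (h3.pow_const n))
    calc _ = ∫⁻ ω, ((n + 1 : ℕ) * ∫⁻ x in Ioo (l.headD 0) 1,
            (l.map fun t => regDens Λ ε t ω).prod
              * (regDens Λ ε x ω * (∫⁻ t in Ioo x 1, regDens Λ ε t ω) ^ n)) ∂P := by
          refine lintegral_congr fun ω => ?_
          have hm : Measurable fun x => regDens Λ ε x ω * (∫⁻ t in Ioo x 1, regDens Λ ε t ω) ^ n :=
            (hreg ω).mul ((measurable_lintegral_Ioo _).pow_const n)
          rw [pow_lintegral_Ioo (hreg ω), lintegral_const_mul _ hm]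
          push_cast
          ring
      _ = (n + 1 : ℕ) * ∫⁻ x : ℝ in Ioo (l.headD 0) 1, ∫⁻ ω : Ω, (l.map fun t => regDens Λ ε t ω).prod
          * (regDens Λ ε x ω * (∫⁻ t in Ioo x 1, regDens Λ ε t ω) ^ n) ∂P := by
          rw [lintegral_const_mul' _ _ (ENNReal.natCast_ne_top _)]
          congr 1
          exact lintegral_lintegral_swap (f := fun (ω : Ω) (x : ℝ) =>
            (l.map fun t => regDens Λ ε t ω).prod
              * (regDens Λ ε x ω * (∫⁻ t in Ioo x 1, regDens Λ ε t ω) ^ n)) hjoint.aemeasurable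
      _ = (n + 1 : ℕ) * ∫⁻ x in Ioo (l.headD 0) 1,
          n.factorial * orderedMoment P Λ ε n (x :: l) := by
          congr 1
          refine lintegral_congr fun x => ?_
          rw [← ih (x :: l)]
          refine lintegral_congr fun ω => ?_
          simp only [List.map_cons, List.prod_cons, List.headD_cons]
          ring
      _ = _ := by
          rw [lintegral_const_mul' _ _ (ENNReal.natCast_ne_top _), orderedMoment, ← mul_assoc,
            Nat.factorial_succ]
          push_cast
          ring

/-- Strictly decreasing lists of points of `(0, 1)`. -/
def IsOrdered (l : List ℝ) : Prop := l.Pairwise (· > ·) ∧ ∀ t ∈ l, t ∈ Ioo (0 : ℝ) 1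

lemma IsOrdered.cons {l : List ℝ} (hl : IsOrdered l) {x : ℝ} (hx : x ∈ Ioo (l.headD 0) 1) :
    IsOrdered (x :: l) := by
  have hall : ∀ w ∈ l, w < x := by
    cases l with
    | nil => simp
    | cons y l =>
      intro w hw
      simp only [List.headD_cons] at hx
      rcases List.mem_cons.1 hw with rfl | hw
      · exact hx.1
      · exact lt_trans ((List.pairwise_cons.1 hl.1).1 w hw) hx.1
  refine ⟨List.pairwise_cons.2 ⟨hall, hl.1⟩, fun t ht => ?_⟩
  rcases List.mem_cons.1 ht with rfl | ht
  · refine ⟨?_, hx.2⟩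
    cases l with
    | nil => simpa using hx.1
    | cons y l => exact (hl.2 y List.mem_cons_self).1.trans (hall y List.mem_cons_self)
  · exact hl.2 t ht

namespace IsCascadeLimit

variable {X : ℝ → ℝ → Ω → ℝ} {M : ℝ → Ω → FiniteMeasure ℝ} {μ : Ω → FiniteMeasure ℝ}

lemma lintegral_mass_trunc_pow [SFinite P] (hμ : IsCascadeLimit P Λ 0 1 X M μ)
    (hΛ : IsIndepScattered P ψ volume Λ) {ε : ℝ} (hε : 0 < ε) (n : ℕ) :
    ∫⁻ ω, ((M ε ω).mass : ℝ≥0∞) ^ n ∂P = n.factorial * orderedMoment P Λ ε n [] := by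
  rw [← lintegral_prod_mul_pow hΛ hε]
  refine lintegral_congr_ae ?_
  filter_upwards [hμ.mass_eq_regDens hε] with ω hω
  rw [hω]
  simp

lemma orderedMoment_zero (hμ : IsCascadeLimit P Λ 0 1 X M μ)
    (hΛ : IsIndepScattered P ψ volume Λ) {φ : ℕ → ℝ} (hφ : IsMomentSeq P Λ φ) {ε : ℝ} (hε : 0 < ε)
    {l : List ℝ} (hl : IsOrdered l) :
    orderedMoment P Λ ε 0 l = ENNReal.ofReal (Real.exp (corr φ (pairVol ε) l)) := by
  rw [orderedMoment, ← hφ.lintegral_prod_dens hΛ hε hl.1 fun t ht => Ioo_subset_Icc_self (hl.2 t ht)]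
  have h1 : ∀ᵐ ω ∂P, ∀ t ∈ l, regDens Λ ε t ω = dens Λ ε t ω := by
    have := (Set.Countable.to_subtype (List.finite_toSet l).countable)
    have h2 : ∀ᵐ ω ∂P, ∀ t : {t | t ∈ l}, regDens Λ ε t ω = dens Λ ε t ω :=
      ae_all_iff.2 fun t => hμ.regDens_eq_dens hε (Ioo_subset_Ico_self (hl.2 t t.2))
    exact h2.mono fun ω hω t ht => hω ⟨t, ht⟩
  refine lintegral_congr_ae ?_
  filter_upwards [h1] with ω hω
  rw [List.map_congr_left hω]

end IsCascadeLimit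

end

section

/-! ### Upper bound for the moments -/

lemma lintegral_Ioi_comp_sub (f : ℝ → ℝ≥0∞) (x : ℝ) :
    ∫⁻ w in Ioi x, f (w - x) = ∫⁻ u in Ioi (0 : ℝ), f u := by
  rw [← lintegral_indicator measurableSet_Ioi, ← lintegral_indicator measurableSet_Ioi,
    ← lintegral_sub_right_eq_self (fun u => (Ioi (0 : ℝ)).indicator f u) x]
  refine lintegral_congr fun w => ?_
  by_cases hw : x < w
  · rw [Set.indicator_of_mem (show w ∈ Ioi x from hw),
      Set.indicator_of_mem (show w - x ∈ Ioi 0 from sub_pos.2 hw)]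
  · rw [Set.indicator_of_notMem (show w ∉ Ioi x from hw), Set.indicator_of_notMem
      (show w - x ∉ Ioi 0 from fun h => hw (sub_pos.1 h))]

lemma lintegral_Ioc_rpow {r v : ℝ} (hr : 0 < r) (hv : 0 < v) :
    ∫⁻ u in Ioc 0 v, ENNReal.ofReal (u ^ (-1 + r)) = ENNReal.ofReal (v ^ r / r) := by
  have h1 : IntegrableOn (fun u : ℝ => u ^ (-1 + r)) (Ioc 0 v) :=
    (intervalIntegrable_iff_integrableOn_Ioc_of_le hv.le).1
      (intervalIntegral.intervalIntegrable_rpow' (by linarith))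
  rw [← ofReal_integral_eq_lintegral_ofReal h1
    ((ae_restrict_mem measurableSet_Ioc).mono fun u hu => Real.rpow_nonneg hu.1.le _),
    ← intervalIntegral.integral_of_le hv.le, integral_rpow (Or.inl (by linarith))]
  congr 1
  rw [show -1 + r + 1 = r by ring, Real.zero_rpow hr.ne', sub_zero]

lemma lintegral_Ioi_rpow {r v : ℝ} (hr : 0 < r) (hv : 0 < v) :
    ∫⁻ u in Ioi v, ENNReal.ofReal (u ^ (-1 - r)) = ENNReal.ofReal (v ^ (-r) / r) := by
  rw [← ofReal_integral_eq_lintegral_ofReal (integrableOn_Ioi_rpow_of_lt (by linarith) hv)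
    ((ae_restrict_mem measurableSet_Ioi).mono fun u hu => Real.rpow_nonneg (hv.trans hu).le _),
    integral_Ioi_rpow_of_lt (by linarith) hv]
  congr 1
  rw [show -1 - r + 1 = -r by ring]
  field_simp

/-- A scale-invariant kernel bound: the singularity at `u = 0` is integrable, and the remaining
singularity as `v → 0` is of order `v^{-η/2}`. -/
lemma lintegral_kernel_le {η v : ℝ} (hη : 0 < η) (hv : 0 < v) :
    ∫⁻ u in Ioi (0 : ℝ), ENNReal.ofReal (u ^ (-1 + η / 2) * (u + v) ^ (-η))
      ≤ ENNReal.ofReal (4 / η * v ^ (-(η / 2))) := by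
  have hη2 : 0 < η / 2 := by positivity
  rw [← Ioc_union_Ioi_eq_Ioi hv.le]
  refine (lintegral_union_le _ _ _).trans ?_
  have h1 : ∫⁻ u in Ioc 0 v, ENNReal.ofReal (u ^ (-1 + η / 2) * (u + v) ^ (-η))
      ≤ ENNReal.ofReal (v ^ (-η)) * ENNReal.ofReal (v ^ (η / 2) / (η / 2)) := by
    rw [← lintegral_Ioc_rpow hη2 hv, ← lintegral_const_mul' _ _ ENNReal.ofReal_ne_top]
    refine setLIntegral_mono' measurableSet_Ioc fun u hu => ?_
    rw [← ENNReal.ofReal_mul (by positivity), mul_comm]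
    refine ENNReal.ofReal_le_ofReal (mul_le_mul_of_nonneg_right ?_ (Real.rpow_nonneg hu.1.le _))
    exact Real.rpow_le_rpow_of_nonpos hv (by linarith [hu.1]) (by linarith)
  have h2 : ∫⁻ u in Ioi v, ENNReal.ofReal (u ^ (-1 + η / 2) * (u + v) ^ (-η))
      ≤ ENNReal.ofReal (v ^ (-(η / 2)) / (η / 2)) := by
    rw [← lintegral_Ioi_rpow hη2 hv]
    refine setLIntegral_mono' measurableSet_Ioi fun u hu => ENNReal.ofReal_le_ofReal ?_
    have hu0 : 0 < u := hv.trans hu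
    calc u ^ (-1 + η / 2) * (u + v) ^ (-η) ≤ u ^ (-1 + η / 2) * u ^ (-η) := by
          refine mul_le_mul_of_nonneg_left ?_ (Real.rpow_nonneg hu0.le _)
          exact Real.rpow_le_rpow_of_nonpos hu0 (by linarith) (by linarith)
      _ = u ^ (-1 - η / 2) := by rw [← Real.rpow_add hu0]; congr 1; ring
  refine (add_le_add h1 h2).trans (le_of_eq ?_)
  rw [← ENNReal.ofReal_mul (by positivity), ← ENNReal.ofReal_add (by positivity) (by positivity)]
  congr 1
  rw [mul_div_assoc', ← Real.rpow_add hv, show -η + η / 2 = -(η / 2) by ring]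
  field_simp
  ring

lemma pairVol_le {ε x y : ℝ} (hε : 0 < ε) (hy : 0 ≤ y) (hyx : y < x) (hx : x ≤ 1) :
    pairVol ε x y ≤ Real.log (1 / (x - y)) := by
  rw [pairVol, inter_comm]
  refine (ENNReal.toReal_mono ENNReal.ofReal_ne_top (volume_truncCone_inter_le hε hy hyx hx)).trans
    (ENNReal.toReal_ofReal (Real.log_nonneg ?_)).le
  rw [le_div_iff₀ (sub_pos.2 hyx)]
  linarith

/-- A new point `x` interacts with points at distance at least `x - z` from it. -/
lemma rowSum_le {φ : ℕ → ℝ} (hφ : ∀ k, 0 ≤ secDiff φ k) {ε x z : ℝ} (hε : 0 < ε) (hx : x ≤ 1)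
    (hzx : z < x) {l : List ℝ} (hl : ∀ w ∈ l, 0 ≤ w ∧ w ≤ z) (k : ℕ) :
    rowSum φ (pairVol ε) k x l
      ≤ (∑ i ∈ Finset.range l.length, secDiff φ (k + i)) * Real.log (1 / (x - z)) := by
  induction l generalizing k with
  | nil => simp [rowSum]
  | cons y l ih =>
    have hy := hl y List.mem_cons_self
    have h1 : pairVol ε x y ≤ Real.log (1 / (x - z)) := by
      refine (pairVol_le hε hy.1 (hy.2.trans_lt hzx) hx).trans ?_
      refine Real.log_le_log (by have := hy.2.trans_lt hzx; have := sub_pos.2 this; positivity) ?_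
      exact one_div_le_one_div_of_le (sub_pos.2 hzx) (by linarith [hy.2])
    have h2 := ih (fun w hw => hl w (List.mem_cons_of_mem _ hw)) (k + 1)
    rw [rowSum, List.length_cons, Finset.sum_range_succ', add_mul, add_comm, add_zero]
    refine add_le_add (h2.trans (le_of_eq ?_)) (mul_le_mul_of_nonneg_left h1 (hφ k))
    congr 1
    refine Finset.sum_congr rfl fun i _ => ?_
    congr 1
    ring

/-- The correlation factor of a new point depends, up to constants, only on its distances to the two
preceding points. -/
lemma exp_rowSum_le {φ : ℕ → ℝ} (hφ : ∀ k, 0 ≤ secDiff φ k) {γ : ℝ}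
    (hγ : ∀ m, ∑ k ∈ Finset.range m, secDiff φ k ≤ γ) {ε w x y : ℝ} (hε : 0 < ε) (hw : w ≤ 1)
    (hwx : x < w) {l : List ℝ} (hl : IsOrdered (x :: y :: l)) :
    Real.exp (rowSum φ (pairVol ε) 0 w (x :: y :: l))
      ≤ (w - x) ^ (-secDiff φ 0) * (w - y) ^ (-(γ - secDiff φ 0)) := by
  have hx0 := hl.2 x List.mem_cons_self
  have hyx : y < x := (List.pairwise_cons.1 hl.1).1 y List.mem_cons_self
  have hyl : ∀ v ∈ y :: l, 0 ≤ v ∧ v ≤ y := by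
    intro v hv
    refine ⟨(hl.2 v (List.mem_cons_of_mem _ hv)).1.le, ?_⟩
    rcases List.mem_cons.1 hv with rfl | hv
    · exact le_rfl
    · exact ((List.pairwise_cons.1 (List.pairwise_cons.1 hl.1).2).1 v hv).le
  have h1 := rowSum_le hφ hε hw (hyx.trans hwx) hyl 1
  have h2 := hγ ((y :: l).length + 1)
  rw [Finset.sum_range_succ'] at h2
  have hlog : 0 ≤ Real.log (1 / (w - y)) := by
    refine Real.log_nonneg ?_
    rw [le_div_iff₀ (sub_pos.2 (hyx.trans hwx))]
    linarith [(hyl y List.mem_cons_self).1]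
  have h3 : (∑ i ∈ Finset.range (y :: l).length, secDiff φ (1 + i)) * Real.log (1 / (w - y))
      ≤ (γ - secDiff φ 0) * Real.log (1 / (w - y)) := by
    refine mul_le_mul_of_nonneg_right ?_ hlog
    simp_rw [add_comm 1]
    linarith
  have h4 := mul_le_mul_of_nonneg_left (pairVol_le hε hx0.1.le hwx hw) (hφ 0)
  rw [rowSum, Real.rpow_def_of_pos (sub_pos.2 hwx), Real.rpow_def_of_pos
    (sub_pos.2 (hyx.trans hwx)), ← Real.exp_add]
  refine Real.exp_le_exp.2 ?_
  rw [one_div, Real.log_inv] at h1 h3 h4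
  linarith

lemma rpow_le_exp {v s : ℝ} (hv : 0 < v) (hs0 : 0 ≤ s) (hs1 : s ≤ 1) : v ^ s ≤ Real.exp v := by
  rw [Real.rpow_def_of_pos hv]
  refine Real.exp_le_exp.2 ?_
  have h1 := Real.log_le_sub_one_of_pos hv
  rcases le_total (Real.log v) 0 with h | h
  · nlinarith
  · nlinarith

variable {Ω : Type*} [MeasurableSpace Ω] {P : Measure Ω} {ψ : ℝ → ℂ} {Λ : Set ℍ → Ω → ℝ}

namespace IsCascadeLimit

variable {X : ℝ → ℝ → Ω → ℝ} {M : ℝ → Ω → FiniteMeasure ℝ} {μ : Ω → FiniteMeasure ℝ}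

/-- The weight `e^{N u} (N u)^{-(1-γ)} ≥ 1`, inserted for every spacing `u`, costs only `e^N` in
total, as the spacings add up to at most one, and it makes the kernel scale invariant. -/
lemma orderedMoment_le (hμ : IsCascadeLimit P Λ 0 1 X M μ)
    (hΛ : IsIndepScattered P ψ volume Λ) {φ : ℕ → ℝ} (hφ : IsMomentSeq P Λ φ)
    (hnn : ∀ k, 0 ≤ secDiff φ k) {γ : ℝ} (hγ : ∀ m, ∑ k ∈ Finset.range m, secDiff φ k ≤ γ)
    (hγ1 : γ ≤ 1) {η : ℝ} (hη : η = γ - secDiff φ 0) (hη0 : 0 < η) {N : ℝ} (hN : 0 < N) {ε : ℝ}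
    (hε : 0 < ε) (n : ℕ) {x y : ℝ} {l : List ℝ} (hl : IsOrdered (x :: y :: l)) :
    orderedMoment P Λ ε n (x :: y :: l) ≤ ENNReal.ofReal ((4 / η * N ^ (-(1 - γ))) ^ n
      * Real.exp (N * (1 - x)) * Real.exp (corr φ (pairVol ε) (x :: y :: l))
        * (x - y) ^ (-(η / 2))) := by
  have hγ0 : 0 ≤ γ := by simpa using hγ 0
  induction n generalizing x y l with
  | zero =>
    rw [hμ.orderedMoment_zero hΛ hφ hε hl]
    refine ENNReal.ofReal_le_ofReal ?_
    have hyx : y < x := (List.pairwise_cons.1 hl.1).1 y List.mem_cons_self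
    have hx := hl.2 x List.mem_cons_self
    have hy := hl.2 y (by simp)
    have h1 : 1 ≤ Real.exp (N * (1 - x)) :=
      Real.one_le_exp (mul_nonneg hN.le (by linarith [hx.2]))
    have h2 : 1 ≤ (x - y) ^ (-(η / 2)) :=
      Real.one_le_rpow_of_pos_of_le_one_of_nonpos (sub_pos.2 hyx) (by linarith [hx.2, hy.1])
        (by linarith)
    rw [pow_zero, one_mul]
    have h3 := Real.exp_pos (corr φ (pairVol ε) (x :: y :: l))
    calc Real.exp (corr φ (pairVol ε) (x :: y :: l))
        ≤ Real.exp (N * (1 - x)) * Real.exp (corr φ (pairVol ε) (x :: y :: l)) :=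
          le_mul_of_one_le_left h3.le h1
      _ ≤ _ := le_mul_of_one_le_right (by positivity) h2
  | succ n ih =>
    have hyx : y < x := (List.pairwise_cons.1 hl.1).1 y List.mem_cons_self
    have hx := hl.2 x List.mem_cons_self
    set A : ℝ := (4 / η * N ^ (-(1 - γ))) ^ n * N ^ (-(1 - γ)) * Real.exp (N * (1 - x))
      * Real.exp (corr φ (pairVol ε) (x :: y :: l)) with hA
    have hA0 : 0 ≤ A := by positivity
    have hpt : ∀ w ∈ Ioo x 1, orderedMoment P Λ ε n (w :: x :: y :: l)
        ≤ ENNReal.ofReal A * ENNReal.ofReal ((w - x) ^ (-1 + η / 2)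
          * (w - x + (x - y)) ^ (-η)) := by
      intro w hw
      have hwx : 0 < w - x := sub_pos.2 hw.1
      refine (ih (hl.cons (x := w) hw)).trans ?_
      rw [← ENNReal.ofReal_mul hA0]
      refine ENNReal.ofReal_le_ofReal ?_
      have h1 := exp_rowSum_le hnn hγ hε hw.2.le hw.1 hl
      rw [← hη] at h1
      have h2 := rpow_le_exp (mul_pos hN hwx) (sub_nonneg.2 hγ1) (by linarith : 1 - γ ≤ 1)
      have h3 : Real.exp (N * (1 - w))
          ≤ N ^ (-(1 - γ)) * (w - x) ^ (-(1 - γ)) * Real.exp (N * (1 - x)) := by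
        rw [← Real.mul_rpow hN.le hwx.le, Real.rpow_neg (by positivity)]
        have h4 : Real.exp (N * (1 - x)) = Real.exp (N * (1 - w)) * Real.exp (N * (w - x)) := by
          rw [← Real.exp_add]; congr 1; ring
        have h5 : 0 < (N * (w - x)) ^ (1 - γ) := by positivity
        rw [h4, ← mul_assoc, mul_comm _ (Real.exp (N * (1 - w))), mul_assoc]
        refine le_mul_of_one_le_right (Real.exp_pos _).le ?_
        rw [inv_mul_eq_div, one_le_div h5]
        exact h2
      have h6 : w - x + (x - y) = w - y := by ring
      have h7 : (w - x) ^ (-1 + η / 2)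
          = (w - x) ^ (-(1 - γ)) * (w - x) ^ (-secDiff φ 0) * (w - x) ^ (-(η / 2)) := by
        rw [← Real.rpow_add hwx, ← Real.rpow_add hwx]
        congr 1
        rw [hη]; ring
      rw [h6, h7, hA, corr, Real.exp_add]
      have h8 : 0 ≤ (w - x) ^ (-(η / 2)) := by positivity
      calc _ ≤ (4 / η * N ^ (-(1 - γ))) ^ n
            * (N ^ (-(1 - γ)) * (w - x) ^ (-(1 - γ)) * Real.exp (N * (1 - x)))
            * (Real.exp (corr φ (pairVol ε) (x :: y :: l))
              * ((w - x) ^ (-secDiff φ 0) * (w - y) ^ (-η))) * (w - x) ^ (-(η / 2)) := by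
            gcongr
        _ = _ := by ring
    rw [orderedMoment, List.headD_cons]
    calc _ ≤ ∫⁻ w in Ioo x 1, ENNReal.ofReal A * ENNReal.ofReal ((w - x) ^ (-1 + η / 2)
          * (w - x + (x - y)) ^ (-η)) := setLIntegral_mono' measurableSet_Ioo hpt
      _ ≤ ∫⁻ w in Ioi x, ENNReal.ofReal A * ENNReal.ofReal ((w - x) ^ (-1 + η / 2)
          * (w - x + (x - y)) ^ (-η)) := lintegral_mono_set Ioo_subset_Ioi_self
      _ ≤ ENNReal.ofReal A * ENNReal.ofReal (4 / η * (x - y) ^ (-(η / 2))) := by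
          rw [lintegral_const_mul' _ _ ENNReal.ofReal_ne_top, lintegral_Ioi_comp_sub
            (fun u => ENNReal.ofReal (u ^ (-1 + η / 2) * (u + (x - y)) ^ (-η)))]
          gcongr
          exact lintegral_kernel_le hη0 (sub_pos.2 hyx)
      _ = _ := by
          rw [← ENNReal.ofReal_mul hA0, hA]
          congr 1
          rw [pow_succ]
          ring

/-- Upper bound for the moments, uniform in the truncation. -/
lemma lintegral_mass_trunc_pow_le [SFinite P] (hμ : IsCascadeLimit P Λ 0 1 X M μ)
    (hΛ : IsIndepScattered P ψ volume Λ) {φ : ℕ → ℝ} (hφ : IsMomentSeq P Λ φ)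
    (hnn : ∀ k, 0 ≤ secDiff φ k) {γ : ℝ} (hγ : ∀ m, ∑ k ∈ Finset.range m, secDiff φ k ≤ γ)
    (hγ1 : γ ≤ 1) {η : ℝ} (hη : η = γ - secDiff φ 0) (hη0 : 0 < η) {N : ℝ} (hN : 0 < N) {ε : ℝ}
    (hε : 0 < ε) (n : ℕ) :
    ∫⁻ ω, ((M ε ω).mass : ℝ≥0∞) ^ (n + 2) ∂P ≤ ENNReal.ofReal ((n + 2).factorial
      * ((4 / η * N ^ (-(1 - γ))) ^ n * Real.exp N * (2 / η))) := by
  have hη2 : 0 < η / 2 := by positivity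
  rw [hμ.lintegral_mass_trunc_pow hΛ hε, ENNReal.ofReal_mul (by positivity),
    ENNReal.ofReal_natCast]
  gcongr
  set A : ℝ := (4 / η * N ^ (-(1 - γ))) ^ n * Real.exp N with hA
  have hA0 : 0 ≤ A := by positivity
  have hnil : IsOrdered [] := ⟨List.Pairwise.nil, by simp⟩
  have hin : ∀ x ∈ Ioo (0 : ℝ) 1, orderedMoment P Λ ε (n + 1) [x]
      ≤ ENNReal.ofReal (A * (2 / η)) := by
    intro x hx
    have hlx : IsOrdered [x] := hnil.cons hx
    have hpt : ∀ w ∈ Ioo x 1, orderedMoment P Λ ε n [w, x]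
        ≤ ENNReal.ofReal A * ENNReal.ofReal ((w - x) ^ (-1 + η / 2)) := by
      intro w hw
      have hwx : 0 < w - x := sub_pos.2 hw.1
      refine (hμ.orderedMoment_le hΛ hφ hnn hγ hγ1 hη hη0 hN hε n (hlx.cons (x := w) hw)).trans ?_
      rw [← ENNReal.ofReal_mul hA0]
      refine ENNReal.ofReal_le_ofReal ?_
      have h1 : Real.exp (corr φ (pairVol ε) [w, x]) ≤ (w - x) ^ (-secDiff φ 0) := by
        rw [Real.rpow_def_of_pos hwx]
        refine Real.exp_le_exp.2 ?_
        simp only [corr, rowSum, add_zero, zero_add]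
        have h4 := mul_le_mul_of_nonneg_left (pairVol_le hε hx.1.le hw.1 hw.2.le) (hnn 0)
        rw [one_div, Real.log_inv] at h4
        linarith
      have h2 : Real.exp (N * (1 - w)) ≤ Real.exp N :=
        Real.exp_le_exp.2 (by nlinarith [hx.1, hw.1])
      have h3 : (w - x) ^ (-secDiff φ 0) * (w - x) ^ (-(η / 2)) ≤ (w - x) ^ (-1 + η / 2) := by
        rw [← Real.rpow_add hwx]
        refine Real.rpow_le_rpow_of_exponent_ge hwx (by linarith [hx.1, hw.2]) ?_
        rw [hη]; linarith
      calc _ ≤ (4 / η * N ^ (-(1 - γ))) ^ n * Real.exp N * (w - x) ^ (-secDiff φ 0)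
            * (w - x) ^ (-(η / 2)) := by gcongr
        _ = A * ((w - x) ^ (-secDiff φ 0) * (w - x) ^ (-(η / 2))) := by rw [hA]; ring
        _ ≤ _ := by gcongr
    rw [orderedMoment, List.headD_cons]
    calc _ ≤ ∫⁻ w in Ioo x 1, ENNReal.ofReal A * ENNReal.ofReal ((w - x) ^ (-1 + η / 2)) :=
          setLIntegral_mono' measurableSet_Ioo hpt
      _ ≤ ∫⁻ w in Ioi x, ENNReal.ofReal A
            * (Ioc 0 1).indicator (fun u => ENNReal.ofReal (u ^ (-1 + η / 2))) (w - x) := by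
          refine (setLIntegral_mono' measurableSet_Ioo fun w hw => ?_).trans
            (lintegral_mono_set Ioo_subset_Ioi_self)
          rw [Set.indicator_of_mem]
          exact ⟨sub_pos.2 hw.1, by linarith [hx.1, hw.2]⟩
      _ = ENNReal.ofReal (A * (2 / η)) := by
          rw [lintegral_const_mul' _ _ ENNReal.ofReal_ne_top, lintegral_Ioi_comp_sub,
            setLIntegral_indicator measurableSet_Ioc, inter_eq_left.2 Ioc_subset_Ioi_self,
            lintegral_Ioc_rpow hη2 one_pos, ← ENNReal.ofReal_mul hA0, Real.one_rpow]
          congr 2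
          field_simp
  rw [orderedMoment, List.headD_nil]
  calc _ ≤ ∫⁻ x in Ioo (0 : ℝ) 1, ENNReal.ofReal (A * (2 / η)) :=
        setLIntegral_mono' measurableSet_Ioo hin
    _ = _ := by simp

end IsCascadeLimit

end

section

/-! ### Lower bound for the moments -/

/-- Every second interval of the subdivision of `[0, 1]` into `2n` intervals of equal length. -/
def box (n j : ℕ) : Set ℝ := Ioo (2 * j / (2 * n)) ((2 * j + 1) / (2 * n))

/-- The `j`-th entry of the list, counted from the end, lies in the `j`-th box. -/
def InBoxes (n : ℕ) : List ℝ → Prop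
  | [] => True
  | x :: l => x ∈ box n l.length ∧ InBoxes n l

lemma box_subset {n j : ℕ} (hj : j < n) : box n j ⊆ Ioo 0 1 := by
  have hn : (0 : ℝ) < n := by exact_mod_cast (Nat.zero_le j).trans_lt hj
  intro x hx
  refine ⟨lt_of_le_of_lt (by positivity) hx.1, hx.2.trans_le ?_⟩
  rw [div_le_one (by positivity)]
  have : (j : ℝ) + 1 ≤ n := by exact_mod_cast hj
  linarith

lemma sub_mem_of_box {n i d : ℕ} (hn : 0 < n) {x y : ℝ} (hx : x ∈ box n (i + d + 1))
    (hy : y ∈ box n i) : 1 / (2 * n : ℝ) ≤ x - y ∧ x - y ≤ (d + 2) / n := by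
  have hn' : (0 : ℝ) < n := by exact_mod_cast hn
  have h1 := hx.1
  have h2 := hx.2
  have h3 := hy.1
  have h4 := hy.2
  push_cast at h1 h2
  constructor
  · have : 1 / (2 * n : ℝ) ≤ 2 * (i + d + 1) / (2 * n) - (2 * i + 1) / (2 * n) := by
      rw [← sub_div]
      gcongr
      have : (0 : ℝ) ≤ d := by positivity
      linarith
    linarith
  · have : (2 * (i + d + 1 : ℝ) + 1) / (2 * n) - 2 * i / (2 * n) ≤ (d + 2) / n := by
      rw [← sub_div, div_le_div_iff₀ (by positivity) hn']
      have : (0 : ℝ) ≤ d := by positivity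
      nlinarith
    linarith

lemma pairVol_eq {ε x y : ℝ} (hε : 0 < ε) (hy : 0 ≤ y) (hyx : ε ≤ x - y) (hx : x ≤ 1) :
    pairVol ε x y = Real.log (1 / (x - y)) := by
  rw [pairVol, inter_comm, volume_truncCone_inter hε hy (by linarith) hx hyx,
    ENNReal.toReal_ofReal (Real.log_nonneg ?_)]
  rw [le_div_iff₀ (hε.trans_le hyx)]
  linarith

lemma pairVol_nonneg (ε x y : ℝ) : 0 ≤ pairVol ε x y := ENNReal.toReal_nonneg

lemma rowSum_nonneg {φ : ℕ → ℝ} (hφ : ∀ k, 0 ≤ secDiff φ k) (ε x : ℝ) (l : List ℝ) (k : ℕ) :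
    0 ≤ rowSum φ (pairVol ε) k x l := by
  induction l generalizing k with
  | nil => exact le_rfl
  | cons y l ih => exact add_nonneg (mul_nonneg (hφ k) (pairVol_nonneg ε x y)) (ih _)

/-- If the points lie in boxes, a new point has distance at most `(R + 1) / n` to the preceding `R`
points. -/
lemma le_rowSum {φ : ℕ → ℝ} (hφ : ∀ k, 0 ≤ secDiff φ k) {n R : ℕ} {ε x : ℝ} (hε : 0 < ε)
    (hεn : ε ≤ 1 / (2 * n)) {l : List ℝ} {k : ℕ} (hx : x ∈ box n (k + l.length))
    (hn : k + l.length < n) (hl : InBoxes n l) (hR : R ≤ k + l.length) :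
    (∑ i ∈ Finset.Ico k R, secDiff φ i) * Real.log (n / (R + 1))
      ≤ rowSum φ (pairVol ε) k x l := by
  induction l generalizing k with
  | nil =>
    rw [Finset.Ico_eq_empty (by simpa using hR)]
    simp [rowSum]
  | cons y l ih =>
    rw [List.length_cons] at hx hn hR
    rw [rowSum]
    rcases lt_or_ge k R with hk | hk
    · have h1 := ih (k := k + 1) (by convert hx using 2; ring) (by omega) hl.2 (by omega)
      rw [Finset.sum_eq_sum_Ico_succ_bot hk, add_mul]
      refine add_le_add (mul_le_mul_of_nonneg_left ?_ (hφ k)) h1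
      have hy := hl.1
      have hx1 := box_subset (by omega) hx
      have hy1 := box_subset (by omega) hy
      have hn0 : (0 : ℝ) < n := by exact_mod_cast (show 0 < n by omega)
      have h2 := sub_mem_of_box (d := k) (by omega) (x := x) (y := y)
        (by convert hx using 2; ring) hy
      rw [pairVol_eq hε hy1.1.le (hεn.trans h2.1) hx1.2.le]
      have h3 : 0 < x - y := lt_of_lt_of_le (by positivity) h2.1
      refine Real.log_le_log (by positivity) ?_
      rw [div_le_div_iff₀ (by positivity) h3, one_mul]
      have h4 : (k : ℝ) + 2 ≤ R + 1 := by exact_mod_cast (show k + 2 ≤ R + 1 by omega)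
      calc (n : ℝ) * (x - y) ≤ n * ((k + 2) / n) := by gcongr; exact h2.2
        _ = k + 2 := by field_simp
        _ ≤ _ := h4
    · rw [Finset.Ico_eq_empty (by omega), Finset.sum_empty, zero_mul]
      exact add_nonneg (mul_nonneg (hφ k) (pairVol_nonneg ε x y)) (rowSum_nonneg hφ _ _ _ _)

lemma volume_box (n j : ℕ) :
    volume (box n j) = ENNReal.ofReal (1 / (2 * n)) := by
  rw [box, Real.volume_Ioo, ← sub_div]
  congr 2
  ring

variable {Ω : Type*} [MeasurableSpace Ω] {P : Measure Ω} {ψ : ℝ → ℂ} {Λ : Set ℍ → Ω → ℝ}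

namespace IsCascadeLimit

variable {X : ℝ → ℝ → Ω → ℝ} {M : ℝ → Ω → FiniteMeasure ℝ} {μ : Ω → FiniteMeasure ℝ}

/-- Lower bound obtained by restricting the remaining points to their boxes. -/
lemma le_orderedMoment (hμ : IsCascadeLimit P Λ 0 1 X M μ)
    (hΛ : IsIndepScattered P ψ volume Λ) {φ : ℕ → ℝ} (hφ : IsMomentSeq P Λ φ)
    (hnn : ∀ k, 0 ≤ secDiff φ k) {n R : ℕ} {ε : ℝ} (hε : 0 < ε)
    (hεn : ε ≤ 1 / (2 * n)) (m : ℕ) {l : List ℝ} (hlen : m + l.length = n)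
    (hl : IsOrdered l) (hb : InBoxes n l) :
    ENNReal.ofReal ((1 / (2 * n)) ^ m * Real.exp ((∑ i ∈ Finset.range R, secDiff φ i)
        * Real.log (n / (R + 1))) ^ min m (n - R) * Real.exp (corr φ (pairVol ε) l))
      ≤ orderedMoment P Λ ε m l := by
  set E := Real.exp ((∑ i ∈ Finset.range R, secDiff φ i) * Real.log (n / (R + 1))) with hE
  induction m generalizing l with
  | zero => simp [hμ.orderedMoment_zero hΛ hφ hε hl]
  | succ m ih =>
    have hn : 0 < n := by omega
    have hn' : (0 : ℝ) < n := by exact_mod_cast hn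
    have hsub : box n l.length ⊆ Ioo (l.headD 0) 1 := by
      intro x hx
      refine ⟨?_, (box_subset (by omega) hx).2⟩
      cases l with
      | nil => exact (box_subset (by omega) hx).1
      | cons y l =>
        refine (hb.1.2.trans_le ?_).trans hx.1
        rw [List.length_cons]
        push_cast
        gcongr
        linarith
    have hpt : ∀ x ∈ box n l.length, ENNReal.ofReal ((1 / (2 * n)) ^ m * E ^ min (m + 1) (n - R)
        * Real.exp (corr φ (pairVol ε) l)) ≤ orderedMoment P Λ ε m (x :: l) := by
      intro x hx
      refine le_trans (ENNReal.ofReal_le_ofReal ?_) (ih (l := x :: l)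
        (by rw [List.length_cons]; omega) (hl.cons (hsub hx)) ⟨hx, hb⟩)
      rw [corr, Real.exp_add]
      have hstep : E ^ min (m + 1) (n - R)
          ≤ E ^ min m (n - R) * Real.exp (rowSum φ (pairVol ε) 0 x l) := by
        rcases le_or_gt (m + 1) (n - R) with h | h
        · rw [min_eq_left h, min_eq_left (by omega), pow_succ]
          have h1 := le_rowSum hnn (R := R) (k := 0) hε hεn (by rwa [zero_add]) (by omega) hb
            (by omega)
          rw [Nat.Ico_zero_eq_range] at h1
          gcongr
          exact Real.exp_le_exp.2 h1
        · rw [min_eq_right h.le, min_eq_right (by omega)]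
          exact le_mul_of_one_le_right (by positivity)
            (Real.one_le_exp (rowSum_nonneg hnn _ _ _ _))
      calc _ ≤ (1 / (2 * n : ℝ)) ^ m * (E ^ min m (n - R)
            * Real.exp (rowSum φ (pairVol ε) 0 x l)) * Real.exp (corr φ (pairVol ε) l) := by
            gcongr
        _ = _ := by ring
    rw [orderedMoment]
    calc _ = ∫⁻ _ in box n l.length, ENNReal.ofReal ((1 / (2 * n)) ^ m
          * E ^ min (m + 1) (n - R) * Real.exp (corr φ (pairVol ε) l)) := by
          rw [setLIntegral_const, volume_box, ← ENNReal.ofReal_mul (by positivity)]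
          congr 1
          rw [pow_succ]
          ring
      _ ≤ ∫⁻ x in box n l.length, orderedMoment P Λ ε m (x :: l) :=
          setLIntegral_mono' measurableSet_Ioo hpt
      _ ≤ _ := lintegral_mono_set hsub

/-- Lower bound for the moments, uniform in the truncation. -/
lemma le_lintegral_mass_trunc_pow [SFinite P] (hμ : IsCascadeLimit P Λ 0 1 X M μ)
    (hΛ : IsIndepScattered P ψ volume Λ) {φ : ℕ → ℝ} (hφ : IsMomentSeq P Λ φ)
    (hnn : ∀ k, 0 ≤ secDiff φ k) (n R : ℕ) {ε : ℝ} (hε : 0 < ε) (hεn : ε ≤ 1 / (2 * n)) :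
    ENNReal.ofReal (n.factorial * ((1 / (2 * n)) ^ n
        * Real.exp ((∑ i ∈ Finset.range R, secDiff φ i) * Real.log (n / (R + 1))) ^ (n - R)))
      ≤ ∫⁻ ω, ((M ε ω).mass : ℝ≥0∞) ^ n ∂P := by
  rw [hμ.lintegral_mass_trunc_pow hΛ hε, ENNReal.ofReal_mul (by positivity),
    ENNReal.ofReal_natCast]
  gcongr
  have h1 := hμ.le_orderedMoment hΛ hφ hnn (R := R) hε hεn n (l := []) (by simp)
    ⟨List.Pairwise.nil, by simp⟩ trivial
  simpa [corr] using h1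

/-! ### Passing to the limit -/

/-- Moment bounds for the truncated cascades pass to the limit, the next moment giving uniform
integrability. -/
lemma le_lintegral_mass_pow [IsFiniteMeasure P] (hμ : IsCascadeLimit P Λ 0 1 X M μ)
    (hΛ : IsIndepScattered P ψ volume Λ) {n : ℕ} {ε₀ : ℝ} (hε₀ : 0 < ε₀) {b C : ℝ≥0∞} (hC : C ≠ ⊤)
    (hb : ∀ ε, 0 < ε → ε ≤ ε₀ → b ≤ ∫⁻ ω, ((M ε ω).mass : ℝ≥0∞) ^ n ∂P)
    (hub : ∀ ε, 0 < ε → ε ≤ ε₀ → ∫⁻ ω, ((M ε ω).mass : ℝ≥0∞) ^ (n + 1) ∂P ≤ C) :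
    b ≤ ∫⁻ ω, ((μ ω).mass : ℝ≥0∞) ^ n ∂P := by
  -- `1 / u k ≤ ε₀` for all `k`
  let u : ℕ → ℝ := fun k => (k : ℝ) + 1 / ε₀
  have hu : Tendsto u atTop atTop :=
    tendsto_atTop_add_const_right _ _ tendsto_natCast_atTop_atTop
  have hu0 : ∀ k, 0 < 1 / u k := fun k => by simp only [u]; positivity
  have huε : ∀ k, 1 / u k ≤ ε₀ := fun k => by
    rw [one_div_le (by simp only [u]; positivity) hε₀]
    simp only [u]
    linarith [(Nat.cast_nonneg k : (0 : ℝ) ≤ k)]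
  -- truncation at level `K`: above it, `z^n` is at most `z^{n+1} / K`
  have hsplit : ∀ K : ℕ, 0 < K → ∀ z : ℝ≥0∞, z ^ n ≤ min z K ^ n + z ^ (n + 1) * (K : ℝ≥0∞)⁻¹ := by
    intro K hK z
    rcases le_total z K with h | h
    · rw [min_eq_left h]; exact le_self_add
    · refine le_trans ?_ le_add_self
      rw [pow_succ, mul_assoc, ← div_eq_mul_inv]
      refine le_mul_of_one_le_right (zero_le) ?_
      rw [ENNReal.le_div_iff_mul_le (by simp [hK.ne']) (by simp), one_mul]
      exact h
  have hK : ∀ K : ℕ, 0 < K → b ≤ ∫⁻ ω, ((μ ω).mass : ℝ≥0∞) ^ n ∂P + C * (K : ℝ≥0∞)⁻¹ := by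
    intro K hK
    have hmeas : ∀ k, AEMeasurable (fun ω => min ((M (1 / u k) ω).mass : ℝ≥0∞) K ^ n) P := fun k =>
      ((hμ.aemeasurable_mass_trunc hΛ (hu0 k)).min aemeasurable_const).pow_const n
    have hlim : Tendsto (fun k => ∫⁻ ω, min ((M (1 / u k) ω).mass : ℝ≥0∞) K ^ n ∂P) atTop
        (𝓝 (∫⁻ ω, min ((μ ω).mass : ℝ≥0∞) K ^ n ∂P)) := by
      refine tendsto_lintegral_of_dominated_convergence' (fun _ => (K : ℝ≥0∞) ^ n) hmeas
        (fun k => ae_of_all _ fun ω => pow_le_pow_left' (min_le_right _ _) n) ?_ ?_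
      · rw [lintegral_const]
        exact ENNReal.mul_ne_top (ENNReal.pow_ne_top (by simp)) (measure_ne_top _ _)
      · filter_upwards [hμ.tendsto_mass hu] with ω hω
        have hc : Continuous fun z : ℝ≥0∞ => min z K ^ n :=
          (ENNReal.continuous_pow n).comp (continuous_id.min continuous_const)
        exact (hc.tendsto _).comp hω
    have hle : ∀ k, b ≤ ∫⁻ ω, min ((M (1 / u k) ω).mass : ℝ≥0∞) K ^ n ∂P + C * (K : ℝ≥0∞)⁻¹ := by
      intro k
      refine (hb _ (hu0 k) (huε k)).trans ?_
      refine (lintegral_mono fun ω => hsplit K hK _).trans ?_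
      rw [lintegral_add_left' (hmeas k), lintegral_mul_const' _ _ (by simp [hK.ne'])]
      gcongr
      exact hub _ (hu0 k) (huε k)
    refine (ge_of_tendsto' (hlim.add_const _) hle).trans ?_
    gcongr
    exact min_le_left _ _
  have hlim : Tendsto (fun K : ℕ => ∫⁻ ω, ((μ ω).mass : ℝ≥0∞) ^ n ∂P + C * (K : ℝ≥0∞)⁻¹) atTop
      (𝓝 (∫⁻ ω, ((μ ω).mass : ℝ≥0∞) ^ n ∂P + C * 0)) :=
    tendsto_const_nhds.add (ENNReal.Tendsto.const_mul
      ENNReal.tendsto_inv_nat_nhds_zero (Or.inr hC))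
  rw [mul_zero, add_zero] at hlim
  refine ge_of_tendsto hlim ?_
  filter_upwards [eventually_gt_atTop 0] with K hK0 using hK K hK0

lemma lintegral_mass_pow_le (hμ : IsCascadeLimit P Λ 0 1 X M μ)
    (hΛ : IsIndepScattered P ψ volume Λ) {n : ℕ} {C : ℝ≥0∞}
    (hub : ∀ ε, 0 < ε → ∫⁻ ω, ((M ε ω).mass : ℝ≥0∞) ^ n ∂P ≤ C) :
    ∫⁻ ω, ((μ ω).mass : ℝ≥0∞) ^ n ∂P ≤ C := by
  have hu1 : Tendsto (fun n : ℕ => (n : ℝ) + 1) atTop atTop :=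
    tendsto_atTop_add_const_right _ _ tendsto_natCast_atTop_atTop
  have hpos : ∀ n : ℕ, (0 : ℝ) < 1 / ((n : ℝ) + 1) := fun n => by positivity
  refine lintegral_le_of_tendsto_ae
    (fun k => (hμ.aemeasurable_mass_trunc hΛ (hpos k)).pow_const n) ?_ (fun k => hub _ (hpos k))
    tendsto_const_nhds
  filter_upwards [hμ.tendsto_mass hu1] with ω hω
  exact ((ENNReal.continuous_pow n).tendsto _).comp hω

end IsCascadeLimit

end

section

/-! ### Growth of the moments -/

lemma log_factorial_le (n : ℕ) : Real.log n.factorial ≤ n * Real.log n := by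
  rw [← Real.log_pow]
  exact Real.log_le_log (by positivity) (by exact_mod_cast Nat.factorial_le_pow n)

lemma le_log_factorial {n : ℕ} (hn : 0 < n) : n * Real.log n - n ≤ Real.log n.factorial := by
  have hn' : (0 : ℝ) < n := by exact_mod_cast hn
  have h1 : (n : ℝ) ^ n / n.factorial ≤ Real.exp n := Real.pow_div_factorial_le_exp n hn'.le n
  have h2 := Real.log_le_log (by positivity) h1
  rw [Real.log_exp, Real.log_div (by positivity) (by positivity), Real.log_pow] at h2
  linarith

lemma tendsto_inv_log : Tendsto (fun n : ℕ => (Real.log n)⁻¹) atTop (𝓝 0) :=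
  (Real.tendsto_log_atTop.comp tendsto_natCast_atTop_atTop).inv_tendsto_atTop

lemma tendsto_inv_nat : Tendsto (fun n : ℕ => ((n : ℝ))⁻¹) atTop (𝓝 0) :=
  tendsto_inv_atTop_nhds_zero_nat

/-- The growth rate of a sequence squeezed between the two kinds of moment bounds. -/
lemma tendsto_div_mul_log {a : ℕ → ℝ} {γ c : ℝ} {s : ℕ → ℝ} (hs : Tendsto s atTop (𝓝 γ))
    (hub : ∀ n : ℕ, 2 ≤ n → a n ≤ γ * n * Real.log n + 2 * (1 - γ) * Real.log n + c * n)
    (hlb : ∀ R n : ℕ, R < n → -n - n * Real.log 2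
      + s R * ((n - R) * (Real.log n - Real.log (R + 1))) ≤ a n) :
    Tendsto (fun n : ℕ => a n / (n * Real.log n)) atTop (𝓝 γ) := by
  refine tendsto_order.2 ⟨fun b hb => ?_, fun b hb => ?_⟩
  · obtain ⟨R, hR⟩ := (hs.eventually_const_lt hb).exists
    have h1 : Tendsto (fun n : ℕ => -(1 + Real.log 2) * (Real.log n)⁻¹
        + s R * ((1 - R * (n : ℝ)⁻¹) * (1 - Real.log (R + 1) * (Real.log n)⁻¹))) atTop
        (𝓝 (-(1 + Real.log 2) * 0 + s R * ((1 - R * 0) * (1 - Real.log (R + 1) * 0)))) :=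
      (tendsto_inv_log.const_mul _).add (((tendsto_const_nhds.sub
        (tendsto_inv_nat.const_mul _)).mul (tendsto_const_nhds.sub
          (tendsto_inv_log.const_mul _))).const_mul _)
    rw [show -(1 + Real.log 2) * 0 + s R * ((1 - R * 0) * (1 - Real.log (R + 1) * 0)) = s R by
      ring] at h1
    filter_upwards [h1.eventually_const_lt hR, eventually_gt_atTop R, eventually_ge_atTop 2]
      with n hn hRn hn2
    refine hn.trans_le ?_
    have hn0 : (0 : ℝ) < n := by positivity
    have hlog : 0 < Real.log n := Real.log_pos (by exact_mod_cast hn2)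
    rw [le_div_iff₀ (by positivity)]
    refine le_trans (le_of_eq ?_) (hlb R n hRn)
    field_simp
    ring
  · have h1 : Tendsto (fun n : ℕ => γ + 2 * (1 - γ) * (n : ℝ)⁻¹ + c * (Real.log n)⁻¹) atTop
        (𝓝 (γ + 2 * (1 - γ) * 0 + c * 0)) :=
      (tendsto_const_nhds.add (tendsto_inv_nat.const_mul _)).add (tendsto_inv_log.const_mul _)
    rw [show γ + 2 * (1 - γ) * 0 + c * 0 = γ by ring] at h1
    filter_upwards [h1.eventually_lt_const hb, eventually_ge_atTop 2] with n hn hn2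
    refine lt_of_le_of_lt ?_ hn
    have hn0 : (0 : ℝ) < n := by positivity
    have hlog : 0 < Real.log n := Real.log_pos (by exact_mod_cast hn2)
    rw [div_le_iff₀ (by positivity)]
    refine (hub n hn2).trans (le_of_eq ?_)
    field_simp

lemma tendsto_log_floor_div_log :
    Tendsto (fun q : ℝ => Real.log ⌊q⌋₊ / Real.log q) atTop (𝓝 1) ∧
      Tendsto (fun q : ℝ => Real.log (⌊q⌋₊ + 1 : ℕ) / Real.log q) atTop (𝓝 1) := by
  have hinv : Tendsto (fun q : ℝ => (Real.log q)⁻¹) atTop (𝓝 0) :=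
    Real.tendsto_log_atTop.inv_tendsto_atTop
  have h1 : Tendsto (fun q : ℝ => 1 - Real.log 2 * (Real.log q)⁻¹) atTop
      (𝓝 (1 - Real.log 2 * 0)) := tendsto_const_nhds.sub (hinv.const_mul _)
  have h2 : Tendsto (fun q : ℝ => 1 + Real.log 2 * (Real.log q)⁻¹) atTop
      (𝓝 (1 + Real.log 2 * 0)) := tendsto_const_nhds.add (hinv.const_mul _)
  rw [mul_zero, sub_zero] at h1
  rw [mul_zero, add_zero] at h2
  constructor
  · refine tendsto_of_tendsto_of_tendsto_of_le_of_le' h1 tendsto_const_nhds ?_ ?_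
    · filter_upwards [eventually_ge_atTop (2 : ℝ)] with q hq
      have hlog : 0 < Real.log q := Real.log_pos (by linarith)
      rw [le_div_iff₀ hlog, sub_mul, one_mul, mul_assoc, inv_mul_cancel₀ hlog.ne', mul_one,
        ← Real.log_div (by positivity) two_ne_zero]
      refine Real.log_le_log (by positivity) ?_
      have := Nat.lt_floor_add_one q
      linarith
    · filter_upwards [eventually_ge_atTop (2 : ℝ)] with q hq
      have hlog : 0 < Real.log q := Real.log_pos (by linarith)
      rw [div_le_one hlog]
      have : 0 < ⌊q⌋₊ := Nat.floor_pos.2 (by linarith)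
      exact Real.log_le_log (by exact_mod_cast this) (Nat.floor_le (by linarith))
  · refine tendsto_of_tendsto_of_tendsto_of_le_of_le' tendsto_const_nhds h2 ?_ ?_
    · filter_upwards [eventually_ge_atTop (2 : ℝ)] with q hq
      have hlog : 0 < Real.log q := Real.log_pos (by linarith)
      rw [one_le_div hlog]
      refine Real.log_le_log (by positivity) ?_
      push_cast
      exact (Nat.lt_floor_add_one q).le
    · filter_upwards [eventually_ge_atTop (2 : ℝ)] with q hq
      have hlog : 0 < Real.log q := Real.log_pos (by linarith)
      rw [div_le_iff₀ hlog, add_mul, one_mul, mul_assoc, inv_mul_cancel₀ hlog.ne', mul_one,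
        add_comm (Real.log q), ← Real.log_mul two_ne_zero (by positivity)]
      refine Real.log_le_log (by positivity) ?_
      push_cast
      have := Nat.floor_le (show 0 ≤ q by linarith)
      linarith

variable {Ω : Type*} [MeasurableSpace Ω] {P : Measure Ω} {Λ : Set ℍ → Ω → ℝ}
  {X : ℝ → ℝ → Ω → ℝ} {M : ℝ → Ω → FiniteMeasure ℝ} {μ : Ω → FiniteMeasure ℝ}

lemma massMoment_natCast (n : ℕ) :
    massMoment P μ n = ∫⁻ ω, ((μ ω).mass : ℝ≥0∞) ^ n ∂P := by
  simp only [massMoment, ENNReal.rpow_natCast]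

/-- Monotonicity of the `L^q` norms of `Z`. -/
lemma massMoment_rpow_le [IsProbabilityMeasure P]
    (hm : AEMeasurable (fun ω => ((μ ω).mass : ℝ≥0∞)) P) {p q : ℝ} (hp : 0 < p) (hpq : p ≤ q) :
    massMoment P μ p ^ (1 / p) ≤ massMoment P μ q ^ (1 / q) := by
  have := eLpNorm'_le_eLpNorm'_of_exponent_le hp hpq P hm.aestronglyMeasurable
  simpa only [eLpNorm', enorm_eq_self, massMoment] using this

lemma massMoment_pos_of_le [IsProbabilityMeasure P]
    (hm : AEMeasurable (fun ω => ((μ ω).mass : ℝ≥0∞)) P) {p q : ℝ} (hp : 0 < p) (hpq : p ≤ q)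
    (h0 : 0 < massMoment P μ p) : 0 < massMoment P μ q := by
  have h1 := massMoment_rpow_le hm hp hpq
  have hq : 0 < q := hp.trans_le hpq
  by_contra! h2
  rw [nonpos_iff_eq_zero] at h2
  rw [h2, ENNReal.zero_rpow_of_pos (by positivity), nonpos_iff_eq_zero,
    ENNReal.rpow_eq_zero_iff_of_pos (by positivity)] at h1
  exact h0.ne' h1

/-- `q ↦ log E(Z^q) / q` is monotone. -/
lemma log_massMoment_div_le [IsProbabilityMeasure P]
    (hm : AEMeasurable (fun ω => ((μ ω).mass : ℝ≥0∞)) P) {p q : ℝ} (hp : 0 < p) (hpq : p ≤ q)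
    (h0 : 0 < massMoment P μ p) (hq : massMoment P μ q < ⊤) :
    Real.log (massMoment P μ p).toReal / p ≤ Real.log (massMoment P μ q).toReal / q := by
  have hq0 : 0 < q := hp.trans_le hpq
  have h1 := massMoment_rpow_le hm hp hpq
  have h2 : massMoment P μ q ^ (1 / q) < ⊤ := ENNReal.rpow_lt_top_of_nonneg (by positivity) hq.ne
  have hp' : massMoment P μ p < ⊤ :=
    (ENNReal.rpow_lt_top_iff_of_pos (by positivity)).1 (h1.trans_lt h2)
  have h3 := ENNReal.toReal_mono h2.ne h1
  rw [← ENNReal.toReal_rpow, ← ENNReal.toReal_rpow] at h3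
  have h4 : 0 < (massMoment P μ p).toReal := ENNReal.toReal_pos h0.ne' hp'.ne
  have h5 : 0 < (massMoment P μ q).toReal :=
    ENNReal.toReal_pos (massMoment_pos_of_le hm hp hpq h0).ne' hq.ne
  have h6 := Real.log_le_log (by positivity) h3
  rw [Real.log_rpow h4, Real.log_rpow h5] at h6
  rw [div_eq_inv_mul, div_eq_inv_mul]
  simpa only [one_div] using h6

/-- The growth rate along the integers determines the growth rate along the reals. -/
lemma tendsto_log_massMoment [IsProbabilityMeasure P]
    (hm : AEMeasurable (fun ω => ((μ ω).mass : ℝ≥0∞)) P) {γ : ℝ}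
    (hpos : ∀ n : ℕ, 0 < n → 0 < massMoment P μ n)
    (hfin : ∀ q : ℝ, 1 < q → massMoment P μ q < ⊤)
    (hlim : Tendsto (fun n : ℕ => Real.log (massMoment P μ n).toReal / (n * Real.log n)) atTop
      (𝓝 γ)) :
    Tendsto (fun q : ℝ => Real.log (massMoment P μ q).toReal / (q * Real.log q)) atTop (𝓝 γ) := by
  have hf := tendsto_nat_floor_atTop (α := ℝ)
  have h1 := (hlim.comp hf).mul tendsto_log_floor_div_log.1
  have h2 := ((hlim.comp (tendsto_add_atTop_nat 1)).comp hf).mul tendsto_log_floor_div_log.2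
  rw [mul_one] at h1 h2
  refine tendsto_of_tendsto_of_tendsto_of_le_of_le' h1 h2 ?_ ?_
  · filter_upwards [eventually_ge_atTop (2 : ℝ)] with q hq
    have hlog : 0 < Real.log q := Real.log_pos (by linarith)
    have hn2 : 2 ≤ ⌊q⌋₊ := Nat.le_floor (by exact_mod_cast hq)
    have hn0 : (0 : ℝ) < ⌊q⌋₊ := by exact_mod_cast (show 0 < ⌊q⌋₊ by omega)
    have hnlog : 0 < Real.log ⌊q⌋₊ := Real.log_pos (by exact_mod_cast hn2)
    have h3 := log_massMoment_div_le hm hn0 (Nat.floor_le (by linarith)) (hpos _ (by omega))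
      (hfin q (by linarith))
    simp only [Function.comp_apply]
    calc _ = Real.log (massMoment P μ ⌊q⌋₊).toReal / ⌊q⌋₊ / Real.log q := by field_simp
      _ ≤ Real.log (massMoment P μ q).toReal / q / Real.log q := by gcongr
      _ = _ := by rw [div_div]
  · filter_upwards [eventually_ge_atTop (2 : ℝ)] with q hq
    have hlog : 0 < Real.log q := Real.log_pos (by linarith)
    have hqn : q ≤ ((⌊q⌋₊ + 1 : ℕ) : ℝ) := by push_cast; exact (Nat.lt_floor_add_one q).le
    have hnlog : 0 < Real.log ((⌊q⌋₊ + 1 : ℕ) : ℝ) := Real.log_pos (by linarith)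
    have hn0 : (0 : ℝ) < ((⌊q⌋₊ + 1 : ℕ) : ℝ) := by linarith
    have hq0 : 0 < massMoment P μ q :=
      massMoment_pos_of_le hm one_pos (by linarith) (by simpa using hpos 1 one_pos)
    have h3 := log_massMoment_div_le hm (by linarith) hqn hq0 (hfin _ (by linarith))
    simp only [Function.comp_apply]
    calc _ = Real.log (massMoment P μ q).toReal / q / Real.log q := by rw [div_div]
      _ ≤ Real.log (massMoment P μ ((⌊q⌋₊ + 1 : ℕ) : ℝ)).toReal / ((⌊q⌋₊ + 1 : ℕ) : ℝ)
          / Real.log q := by gcongr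
      _ = _ := by field_simp

namespace IsCascadeLimit

variable {σ : ℝ} {ν : Measure ℝ}

/-- The uniform upper bound for moments of order `n + 2`, with the spacing parameter `N = n + 2`. -/
lemma massMoment_le [IsProbabilityMeasure P] (hμ : IsCascadeLimit P Λ 0 1 X M μ)
    (h : SubcriticalNegative σ ν) (hν : IsLevyMeasure ν) (hν0 : ν ≠ 0)
    (hΛ : IsIndepScattered P (levyExponent (normDrift σ ν) σ ν) volume Λ) {η : ℝ}
    (hη : η = gam ν - secDiff (fun n => momentExp ν n) 0) (n : ℕ) :
    massMoment P μ (n + 2 : ℕ) ≤ ENNReal.ofReal ((n + 2).factorial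
      * ((4 / η * ((n + 2 : ℕ) : ℝ) ^ (-(1 - gam ν))) ^ n * Real.exp (n + 2 : ℕ) * (2 / η))) := by
  rw [massMoment_natCast]
  exact hμ.lintegral_mass_pow_le hΛ fun ε hε =>
    hμ.lintegral_mass_trunc_pow_le hΛ (h.isMomentSeq hν hΛ) (h.secDiff_nonneg hν)
      (h.sum_secDiff_le hν) h.2.2.2 hη (hη ▸ sub_pos.2 (h.secDiff_zero_lt hν hν0))
      (by positivity) hε n

lemma le_massMoment [IsProbabilityMeasure P] (hμ : IsCascadeLimit P Λ 0 1 X M μ)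
    (h : SubcriticalNegative σ ν) (hν : IsLevyMeasure ν) (hν0 : ν ≠ 0)
    (hΛ : IsIndepScattered P (levyExponent (normDrift σ ν) σ ν) volume Λ) {n : ℕ} (hn : 0 < n)
    (R : ℕ) :
    ENNReal.ofReal (n.factorial * ((1 / (2 * n)) ^ n
        * Real.exp ((∑ i ∈ Finset.range R, secDiff (fun n => momentExp ν n) i)
          * Real.log (n / (R + 1))) ^ (n - R)))
      ≤ massMoment P μ n := by
  obtain ⟨m, rfl⟩ : ∃ m, n = m + 1 := ⟨n - 1, by omega⟩
  rw [massMoment_natCast]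
  have hφ := h.isMomentSeq hν hΛ
  exact hμ.le_lintegral_mass_pow hΛ (ε₀ := 1 / (2 * (m + 1 : ℕ))) (by positivity)
    ENNReal.ofReal_ne_top
    (fun ε hε hε' => hμ.le_lintegral_mass_trunc_pow hΛ hφ (h.secDiff_nonneg hν) _ R hε hε')
    (fun ε hε _ => hμ.lintegral_mass_trunc_pow_le hΛ hφ (h.secDiff_nonneg hν)
      (h.sum_secDiff_le hν) h.2.2.2 rfl (sub_pos.2 (h.secDiff_zero_lt hν hν0)) one_pos hε m)

lemma massMoment_pos_and_lt_top [IsProbabilityMeasure P] (hμ : IsCascadeLimit P Λ 0 1 X M μ)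
    (h : SubcriticalNegative σ ν) (hν : IsLevyMeasure ν) (hν0 : ν ≠ 0)
    (hΛ : IsIndepScattered P (levyExponent (normDrift σ ν) σ ν) volume Λ) {q : ℝ} (hq : 1 < q) :
    0 < massMoment P μ q ∧ massMoment P μ q < ⊤ := by
  have hm := hμ.aemeasurable_mass hΛ
  constructor
  · have h1 : 0 < massMoment P μ 1 := by
      have := hμ.le_massMoment h hν hν0 hΛ one_pos 0
      rw [Nat.cast_one] at this
      exact lt_of_lt_of_le (ENNReal.ofReal_pos.2 (by positivity)) this
    exact massMoment_pos_of_le hm one_pos hq.le h1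
  · obtain ⟨n, hn⟩ := exists_nat_ge q
    have h1 : q ≤ ((n + 2 : ℕ) : ℝ) := by push_cast; linarith
    have h2 := massMoment_rpow_le hm (by linarith) h1
    have h3 := (hμ.massMoment_le h hν hν0 hΛ rfl n).trans_lt ENNReal.ofReal_lt_top
    exact (ENNReal.rpow_lt_top_iff_of_pos (by positivity)).1
      (h2.trans_lt (ENNReal.rpow_lt_top_of_nonneg (by positivity) h3.ne))

lemma log_massMoment_le [IsProbabilityMeasure P] (hμ : IsCascadeLimit P Λ 0 1 X M μ)
    (h : SubcriticalNegative σ ν) (hν : IsLevyMeasure ν) (hν0 : ν ≠ 0)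
    (hΛ : IsIndepScattered P (levyExponent (normDrift σ ν) σ ν) volume Λ) {η : ℝ}
    (hη : η = gam ν - secDiff (fun n => momentExp ν n) 0) {n : ℕ} (hn : 2 ≤ n) :
    Real.log (massMoment P μ n).toReal ≤ gam ν * n * Real.log n + 2 * (1 - gam ν) * Real.log n
      + (|Real.log (4 / η)| + 1 + |Real.log (2 / η)|) * n := by
  have hη0 : 0 < η := hη ▸ sub_pos.2 (h.secDiff_zero_lt hν hν0)
  obtain ⟨m, rfl⟩ : ∃ m, n = m + 2 := ⟨n - 2, by omega⟩
  have h1 := ENNReal.toReal_mono ENNReal.ofReal_ne_top (hμ.massMoment_le h hν hν0 hΛ hη m)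
  rw [ENNReal.toReal_ofReal (by positivity)] at h1
  have h2 := hμ.massMoment_pos_and_lt_top h hν hν0 hΛ (q := (m + 2 : ℕ))
    (by push_cast; linarith [(Nat.cast_nonneg m : (0 : ℝ) ≤ m)])
  have h3 := Real.log_le_log (ENNReal.toReal_pos h2.1.ne' h2.2.ne) h1
  have hN : (0 : ℝ) < (m + 2 : ℕ) := by positivity
  rw [Real.log_mul (by positivity) (by positivity), Real.log_mul (by positivity) (by positivity),
    Real.log_mul (by positivity) (by positivity), Real.log_pow, Real.log_exp,
    Real.log_mul (by positivity) (by positivity), Real.log_rpow hN] at h3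
  have h4 := log_factorial_le (m + 2)
  have h5 : (m : ℝ) = (m + 2 : ℕ) - 2 := by push_cast; ring
  set L := Real.log ((m + 2 : ℕ) : ℝ)
  set N : ℝ := ((m + 2 : ℕ) : ℝ)
  rw [h5] at h3
  have hN2 : 2 ≤ N := by simp only [N]; push_cast; linarith [(Nat.cast_nonneg m : (0 : ℝ) ≤ m)]
  have h6 : (N - 2) * Real.log (4 / η) ≤ N * |Real.log (4 / η)| := by
    calc _ ≤ (N - 2) * |Real.log (4 / η)| :=
          mul_le_mul_of_nonneg_left (le_abs_self _) (by linarith)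
      _ ≤ _ := mul_le_mul_of_nonneg_right (by linarith) (abs_nonneg _)
  have h7 : Real.log (2 / η) ≤ |Real.log (2 / η)| * N :=
    (le_abs_self _).trans (le_mul_of_one_le_right (abs_nonneg _) (by linarith))
  calc _ ≤ _ := h3
    _ ≤ N * L + (N * |Real.log (4 / η)| + (N - 2) * (-(1 - gam ν) * L) + N
        + |Real.log (2 / η)| * N) := by rw [mul_add]; gcongr
    _ = _ := by ring

lemma le_log_massMoment [IsProbabilityMeasure P] (hμ : IsCascadeLimit P Λ 0 1 X M μ)
    (h : SubcriticalNegative σ ν) (hν : IsLevyMeasure ν) (hν0 : ν ≠ 0)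
    (hΛ : IsIndepScattered P (levyExponent (normDrift σ ν) σ ν) volume Λ) {R n : ℕ} (hn : R < n)
    (hfin : massMoment P μ n < ⊤) :
    -n - n * Real.log 2 + (∑ i ∈ Finset.range R, secDiff (fun n => momentExp ν n) i)
        * ((n - R) * (Real.log n - Real.log (R + 1)))
      ≤ Real.log (massMoment P μ n).toReal := by
  have hn0 : 0 < n := by omega
  have hn' : (0 : ℝ) < n := by exact_mod_cast hn0
  have h1 := ENNReal.toReal_mono hfin.ne (hμ.le_massMoment h hν hν0 hΛ hn0 R)
  rw [ENNReal.toReal_ofReal (by positivity)] at h1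
  have h3 := Real.log_le_log (by positivity) h1
  rw [Real.log_mul (by positivity) (by positivity), Real.log_mul (by positivity) (by positivity),
    Real.log_pow, Real.log_pow, Real.log_exp, one_div, Real.log_inv,
    Real.log_mul two_ne_zero hn'.ne', Real.log_div hn'.ne' (by positivity),
    Nat.cast_sub hn.le] at h3
  have h4 := le_log_factorial hn0
  linarith

/-- In the subcritical negative case `log E(Z^q) ∼ γ q log q`. -/
theorem tendsto_log_massMoment_div [IsProbabilityMeasure P] (hμ : IsCascadeLimit P Λ 0 1 X M μ)
    (h : SubcriticalNegative σ ν) (hν : IsLevyMeasure ν) (hν0 : ν ≠ 0)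
    (hΛ : IsIndepScattered P (levyExponent (normDrift σ ν) σ ν) volume Λ) :
    Tendsto (fun q : ℝ => Real.log (massMoment P μ q).toReal / (q * Real.log q)) atTop
      (𝓝 (gam ν)) := by
  have hfin := fun (q : ℝ) (hq : 1 < q) => (hμ.massMoment_pos_and_lt_top h hν hν0 hΛ hq).2
  have hfin' : ∀ n : ℕ, 0 < n → massMoment P μ n < ⊤ := by
    intro n hn
    rcases Nat.lt_or_ge 1 n with h1 | h1
    · exact hfin n (by exact_mod_cast h1)
    · have hn1 : n = 1 := by omega
      have h2 := massMoment_rpow_le (hμ.aemeasurable_mass hΛ) one_pos (one_le_two (α := ℝ))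
      rw [div_one, ENNReal.rpow_one] at h2
      rw [hn1, Nat.cast_one]
      exact h2.trans_lt (ENNReal.rpow_lt_top_of_nonneg (by positivity) (hfin 2 one_lt_two).ne)
  refine tendsto_log_massMoment (hμ.aemeasurable_mass hΛ) (fun n hn => ?_) hfin
    (tendsto_div_mul_log (h.tendsto_sum_secDiff hν)
      (fun n hn => hμ.log_massMoment_le h hν hν0 hΛ rfl hn)
      (fun R n hRn => hμ.le_log_massMoment h hν hν0 hΛ hRn (hfin' n (by omega))))
  exact lt_of_lt_of_le (ENNReal.ofReal_pos.2 (by positivity)) (hμ.le_massMoment h hν hν0 hΛ hn 0)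

end IsCascadeLimit

end

end LogIDCascade

end

theorem mainTheorem2 {Ω : Type*} [MeasurableSpace Ω] (P : Measure Ω) [IsProbabilityMeasure P]
    (σ : ℝ) (ν : Measure ℝ) (hν : LogIDCascade.IsLevyMeasure ν) (hnontriv : σ ≠ 0 ∨ ν ≠ 0)
    (hI : Icc (0 : ℝ) 1 ⊆ LogIDCascade.expDomain ν)
    (Λ : Set ℍ → Ω → ℝ)
    (hΛ : LogIDCascade.IsIndepScattered P
      (LogIDCascade.levyExponent (LogIDCascade.normDrift σ ν) σ ν) volume Λ)
    (X : ℝ → ℝ → Ω → ℝ) (M : ℝ → Ω → FiniteMeasure ℝ) (μ : Ω → FiniteMeasure ℝ)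
    (hμ : LogIDCascade.IsCascadeLimit P Λ 0 1 X M μ) :
    ((∀ q : ℝ, 1 < q →
        0 < LogIDCascade.massMoment P μ q ∧ LogIDCascade.massMoment P μ q < ⊤) ↔
      LogIDCascade.SubcriticalNegative σ ν) ∧
    (LogIDCascade.SubcriticalNegative σ ν →
      Tendsto (fun q : ℝ => Real.log (LogIDCascade.massMoment P μ q).toReal / (q * Real.log q))
        atTop (𝓝 (LogIDCascade.gam ν))) := by
  have hν0 : LogIDCascade.SubcriticalNegative σ ν → ν ≠ 0 := fun h =>
    hnontriv.resolve_left (not_not.2 h.1)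
  exact ⟨⟨fun hα => (hμ.smallTimeBounded hΛ hα).subcriticalNegative hν,
    fun h _ hq => hμ.massMoment_pos_and_lt_top h hν (hν0 h) hΛ hq⟩,
    fun h => hμ.tendsto_log_massMoment_div h hν (hν0 h) hΛ⟩
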